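/- **Heaps.** Let $\mathsf{qName}$ and $\mathsf{qDangle}$ be disjoint countably infinite sets (qubit names and dangling names) and $\mathsf{qDomain}=\mathsf{qName}\cup\mathsf{qDangle}$. For a finite $d\subseteq\mathsf{qDomain}$ put $\mathcal H_d=\bigotimes_{x\in d}\mathbb C^2$. A quantum heap is a density operator $\rho$ on $\mathcal H_d$ for some finite $d=:\operatorname{dom}\rho$; $\rho|_{d'}$ is the partial trace of $\rho$ over $d\setminus d'$, and $\operatorname{supp}\rho=(\ker\rho)^\perp$. An operator written with a list $\bar q$ of qubits acts on these qubits and as the identity on the others. Projections are identified with subspaces. **Assertions.** Formulas are $$\psi::=\top\mid\bot\mid\top^*\mid\bar q\mapsto P\mid\neg\psi\mid\psi\wedge\psi\mid\psi\vee\psi\mid\psi\rightsquigarrow\psi\mid\psi*\psi\mid\psi\mathrel{-\!*}\psi,$$ where $\bar q$ is a finite list of distinct elements of $\mathsf{qName}$ and $P$ a projection on $\mathcal H_{\bar q}$. The meaning of $\psi$ assigns to every finite $d\subseteq\mathsf{qDomain}$ a subspace $[\![\psi]\!](d)\subseteq\mathcal H_d$: $\top$ and $\bot$ give $\mathcal H_d$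 and $0$; $\top^*$ gives $\mathcal H_\emptyset$ if $d=\emptyset$ and $0$ otherwise; $\bar q\mapsto P$ gives $P$ if $d=\bar q$ and $0$ otherwise; $\neg,\wedge,\vee$ are orthogonal complement, intersection and span, for each $d$; $[\![\psi\rightsquigarrow\varphi]\!](d)=[\![\psi]\!](d)^\perp\vee([\![\psi]\!](d)\wedge[\![\varphi]\!](d))$ (Sasaki hook); $$[\![\psi*\varphi]\!](d)=\bigvee_{d'\subseteq d}[\![\psi]\!](d')\otimes[\![\varphi]\!](d\setminus d'),\qquad [\![\psi\mathrel{-\!*}\varphi]\!](d)=\bigwedge_{d'\text{ finite},\,d'\cap d=\emptyset}\max\{R\subseteq\mathcal H_d:[\![\psi]\!](d')\otimes R\subseteq[\![\varphi]\!](d'\cup d)\}.$$ Write $\bar q\hookrightarrow P$ for $(\bar q\mapsto P)*\top$, $\rho\models\psi$ if $\operatorname{supp}\rho\subseteq[\![\psi]\!](\operatorname{dom}\rho)$, and $\psi\models\varphi$ if $[\![\psi]\!](d)\subseteq[\![\varphi]\!](d)$ for all finite $d$. Let $qbit(\psi)$ be the set of qubit names that occur in $\psi$. **Programs (Qwhile-hp).**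 $$S::=\mathtt{skip}\mid\mathtt{qalloc}(q)\mid\mathtt{qfree}(q)\mid[\bar q]:=|0\rangle\mid U[\bar q]\mid S;S\mid\mathbf{if}\ \square m\cdot M_P[\bar q]\to S_m\ \mathbf{fi}\mid\mathbf{while}\ M_P[\bar q]\ \mathbf{do}\ S\ \mathbf{end},$$ where $\bar q$ is a finite list of distinct qubit names, $U$ a unitary on $|\bar q|$ qubits, and $M_P=\{P_m\}$ a finite family of projections on $|\bar q|$ qubits with $\sum_mP_m=I$ (with $m\in\{0,1\}$ for while-loops). Configurations are pairs of a statement, or $\downarrow$ for termination, and a heap. The steps are: - $(\mathtt{skip},\rho)\to(\downarrow,\rho)$. - $([\bar q]:=|0\rangle,\rho)\to(\downarrow,\sum_i|0\rangle_{\bar q}\langle i|\,\rho\,|i\rangle_{\bar q}\langle0|)$ and $(U[\bar q],\rho)\to(\downarrow,U_{\bar q}\rho U_{\bar q}^\dagger)$, if $\bar q\subseteq\operatorname{dom}\rho$. - $(\mathtt{qalloc}(q),\rho)\to(\downarrow,\rho')$ for every dangling name $\sqcup\notin\operatorname{dom}\rho$ and every heap $\rho'$ with domain $d'\cup\{q\}$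 and $\rho'|_{d'}=\rho[q\Rightarrow\sqcup]$, where $d'=(\operatorname{dom}\rho)[q\Rightarrow\sqcup]$ and $[q\Rightarrow\sqcup]$ renames $q$ (if present) to $\sqcup$. - $(\mathtt{qfree}(q),\rho)\to(\downarrow,\rho|_{\operatorname{dom}\rho\setminus\{q\}})$ if $q\in\operatorname{dom}\rho$. - $(S_1;S_2,\rho)\to(S_1';S_2,\rho')$ if $(S_1,\rho)\to(S_1',\rho')$ with $S_1'\ne{\downarrow}$, and $(S_1;S_2,\rho)\to(S_2,\rho')$ if $(S_1,\rho)\to(\downarrow,\rho')$. - If $\bar q\subseteq\operatorname{dom}\rho$ and $\operatorname{tr}(P_m\rho)\ne0$, put $\rho_m=P_m\rho P_m/\operatorname{tr}(P_m\rho)$; the if-statement steps to $(S_m,\rho_m)$; the while-loop steps to $(\downarrow,\rho_0)$ for $m=0$ and to $(S;\mathbf{while}\ M_P[\bar q]\ \mathbf{do}\ S\ \mathbf{end},\rho_1)$ for $m=1$. Let $alloc(S)$ be the set of names $q$ such that $\mathtt{qalloc}(q)$ occurs in $S$. The triple $\models\{\psi\}S\{\varphi\}$ is valid if for every heap $\rho\models\psi$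 no configuration reachable from $(S,\rho)$ is stuck (not terminated and without a next step), and every $\rho'$ with $(S,\rho)\to^*(\downarrow,\rho')$ satisfies $\rho'\models\varphi$. **Proof system.** Relative to a relation $\Vdash$ between assertions, triples are derived by the rules: - Skip: $\{\psi\}\mathtt{skip}\{\psi\}$. Qalloc: $\{\top^*\}\mathtt{qalloc}(q)\{q\mapsto I\}$. Qfree: $\{q\mapsto I\}\mathtt{qfree}(q)\{\top^*\}$. Init: $\{\bar q\mapsto I\}[\bar q]:=|0\rangle\{\bar q\mapsto|0\rangle\langle0|\}$. - Unitary: $\{\bar q'\mapsto P\}U[\bar q]\{\bar q'\mapsto U_{\bar q}PU_{\bar q}^\dagger\}$ for $\bar q\subseteq\bar q'\subseteq\mathsf{qName}$. - Sequence: from $\{\psi\}S_1\{\varphi\}$ and $\{\varphi\}S_2\{\phi\}$ infer $\{\psi\}S_1;S_2\{\phi\}$. - Consequence: from $\psi\Vdash\psi'$, $\{\psi'\}S\{\varphi'\}$ and $\varphi'\Vdash\varphi$ infer $\{\psi\}S\{\varphi\}$. - If: from $\{\psi_m\}S_m\{\psi\}$ for all $m$ infer $\{(\bar q\hookrightarrow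 I)\wedge\bigwedge_m((\bar q\hookrightarrow P_m)\rightsquigarrow\psi_m)\}\ \mathbf{if}\ \square m\cdot M_P[\bar q]\to S_m\ \mathbf{fi}\ \{\psi\}$. - While: with $\theta=(\bar q\hookrightarrow I)\wedge((\bar q\hookrightarrow P_0)\rightsquigarrow\psi)\wedge((\bar q\hookrightarrow P_1)\rightsquigarrow\varphi)$, from $\{\varphi\}S\{\theta\}$ infer $\{\theta\}\ \mathbf{while}\ M_P[\bar q]\ \mathbf{do}\ S\ \mathbf{end}\ \{\psi\}$. - Conjunction and Disjunction: from $\{\psi_1\}S\{\varphi_1\}$ and $\{\psi_2\}S\{\varphi_2\}$ infer $\{\psi_1\wedge\psi_2\}S\{\varphi_1\wedge\varphi_2\}$ and $\{\psi_1\vee\psi_2\}S\{\varphi_1\vee\varphi_2\}$. - Frame: from $\{\psi\}S\{\varphi\}$ and $qbit(\phi)\cap alloc(S)=\emptyset$ infer $\{\psi*\phi\}S\{\varphi*\phi\}$. **Theorem (soundness and relative completeness).** Let $\psi,\varphi$ be assertions and $S$ a statement. 1. With $\Vdash$ the semantic entailment $\models$ (every valid entailment may be used), $\models\{\psi\}S\{\varphi\}$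 if and only if $\{\psi\}S\{\varphi\}$ is derivable. 2. (Soundness.) For any relation $\Vdash$ contained in $\models$, if $\{\psi\}S\{\varphi\}$ is derivable relative to $\Vdash$, then $\models\{\psi\}S\{\varphi\}$. 3. (Relative completeness.) For any relation $\Vdash$ that contains every valid entailment, if $\models\{\psi\}S\{\varphi\}$, then $\{\psi\}S\{\varphi\}$ is derivable relative to $\Vdash$. -/

import Mathlib

open scoped Matrix ComplexOrder

namespace QwhileHP

noncomputable section

/-! ## Qubit names, state spaces, operators -/

/-- The countably infinite set of qubit names. -/
abbrev QName := ℕ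

/-- The countably infinite set of dangling names. -/
abbrev QDangle := ℕ

/-- All names a heap can use: qubit names `Sum.inl q` and dangling names `Sum.inr s`. -/
abbrev QDomain := QName ⊕ QDangle

/-- Square matrices on `(ℂ²)^{⊗ι}`; the computational basis is indexed by the functions
`ι → Fin 2`. -/
abbrev Op (ι : Type) := Matrix (ι → Fin 2) (ι → Fin 2) ℂ

/-- The state space `H_d = ⨂_{q ∈ d} ℂ²` of a finite domain `d`. -/
abbrev H (d : Finset QDomain) := EuclideanSpace ℂ (d → Fin 2)

/-- Projection operators on `n` qubits. -/
abbrev Proj (n : ℕ) := {P : Op (Fin n) // IsStarProjection P}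

/-- The identity operator as a projection. -/
def Proj.one (n : ℕ) : Proj n := ⟨1, IsStarProjection.one _⟩

/-- The projection `|0…0⟩⟨0…0|`. -/
def Proj.zeroKet (n : ℕ) : Proj n :=
  ⟨Matrix.single 0 0 1, by
    constructor
    · simp [IsIdempotentElem]
    · simp [IsSelfAdjoint, Matrix.star_eq_conjTranspose, Matrix.conjTranspose_single]⟩

/-- Projective measurements on `n` qubits with outcomes `0, …, k-1`. -/
abbrev Measurement (n k : ℕ) := {P : Fin k → Proj n // ∑ m, (P m).1 = 1}

/-- `lift e A` is the operator `A ⊗ I` on `(ℂ²)^{⊗κ}` in which the `i`-th tensor factor of `A`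
acts on the factor `e i`, and the identity acts on the factors outside the range of `e`. -/
def lift {ι κ : Type} (e : ι ↪ κ) (A : Op ι) : Op κ :=
  open Classical in
  Matrix.of fun f g => if ∀ k, k ∉ Set.range e → f k = g k then A (f ∘ e) (g ∘ e) else 0

/-- The domain `{q₁, …, qₙ}` of a list of distinct qubit names. -/
def qdom {n : ℕ} (q : Fin n ↪ QName) : Finset QDomain :=
  Finset.univ.map (q.trans Function.Embedding.inl)

theorem mem_qdom {n : ℕ} (q : Fin n ↪ QName) (i : Fin n) : Sum.inl (q i) ∈ qdom q :=
  Finset.mem_map_of_mem _ (Finset.mem_univ i)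

/-- A list of distinct qubit names inside a domain, as positions in that domain. -/
def pos {n : ℕ} (q : Fin n ↪ QName) {d : Finset QDomain} (h : qdom q ⊆ d) : Fin n ↪ d where
  toFun i := ⟨Sum.inl (q i), h (mem_qdom q i)⟩
  inj' _ _ hij := q.injective (Sum.inl_injective (congrArg Subtype.val hij))

/-- `A_q ⊗ I_{d \ q}`: the operator `A` applied to the qubits `q` of the domain `d`. -/
def onQubits {n : ℕ} (q : Fin n ↪ QName) {d : Finset QDomain} (h : qdom q ⊆ d)
    (A : Op (Fin n)) : Op d :=
  lift (pos q h) A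

/-- The subspace `{v | P v = v}` that belongs to a projection operator `P`. -/
def projSpace {d : Finset QDomain} (P : Op d) : Submodule ℂ (H d) :=
  LinearMap.eqLocus (Matrix.toEuclideanLin P) LinearMap.id

/-- The support `(ρ^⊥)^⊥` of a positive operator, where `ρ^⊥` is the kernel. -/
def supp {d : Finset QDomain} (ρ : Op d) : Submodule ℂ (H d) :=
  (LinearMap.ker (Matrix.toEuclideanLin ρ))ᗮ

/-- The product vector `u ⊗ v` in `H_d`, for a partition of `d` into `d₁` and `d₂`. -/
def tmul {d₁ d₂ d : Finset QDomain} (h₁ : d₁ ⊆ d) (h₂ : d₂ ⊆ d) (u : H d₁) (v : H d₂) : H d :=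
  WithLp.toLp 2 fun f => u (fun x => f ⟨x.1, h₁ x.2⟩) * v (fun x => f ⟨x.1, h₂ x.2⟩)

/-- The tensor product `V ⊗ W ⊆ H_d` of two subspaces, for a partition of `d` into `d₁` and
`d₂`. -/
def tensor {d₁ d₂ d : Finset QDomain} (h₁ : d₁ ⊆ d) (h₂ : d₂ ⊆ d)
    (V : Submodule ℂ (H d₁)) (W : Submodule ℂ (H d₂)) : Submodule ℂ (H d) :=
  Submodule.span ℂ {x | ∃ u ∈ V, ∃ v ∈ W, x = tmul h₁ h₂ u v}

/-- Tensor implication: the largest subspace `W` of `H_{d₂}` with `V ⊗ W ⊆ Q`. -/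
def tensorImp {d₁ d₂ d : Finset QDomain} (h₁ : d₁ ⊆ d) (h₂ : d₂ ⊆ d)
    (V : Submodule ℂ (H d₁)) (Q : Submodule ℂ (H d)) : Submodule ℂ (H d₂) where
  carrier := {v | ∀ u ∈ V, tmul h₁ h₂ u v ∈ Q}
  zero_mem' u _ := by
    have : tmul h₁ h₂ u (0 : H d₂) = 0 := by ext f; simp [tmul]
    rw [this]; exact Q.zero_mem
  add_mem' {v w} hv hw u hu := by
    have : tmul h₁ h₂ u (v + w) = tmul h₁ h₂ u v + tmul h₁ h₂ u w := by
      ext f; simp [tmul, mul_add]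
    rw [this]; exact Q.add_mem (hv u hu) (hw u hu)
  smul_mem' c v hv u hu := by
    have : tmul h₁ h₂ u (c • v) = c • tmul h₁ h₂ u v := by
      ext f; simp [tmul, mul_left_comm]
    rw [this]; exact Q.smul_mem c (hv u hu)

theorem tensorImp_isGreatest {d₁ d₂ d : Finset QDomain} (h₁ : d₁ ⊆ d) (h₂ : d₂ ⊆ d)
    (V : Submodule ℂ (H d₁)) (Q : Submodule ℂ (H d)) :
    IsGreatest {W | tensor h₁ h₂ V W ≤ Q} (tensorImp h₁ h₂ V Q) := by
  constructor
  · refine Submodule.span_le.2 ?_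
    rintro x ⟨u, hu, v, hv, rfl⟩
    exact hv u hu
  · intro W hW v hv u hu
    exact hW (Submodule.subset_span ⟨u, hu, v, hv, rfl⟩)

/-! ## Quantum heaps -/

/-- Density operators on `H_d`. -/
abbrev Density (d : Finset QDomain) := {ρ : Op d // ρ.PosSemidef ∧ ρ.trace = 1}

/-- Quantum heaps: a finite domain together with a density operator on its state space. -/
abbrev QHeap := Σ d : Finset QDomain, Density d

/-- Combine basis labels of `d'` and of `d \ d'` into a basis label of `d`. -/
def glue {d' d : Finset QDomain} (f : d' → Fin 2) (k : (d \ d' : Finset QDomain) → Fin 2) :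
    d → Fin 2 :=
  fun x => if hx : x.1 ∈ d' then f ⟨x.1, hx⟩ else k ⟨x.1, Finset.mem_sdiff.2 ⟨x.2, hx⟩⟩

/-- The restriction `ρ|_{d'}`: the partial trace over the qubits in `d \ d'`, for `d' ⊆ d`. -/
def restr (d' : Finset QDomain) {d : Finset QDomain} (ρ : Op d) : Op d' :=
  Matrix.of fun f g => ∑ k : (d \ d' : Finset QDomain) → Fin 2, ρ (glue f k) (glue g k)

/-- `d[q ⇒ s]`, for a dangling name `s` outside `d`: then the transposition of `q` and `s`
replaces `q` by `s` if `q ∈ d`, and otherwise leaves `d` as it is. -/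
def renameDom (q : QName) (s : QDangle) (d : Finset QDomain) : Finset QDomain :=
  d.map (Equiv.swap (Sum.inl q : QDomain) (Sum.inr s)).toEmbedding

theorem renameDom_eq_image (q : QName) (s : QDangle) {d : Finset QDomain}
    (hs : Sum.inr s ∉ d) :
    renameDom q s d = d.image fun x => if x = Sum.inl q then Sum.inr s else x := by
  ext x
  simp only [renameDom, Finset.mem_map, Finset.mem_image]
  constructor <;>
  · rintro ⟨y, hy, rfl⟩
    refine ⟨y, hy, ?_⟩
    have : y ≠ Sum.inr s := by rintro rfl; exact hs hy
    simp [Equiv.swap_apply_def, this]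

/-- `ρ[q ⇒ s]`, for a dangling name `s` outside the domain `d` of `ρ`. -/
def renameOp (q : QName) (s : QDangle) {d : Finset QDomain} (ρ : Op d) :
    Op (renameDom q s d) :=
  let pull : (renameDom q s d → Fin 2) → (d → Fin 2) := fun f x =>
    f ⟨Equiv.swap (Sum.inl q : QDomain) (Sum.inr s) x.1, Finset.mem_map_of_mem _ x.2⟩
  ρ.submatrix pull pull

/-! ## Assertions -/

/-- Formulas of the quantum BI-style logic. In `pointsTo q P` the `i`-th tensor factor of `P`
belongs to the qubit `q i`. -/
inductive Assr : Type
  | top : Assr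
  | bot : Assr
  | emp : Assr
  | pointsTo {n : ℕ} (q : Fin n ↪ QName) (P : Proj n) : Assr
  | neg (ψ : Assr) : Assr
  | and (ψ φ : Assr) : Assr
  | or (ψ φ : Assr) : Assr
  | hook (ψ φ : Assr) : Assr
  | sep (ψ φ : Assr) : Assr
  | wand (ψ φ : Assr) : Assr

/-- The semantics of an assertion: a subspace of `H_d` for each finite domain `d`. -/
def den : Assr → (d : Finset QDomain) → Submodule ℂ (H d)
  | .top, _ => ⊤
  | .bot, _ => ⊥
  | .emp, d => if d = ∅ then ⊤ else ⊥
  | .pointsTo q P, d =>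
      if h : qdom q = d then projSpace (onQubits q h.subset P.1) else ⊥
  | .neg ψ, d => (den ψ d)ᗮ
  | .and ψ φ, d => den ψ d ⊓ den φ d
  | .or ψ φ, d => den ψ d ⊔ den φ d
  | .hook ψ φ, d => (den ψ d)ᗮ ⊔ (den ψ d ⊓ den φ d)
  | .sep ψ φ, d =>
      ⨆ (d' : Finset QDomain) (h : d' ⊆ d),
        tensor h Finset.sdiff_subset (den ψ d') (den φ (d \ d'))
  | .wand ψ φ, d =>
      ⨅ (d' : Finset QDomain) (_ : Disjoint d' d),
        tensorImp Finset.subset_union_left Finset.subset_union_right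
          (den ψ d') (den φ (d' ∪ d))

/-- The qubit names that occur in an assertion. -/
def qbit : Assr → Set QName
  | .top => ∅
  | .bot => ∅
  | .emp => ∅
  | .pointsTo q _ => Set.range q
  | .neg ψ => qbit ψ
  | .and ψ φ => qbit ψ ∪ qbit φ
  | .or ψ φ => qbit ψ ∪ qbit φ
  | .hook ψ φ => qbit ψ ∪ qbit φ
  | .sep ψ φ => qbit ψ ∪ qbit φ
  | .wand ψ φ => qbit ψ ∪ qbit φ

/-- Satisfaction `ρ ⊨ ψ`. -/
def Sat (ρ : QHeap) (ψ : Assr) : Prop := supp ρ.2.1 ≤ den ψ ρ.1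

/-- Entailment `ψ ⊨ φ`. -/
def Entails (ψ φ : Assr) : Prop := ∀ d : Finset QDomain, den ψ d ≤ den φ d

/-- `q ↪ P`, that is `(q ↦ P) * ⊤`. -/
def Assr.contains {n : ℕ} (q : Fin n ↪ QName) (P : Proj n) : Assr :=
  .sep (.pointsTo q P) .top

/-- The conjunction `⋀_{m < k} ψ m`. -/
def Assr.bigAnd {k : ℕ} (ψ : Fin k → Assr) : Assr := (List.ofFn ψ).foldr .and .top

/-! ## Programs -/

/-- Statements of the language Qwhile-hp. An ordered list of distinct qubits is an injection
`q : Fin n ↪ QName`. -/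
inductive Stmt : Type
  | skip : Stmt
  | qalloc (q : QName) : Stmt
  | qfree (q : QName) : Stmt
  | reset {n : ℕ} (q : Fin n ↪ QName) : Stmt
  | unitary {n : ℕ} (U : Matrix.unitaryGroup (Fin n → Fin 2) ℂ) (q : Fin n ↪ QName) : Stmt
  | seq (S₁ S₂ : Stmt) : Stmt
  | ifMeas {n k : ℕ} (M : Measurement n k) (q : Fin n ↪ QName) (S : Fin k → Stmt) : Stmt
  | whileMeas {n : ℕ} (M : Measurement n 2) (q : Fin n ↪ QName) (S : Stmt) : Stmt

/-- The qubit names that a statement allocates. -/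
def alloc : Stmt → Set QName
  | .skip => ∅
  | .qalloc q => {q}
  | .qfree _ => ∅
  | .reset _ => ∅
  | .unitary _ _ => ∅
  | .seq S₁ S₂ => alloc S₁ ∪ alloc S₂
  | .ifMeas _ _ S => ⋃ m, alloc (S m)
  | .whileMeas _ _ S => alloc S

/-- `A ρ A†`, with `A` acting on the qubits `q`. -/
def act {n : ℕ} (q : Fin n ↪ QName) {d : Finset QDomain} (h : qdom q ⊆ d) (A : Op (Fin n))
    (ρ : Op d) : Op d :=
  onQubits q h A * ρ * (onQubits q h A)ᴴ

/-- Program configurations; `none` is the symbol `↓` of successful termination. -/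
abbrev Config := Option Stmt × QHeap

/-- One step of the operational semantics. -/
inductive Step : Config → Config → Prop
  | skip (ρ : QHeap) : Step (some .skip, ρ) (none, ρ)
  | reset {n : ℕ} (q : Fin n ↪ QName) {d : Finset QDomain} (h : qdom q ⊆ d) (ρ ρ' : Density d)
      (hρ' : ρ'.1 = ∑ i : Fin n → Fin 2, act q h (Matrix.single 0 i 1) ρ.1) :
      Step (some (.reset q), ⟨d, ρ⟩) (none, ⟨d, ρ'⟩)
  | unitary {n : ℕ} (U : Matrix.unitaryGroup (Fin n → Fin 2) ℂ) (q : Fin n ↪ QName)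
      {d : Finset QDomain} (h : qdom q ⊆ d) (ρ ρ' : Density d)
      (hρ' : ρ'.1 = act q h U.1 ρ.1) :
      Step (some (.unitary U q), ⟨d, ρ⟩) (none, ⟨d, ρ'⟩)
  | qalloc (q : QName) (s : QDangle) {d : Finset QDomain} (hs : Sum.inr s ∉ d) (ρ : Density d)
      (ρ' : Density (insert (Sum.inl q) (renameDom q s d)))
      (hρ' : restr (renameDom q s d) ρ'.1 = renameOp q s ρ.1) :
      Step (some (.qalloc q), ⟨d, ρ⟩) (none, ⟨_, ρ'⟩)
  | qfree (q : QName) {d : Finset QDomain} (hq : Sum.inl q ∈ d) (ρ : Density d)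
      (ρ' : Density (d.erase (Sum.inl q))) (hρ' : ρ'.1 = restr (d.erase (Sum.inl q)) ρ.1) :
      Step (some (.qfree q), ⟨d, ρ⟩) (none, ⟨_, ρ'⟩)
  | seqStep {S₁ S₁' : Stmt} (S₂ : Stmt) {ρ ρ' : QHeap} :
      Step (some S₁, ρ) (some S₁', ρ') → Step (some (.seq S₁ S₂), ρ) (some (.seq S₁' S₂), ρ')
  | seqDone {S₁ : Stmt} (S₂ : Stmt) {ρ ρ' : QHeap} :
      Step (some S₁, ρ) (none, ρ') → Step (some (.seq S₁ S₂), ρ) (some S₂, ρ')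
  | ifMeas {n k : ℕ} (M : Measurement n k) (q : Fin n ↪ QName) (S : Fin k → Stmt) (m : Fin k)
      {d : Finset QDomain} (h : qdom q ⊆ d) (ρ ρ' : Density d)
      (hm : (onQubits q h (M.1 m).1 * ρ.1).trace ≠ 0)
      (hρ' : ρ'.1 = (onQubits q h (M.1 m).1 * ρ.1).trace⁻¹ • act q h (M.1 m).1 ρ.1) :
      Step (some (.ifMeas M q S), ⟨d, ρ⟩) (some (S m), ⟨d, ρ'⟩)
  | whileDone {n : ℕ} (M : Measurement n 2) (q : Fin n ↪ QName) (S : Stmt)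
      {d : Finset QDomain} (h : qdom q ⊆ d) (ρ ρ' : Density d)
      (hm : (onQubits q h (M.1 0).1 * ρ.1).trace ≠ 0)
      (hρ' : ρ'.1 = (onQubits q h (M.1 0).1 * ρ.1).trace⁻¹ • act q h (M.1 0).1 ρ.1) :
      Step (some (.whileMeas M q S), ⟨d, ρ⟩) (none, ⟨d, ρ'⟩)
  | whileLoop {n : ℕ} (M : Measurement n 2) (q : Fin n ↪ QName) (S : Stmt)
      {d : Finset QDomain} (h : qdom q ⊆ d) (ρ ρ' : Density d)
      (hm : (onQubits q h (M.1 1).1 * ρ.1).trace ≠ 0)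
      (hρ' : ρ'.1 = (onQubits q h (M.1 1).1 * ρ.1).trace⁻¹ • act q h (M.1 1).1 ρ.1) :
      Step (some (.whileMeas M q S), ⟨d, ρ⟩) (some (.seq S (.whileMeas M q S)), ⟨d, ρ'⟩)

/-- The set `⟦S⟧ρ` of output heaps of successfully terminating executions. -/
def outputs (S : Stmt) (ρ : QHeap) : Set QHeap :=
  {ρ' | Relation.ReflTransGen Step (some S, ρ) (none, ρ')}

/-- No execution of `S` from `ρ` gets stuck: every configuration reached is terminated or can make
another step. -/
def Safe (S : Stmt) (ρ : QHeap) : Prop :=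
  ∀ (S' : Stmt) (ρ' : QHeap), Relation.ReflTransGen Step (some S, ρ) (some S', ρ') →
    ∃ c : Config, Step (some S', ρ') c

/-- Validity `⊨ {ψ} S {φ}` of a correctness triple. -/
def Valid (ψ : Assr) (S : Stmt) (φ : Assr) : Prop :=
  ∀ ρ : QHeap, Sat ρ ψ → Safe S ρ ∧ ∀ ρ' ∈ outputs S ρ, Sat ρ' φ

/-! ## The proof system -/

/-- The precondition `(q ↪ I) ∧ (q ↪ P₀ ⇝ ψ) ∧ (q ↪ P₁ ⇝ φ)` of the while rule. -/
def whilePre {n : ℕ} (M : Measurement n 2) (q : Fin n ↪ QName) (ψ φ : Assr) : Assr :=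
  .and (.contains q (Proj.one n))
    (.and (.hook (.contains q (M.1 0)) ψ) (.hook (.contains q (M.1 1)) φ))

/-- Derivability `⊢ {ψ} S {φ}` in the small-axiom proof system, where the consequence rule takes
its entailments between assertions from `Ent`. -/
inductive Derivable (Ent : Assr → Assr → Prop) : Assr → Stmt → Assr → Prop
  | skip (ψ : Assr) : Derivable Ent ψ .skip ψ
  | qalloc (q : QName) :
      Derivable Ent .emp (.qalloc q)
        (.pointsTo (n := 1) ⟨fun _ => q, fun _ _ _ => Subsingleton.elim _ _⟩ (Proj.one 1))
  | qfree (q : QName) :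
      Derivable Ent
        (.pointsTo (n := 1) ⟨fun _ => q, fun _ _ _ => Subsingleton.elim _ _⟩ (Proj.one 1))
        (.qfree q) .emp
  | reset {n : ℕ} (q : Fin n ↪ QName) :
      Derivable Ent (.pointsTo q (Proj.one n)) (.reset q) (.pointsTo q (Proj.zeroKet n))
  /- The qubits `q i = q' (e i)` are among the qubits `q'`, and `P' = U_q P U_q†` on `q'`. -/
  | unitary {n n' : ℕ} (U : Matrix.unitaryGroup (Fin n → Fin 2) ℂ) (q : Fin n ↪ QName)
      (q' : Fin n' ↪ QName) (e : Fin n ↪ Fin n') (he : ∀ i, q' (e i) = q i)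
      (P P' : Proj n') (hP' : P'.1 = lift e U.1 * P.1 * (lift e U.1)ᴴ) :
      Derivable Ent (.pointsTo q' P) (.unitary U q) (.pointsTo q' P')
  | seq {ψ φ χ : Assr} {S₁ S₂ : Stmt} :
      Derivable Ent ψ S₁ φ → Derivable Ent φ S₂ χ → Derivable Ent ψ (.seq S₁ S₂) χ
  | consequence {ψ ψ' φ φ' : Assr} {S : Stmt} :
      Ent ψ ψ' → Derivable Ent ψ' S φ' → Ent φ' φ → Derivable Ent ψ S φ
  | ifMeas {n k : ℕ} (M : Measurement n k) (q : Fin n ↪ QName) (S : Fin k → Stmt)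
      (ψ : Fin k → Assr) (φ : Assr) :
      (∀ m, Derivable Ent (ψ m) (S m) φ) →
      Derivable Ent
        (.and (.contains q (Proj.one n))
          (.bigAnd fun m => .hook (.contains q (M.1 m)) (ψ m)))
        (.ifMeas M q S) φ
  | whileMeas {n : ℕ} (M : Measurement n 2) (q : Fin n ↪ QName) (S : Stmt) (ψ φ : Assr) :
      Derivable Ent φ S (whilePre M q ψ φ) →
      Derivable Ent (whilePre M q ψ φ) (.whileMeas M q S) ψ
  | conjunction {ψ₁ ψ₂ φ₁ φ₂ : Assr} {S : Stmt} :
      Derivable Ent ψ₁ S φ₁ → Derivable Ent ψ₂ S φ₂ →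
      Derivable Ent (.and ψ₁ ψ₂) S (.and φ₁ φ₂)
  | disjunction {ψ₁ ψ₂ φ₁ φ₂ : Assr} {S : Stmt} :
      Derivable Ent ψ₁ S φ₁ → Derivable Ent ψ₂ S φ₂ →
      Derivable Ent (.or ψ₁ ψ₂) S (.or φ₁ φ₂)
  | frame {ψ φ χ : Assr} {S : Stmt} :
      Derivable Ent ψ S φ → qbit χ ∩ alloc S = ∅ →
      Derivable Ent (.sep ψ χ) S (.sep φ χ)

end

end QwhileHP

/-!
A vector of `H d` is read as a function of the labels of *all* names that depends only on the names
in `d` (`amp`, `cyl`). The tensor product of vectors is then the pointwise product, the tensor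
product of subspaces is the product of submodules of a commutative algebra, and domains disappear
from the types. An assertion becomes a family of submodules, one for each domain (`denA`).

**Weakest preconditions.** A statement `S` and a postcondition, again a family of subspaces, have
a weakest precondition `wp S`, defined by recursion on `S`; for a loop it is the greatest fixed
point of the unrolling. The support of the image of a state under a completely positive map is
spanned by the images of its support under the Kraus operators (`matSupp_kraus_le_iff`). Hence a
heap runs correctly if and only if its support lies in the weakest precondition: "if" because `wp`
is an invariant of execution (`Inv.step`, `Inv.progress`), "only if" because the supports of all
correct heaps span a family that is a post-fixed point at each loop (`Correct.satF_wp`). So validity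
of a triple is the inclusion `denA ψ ≤ wp S (denA φ)` (`valid_iff`), and soundness is a rule by rule
check of such inclusions. For the frame rule, a statement acts on its own factor of a product,
except that allocating `q` renames a qubit `q` of the other factor to a dangling name
(`star_wp_le`); the frame assertion does not notice this if `q` does not occur in it.

**Locality.** That last fact, and completeness, rest on a normal form. An assertion whose qubit
names lie in a finite set `Q` sees of a domain `d` only `d ∩ Q` and, up to some bound `N`, the
number of the other names, and on these other names it denotes a full tensor factor (`Local`,
`exists_local_denA`). Weakest preconditions preserve locality with the same `Q` and `N`
(`Local.wp`). Conversely a local family amounts to finitely many subspaces, one for each type of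
domains, and is the meaning of a finite disjunction of assertions `(q ↦ P) * χ`, where `χ` only
restricts the names of a domain (`Local.exists_normal_form`). So weakest preconditions of assertions
are assertions, which reduces completeness to the atomic statements. The triples for `qfree` and
reset come from the frame rule with the frames `φ` and `(q ↦ |0⟩⟨0|) -* φ`. For a unitary, whose
qubits may be entangled with others, the normal form of the precondition is derived disjunct by
disjunct. For `qalloc q`, the precondition is local for the names other than `q`
(`Local.allocPre`), so its normal form does not mention `q` and can be framed.
-/

namespace QwhileHP

noncomputable section

/-! ### Supports of positive operators and Kraus maps -/

/-- The orthogonal complement of the kernel of a square matrix; on the operators of a heap this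
is `supp`. -/
def matSupp {n : Type*} [Fintype n] [DecidableEq n] (ρ : Matrix n n ℂ) :
    Submodule ℂ (EuclideanSpace ℂ n) :=
  (LinearMap.ker (Matrix.toEuclideanLin ρ))ᗮ

section Kraus

variable {n m κ : Type*} [Fintype n] [Fintype m] [Fintype κ]

theorem posSemidef_kraus (K : κ → Matrix m n ℂ) {ρ : Matrix n n ℂ} (hρ : ρ.PosSemidef) :
    (∑ i, K i * ρ * (K i)ᴴ).PosSemidef :=
  Matrix.posSemidef_sum _ fun i _ => hρ.mul_mul_conjTranspose_same (K i)

theorem trace_kraus (K : κ → Matrix m n ℂ) (ρ : Matrix n n ℂ) :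
    (∑ i, K i * ρ * (K i)ᴴ).trace = ((∑ i, (K i)ᴴ * K i) * ρ).trace := by
  rw [Matrix.trace_sum, Finset.sum_mul, Matrix.trace_sum]
  refine Finset.sum_congr rfl fun i _ => ?_
  rw [Matrix.trace_mul_comm, Matrix.mul_assoc]

theorem mul_conjTranspose_eq_zero_of_trace {ρ P : Matrix n n ℂ} (hρ : ρ.PosSemidef)
    (hP : IsStarProjection P) (h : (P * ρ).trace = 0) : P * ρ * Pᴴ = 0 := by
  have hs : Pᴴ = P := hP.2
  have h1 := (hρ.mul_mul_conjTranspose_same P).trace_eq_zero_iff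
  rw [← h1, Matrix.trace_mul_comm, hs, ← Matrix.mul_assoc, hP.1.eq, h]

variable [DecidableEq n] [DecidableEq m]

theorem matSupp_le_iff {ρ : Matrix n n ℂ} {W : Submodule ℂ (EuclideanSpace ℂ n)} :
    matSupp ρ ≤ W ↔ ∀ x ∈ Wᗮ, Matrix.toEuclideanLin ρ x = 0 := by
  constructor
  · intro h x hx
    have := Submodule.orthogonal_le h hx
    rw [matSupp, Submodule.orthogonal_orthogonal] at this
    exact this
  · intro h
    have h2 : Wᗮ ≤ LinearMap.ker (Matrix.toEuclideanLin ρ) := fun x hx => h x hx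
    have := Submodule.orthogonal_le h2
    rwa [Submodule.orthogonal_orthogonal] at this

theorem apply_eq_zero_iff_orthogonal_matSupp {ρ : Matrix n n ℂ} {x : EuclideanSpace ℂ n} :
    Matrix.toEuclideanLin ρ x = 0 ↔ x ∈ (matSupp ρ)ᗮ := by
  rw [matSupp, Submodule.orthogonal_orthogonal]; rfl

theorem inner_toEuclideanLin (A : Matrix m n ℂ) (x : EuclideanSpace ℂ m)
    (y : EuclideanSpace ℂ n) :
    inner ℂ x (Matrix.toEuclideanLin A y) = inner ℂ (Matrix.toEuclideanLin Aᴴ x) y := by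
  rw [Matrix.toEuclideanLin_conjTranspose_eq_adjoint, LinearMap.adjoint_inner_left]

theorem toEuclideanLin_eq_zero_iff_inner {ρ : Matrix n n ℂ} (hρ : ρ.PosSemidef)
    (x : EuclideanSpace ℂ n) :
    Matrix.toEuclideanLin ρ x = 0 ↔ inner ℂ x (Matrix.toEuclideanLin ρ x) = 0 := by
  have h := hρ.dotProduct_mulVec_zero_iff x.ofLp
  rw [EuclideanSpace.inner_eq_star_dotProduct, Matrix.ofLp_toLpLin, Matrix.toLin'_apply,
    dotProduct_comm, h]
  constructor
  · intro h0
    simpa using congrArg WithLp.ofLp h0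
  · intro h0
    ext i
    simpa using congrFun h0 i

theorem inner_toEuclideanLin_nonneg {ρ : Matrix n n ℂ} (hρ : ρ.PosSemidef)
    (x : EuclideanSpace ℂ n) : 0 ≤ inner ℂ x (Matrix.toEuclideanLin ρ x) := by
  rw [EuclideanSpace.inner_eq_star_dotProduct, Matrix.ofLp_toLpLin, Matrix.toLin'_apply,
    dotProduct_comm]
  exact hρ.dotProduct_mulVec_nonneg _

/-- The support of the image of `ρ` under the completely positive map with Kraus operators `K i`
is generated by the images of the support of `ρ`: a sum of positive operators kills a vector only
if each summand does. -/
theorem matSupp_kraus_le_iff (K : κ → Matrix m n ℂ) {ρ : Matrix n n ℂ} (hρ : ρ.PosSemidef)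
    {W : Submodule ℂ (EuclideanSpace ℂ m)} :
    matSupp (∑ i, K i * ρ * (K i)ᴴ) ≤ W ↔
      ∀ i, matSupp ρ ≤ W.comap (Matrix.toEuclideanLin (K i)) := by
  have key : ∀ x : EuclideanSpace ℂ m,
      Matrix.toEuclideanLin (∑ i, K i * ρ * (K i)ᴴ) x = 0 ↔
        ∀ i, Matrix.toEuclideanLin ρ (Matrix.toEuclideanLin (K i)ᴴ x) = 0 := by
    intro x
    rw [toEuclideanLin_eq_zero_iff_inner (posSemidef_kraus K hρ)]
    have e : inner ℂ x (Matrix.toEuclideanLin (∑ i, K i * ρ * (K i)ᴴ) x) =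
        ∑ i, inner ℂ (Matrix.toEuclideanLin (K i)ᴴ x)
          (Matrix.toEuclideanLin ρ (Matrix.toEuclideanLin (K i)ᴴ x)) := by
      rw [map_sum, LinearMap.sum_apply, inner_sum]
      refine Finset.sum_congr rfl fun i _ => ?_
      rw [← inner_toEuclideanLin, Matrix.mul_assoc, Matrix.toLpLin_mul 2 2 2,
        Matrix.toLpLin_mul 2 2 2]
      rfl
    rw [e, Finset.sum_eq_zero_iff_of_nonneg fun i _ => inner_toEuclideanLin_nonneg hρ _]
    simp [toEuclideanLin_eq_zero_iff_inner hρ]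
  rw [matSupp_le_iff]
  constructor
  · intro h i u hu
    rw [Submodule.mem_comap, ← Submodule.orthogonal_orthogonal W, Submodule.mem_orthogonal]
    intro x hx
    have h1 := (key x).1 (h x hx) i
    rw [apply_eq_zero_iff_orthogonal_matSupp] at h1
    rw [inner_toEuclideanLin]
    exact (Submodule.mem_orthogonal' _ _).1 h1 u hu
  · intro h x hx
    refine (key x).2 fun i => ?_
    rw [apply_eq_zero_iff_orthogonal_matSupp, Submodule.mem_orthogonal']
    intro u hu
    rw [← inner_toEuclideanLin]
    exact (Submodule.mem_orthogonal' _ _).1 hx _ (h i hu)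

theorem matSupp_conj_le_iff (K : Matrix m n ℂ) {ρ : Matrix n n ℂ} (hρ : ρ.PosSemidef)
    {W : Submodule ℂ (EuclideanSpace ℂ m)} :
    matSupp (K * ρ * Kᴴ) ≤ W ↔ matSupp ρ ≤ W.comap (Matrix.toEuclideanLin K) := by
  have := matSupp_kraus_le_iff (fun _ : Unit => K) hρ (W := W)
  simpa using this

theorem matSupp_smul (ρ : Matrix n n ℂ) {c : ℂ} (hc : c ≠ 0) :
    matSupp (c • ρ) = matSupp ρ := by
  rw [matSupp, matSupp, map_smul]
  congr 1
  ext x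
  simp [hc]

theorem matSupp_zero : matSupp (0 : Matrix n n ℂ) = ⊥ := by
  rw [matSupp, map_zero, LinearMap.ker_zero, Submodule.top_orthogonal_eq_bot]

/-- The pure state `|v⟩⟨v| / ⟨v, v⟩`. -/
theorem exists_pure_state {v : EuclideanSpace ℂ n} (hv : v ≠ 0) :
    ∃ ρ : Matrix n n ℂ, (ρ.PosSemidef ∧ ρ.trace = 1) ∧ v ∈ matSupp ρ ∧
      ∀ W : Submodule ℂ (EuclideanSpace ℂ n), v ∈ W → matSupp ρ ≤ W := by
  have hv' : v.ofLp ≠ 0 := fun h => hv (by ext i; simpa using congrFun h i)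
  have hpos : 0 < star v.ofLp ⬝ᵥ v.ofLp := Matrix.dotProduct_star_self_pos_iff.2 hv'
  set c := star v.ofLp ⬝ᵥ v.ofLp with hc
  have happ : ∀ x : EuclideanSpace ℂ n,
      Matrix.toEuclideanLin (Matrix.vecMulVec v.ofLp (star v.ofLp)) x = inner ℂ v x • v := by
    intro x
    ext i
    simp [Matrix.toLpLin_apply, Matrix.vecMulVec_mulVec, EuclideanSpace.inner_eq_star_dotProduct,
      dotProduct_comm, mul_comm]
  refine ⟨c⁻¹ • Matrix.vecMulVec v.ofLp (star v.ofLp), ⟨?_, ?_⟩, ?_, ?_⟩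
  · exact (Matrix.posSemidef_vecMulVec_self_star _).smul (inv_nonneg.2 hpos.le)
  · rw [Matrix.trace_smul, Matrix.trace_vecMulVec, dotProduct_comm, ← hc, smul_eq_mul,
      inv_mul_cancel₀ hpos.ne']
  · rw [matSupp_smul _ (inv_ne_zero hpos.ne'), matSupp, Submodule.mem_orthogonal']
    intro x hx
    rw [LinearMap.mem_ker, happ] at hx
    exact (smul_eq_zero.1 hx).resolve_right hv
  · intro W hW
    rw [matSupp_smul _ (inv_ne_zero hpos.ne'), matSupp_le_iff]
    intro x hx
    rw [happ, (Submodule.mem_orthogonal _ _).1 hx v hW, zero_smul]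

theorem matSupp_ne_bot {ρ : Matrix n n ℂ} (h : ρ.trace = 1) : matSupp ρ ≠ ⊥ := by
  intro h0
  have : Matrix.toEuclideanLin ρ = 0 := by
    ext1 x
    exact matSupp_le_iff.1 h0.le x (by simp)
  have : ρ = 0 := by simpa using this
  simp [this] at h

end Kraus

/-! ### Vectors as functions of all basis labels -/

/-- Basis labels of all names at once. -/
abbrev Label := QDomain → Fin 2

/-- Amplitude functions. A vector of `H d` is read as a function of all labels that depends only
on the names in `d`; the tensor product of vectors then becomes the pointwise product, and the
tensor product of subspaces the product of submodules of the algebra `Amp`. -/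
abbrev Amp := Label → ℂ

/-- The amplitude function of a vector. -/
def amp (d : Finset QDomain) : H d →ₗ[ℂ] Amp where
  toFun v f := v fun x => f x.1
  map_add' _ _ := rfl
  map_smul' _ _ := rfl

/-- The amplitude functions that depend only on the names in `d`. -/
def cyl (d : Finset QDomain) : Submodule ℂ Amp where
  carrier := {a | ∀ f g : Label, (∀ x ∈ d, f x = g x) → a f = a g}
  zero_mem' _ _ _ := rfl
  add_mem' ha hb f g h := congrArg₂ (· + ·) (ha f g h) (hb f g h)
  smul_mem' c _ ha f g h := congrArg (c • ·) (ha f g h)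

/-- A label of the names in `c`, extended by `0`. -/
def zeroExt {c : Finset QDomain} (j : c → Fin 2) : Label :=
  fun x => if h : x ∈ c then j ⟨x, h⟩ else 0

theorem zeroExt_apply {c : Finset QDomain} (j : c → Fin 2) (x : c) : zeroExt j x.1 = j x := by
  simp [zeroExt]

theorem amp_apply (d : Finset QDomain) (v : H d) (f : Label) : amp d v f = v fun x => f x.1 := rfl

theorem amp_mem_cyl {d : Finset QDomain} (v : H d) : amp d v ∈ cyl d := by
  intro f g h
  have : (fun x : d => f x.1) = fun x : d => g x.1 := funext fun x => h x.1 x.2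
  rw [amp_apply, amp_apply, this]

theorem amp_injective (d : Finset QDomain) : Function.Injective (amp d) := by
  intro u v h
  ext j
  have := congrFun h (zeroExt j)
  simpa [amp_apply, zeroExt_apply] using this

theorem exists_amp_eq {d : Finset QDomain} {a : Amp} (ha : a ∈ cyl d) : ∃ v, amp d v = a := by
  refine ⟨WithLp.toLp 2 fun j => a (zeroExt j), ?_⟩
  ext f
  exact ha _ _ fun x hx => by simp [zeroExt, hx]

theorem range_amp (d : Finset QDomain) : LinearMap.range (amp d) = cyl d := by
  ext a
  exact ⟨by rintro ⟨v, rfl⟩; exact amp_mem_cyl v, exists_amp_eq⟩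

theorem cyl_mono {d e : Finset QDomain} (h : d ⊆ e) : cyl d ≤ cyl e :=
  fun _ ha f g hfg => ha f g fun x hx => hfg x (h hx)

theorem mul_mem_cyl {d : Finset QDomain} {a b : Amp} (ha : a ∈ cyl d) (hb : b ∈ cyl d) :
    a * b ∈ cyl d :=
  fun f g h => congrArg₂ (· * ·) (ha f g h) (hb f g h)

theorem one_mem_cyl (d : Finset QDomain) : (1 : Amp) ∈ cyl d := fun _ _ _ => rfl

theorem map_amp_tensor {d₁ d₂ d : Finset QDomain} (h₁ : d₁ ⊆ d) (h₂ : d₂ ⊆ d)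
    (V : Submodule ℂ (H d₁)) (W : Submodule ℂ (H d₂)) :
    (tensor h₁ h₂ V W).map (amp d) = V.map (amp d₁) * W.map (amp d₂) := by
  apply le_antisymm
  · rw [tensor, Submodule.map_span, Submodule.span_le]
    rintro _ ⟨_, ⟨u, hu, v, hv, rfl⟩, rfl⟩
    exact Submodule.mul_mem_mul (Submodule.mem_map_of_mem hu) (Submodule.mem_map_of_mem hv)
  · rw [Submodule.mul_le]
    rintro _ ⟨u, hu, rfl⟩ _ ⟨v, hv, rfl⟩
    exact ⟨tmul h₁ h₂ u v, Submodule.subset_span ⟨u, hu, v, hv, rfl⟩, rfl⟩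

/-! ### Substitutions of labels -/

/-- Composition of amplitude functions with a map of labels. -/
def subst (σ : Label → Label) : Amp →ₐ[ℂ] Amp where
  toFun a f := a (σ f)
  map_one' := rfl
  map_mul' _ _ := rfl
  map_zero' := rfl
  map_add' _ _ := rfl
  commutes' _ := rfl

/-- A slice of an amplitude function: the labels outside `Q` are fixed to be those of `k`. -/
def freeze (Q : Finset QDomain) (k : Label) : Amp →ₐ[ℂ] Amp := subst fun f => Q.piecewise f k

theorem freeze_apply (Q : Finset QDomain) (k : Label) (a : Amp) (f : Label) :
    freeze Q k a f = a (Q.piecewise f k) := rfl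

/-- The renaming that exchanges the qubit name `q` and the dangling name `s`. -/
def ren (q : QName) (s : QDangle) : Amp →ₐ[ℂ] Amp :=
  subst fun f x => f (Equiv.swap (Sum.inl q : QDomain) (Sum.inr s) x)

theorem ren_apply (q : QName) (s : QDangle) (a : Amp) (f : Label) :
    ren q s a f = a fun x => f (Equiv.swap (Sum.inl q : QDomain) (Sum.inr s) x) := rfl

/-- A list of qubit names as a list of names. -/
def nm {n : ℕ} (q : Fin n ↪ QName) : Fin n → QDomain := fun i => Sum.inl (q i)

theorem nm_injective {n : ℕ} (q : Fin n ↪ QName) : Function.Injective (nm q) :=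
  Sum.inl_injective.comp q.injective

theorem nm_mem_qdom {n : ℕ} (q : Fin n ↪ QName) (i : Fin n) : nm q i ∈ qdom q := mem_qdom q i

theorem mem_qdom_iff {n : ℕ} (q : Fin n ↪ QName) (x : QDomain) : x ∈ qdom q ↔ ∃ i, nm q i = x := by
  simp [qdom, nm]

/-- The slice at which the qubits `q` have the labels `g`. -/
def assign {n : ℕ} (q : Fin n ↪ QName) (g : Fin n → Fin 2) : Amp →ₐ[ℂ] Amp :=
  subst fun f => Function.extend (nm q) g f

theorem assign_apply {n : ℕ} (q : Fin n ↪ QName) (g : Fin n → Fin 2) (a : Amp) (f : Label) :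
    assign q g a f = a (Function.extend (nm q) g f) := rfl

/-- The basis vector `|g⟩` of the qubits `q`. -/
def ket {n : ℕ} (q : Fin n ↪ QName) (g : Fin n → Fin 2) : Amp :=
  fun f => if (fun i => f (nm q i)) = g then 1 else 0

theorem freeze_mem_cyl {Q : Finset QDomain} (k : Label) {d : Finset QDomain} {a : Amp}
    (ha : a ∈ cyl d) : freeze Q k a ∈ cyl (d ∩ Q) := by
  intro f g h
  refine ha _ _ fun x hx => ?_
  by_cases hQ : x ∈ Q
  · simp [hQ, h x (Finset.mem_inter.2 ⟨hx, hQ⟩)]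
  · simp [hQ]

theorem freeze_eq_self {Q : Finset QDomain} (k : Label) {d : Finset QDomain} {a : Amp}
    (ha : a ∈ cyl d) (hd : d ⊆ Q) : freeze Q k a = a := by
  ext f
  exact ha _ _ fun x hx => by simp [hd hx]

theorem freeze_eq_const {Q : Finset QDomain} (k : Label) {c : Finset QDomain} {t : Amp}
    (ht : t ∈ cyl c) (hc : Disjoint c Q) : freeze Q k t = t k • 1 := by
  ext f
  have : t (Q.piecewise f k) = t k :=
    ht _ _ fun x hx => by simp [Finset.disjoint_left.1 hc hx]
  simp [freeze_apply, this]

theorem freeze_congr {Q : Finset QDomain} {k k' : Label} {d : Finset QDomain} {a : Amp}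
    (ha : a ∈ cyl d) (h : ∀ x ∈ d, x ∉ Q → k x = k' x) : freeze Q k a = freeze Q k' a := by
  ext f
  refine ha _ _ fun x hx => ?_
  by_cases hQ : x ∈ Q
  · simp [hQ]
  · simp [hQ, h x hx hQ]

theorem freeze_freeze {Q' Q : Finset QDomain} (h : Q' ⊆ Q) (j k : Label) (a : Amp) :
    freeze Q' j (freeze Q k a) = freeze Q' (Q.piecewise j k) a := by
  ext f
  rw [freeze_apply, freeze_apply, freeze_apply]
  congr 1
  ext x
  by_cases hQ : x ∈ Q'
  · simp [hQ, h hQ]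
  · by_cases hx : x ∈ Q <;> simp [hQ, hx]

/-- Expansion of an amplitude function in the basis labels outside `Q`. -/
theorem eq_sum_freeze (Q : Finset QDomain) {d : Finset QDomain} {a : Amp} (ha : a ∈ cyl d) :
    ∃ t : (((d \ Q : Finset QDomain)) → Fin 2) → Amp, (∀ j, t j ∈ cyl (d \ Q)) ∧
      a = ∑ j, freeze Q (zeroExt j) a * t j := by
  refine ⟨fun j f => if (fun x : (d \ Q : Finset QDomain) => f x.1) = j then 1 else 0, ?_, ?_⟩
  · intro j f g h
    have : (fun x : (d \ Q : Finset QDomain) => f x.1) = fun x => g x.1 :=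
      funext fun x => h x.1 x.2
    simp only [this]
  · ext f
    rw [Finset.sum_apply]
    simp only [Pi.mul_apply, mul_ite, mul_one, mul_zero]
    rw [Finset.sum_ite_eq]
    simp only [Finset.mem_univ, if_true, freeze_apply]
    refine ha _ _ fun x hx => ?_
    by_cases hQ : x ∈ Q
    · simp [hQ]
    · simp [hQ, zeroExt, hx]

theorem cyl_mul_cyl (d e : Finset QDomain) : cyl d * cyl e = cyl (d ∪ e) := by
  apply le_antisymm
  · rw [Submodule.mul_le]
    exact fun a ha b hb => mul_mem_cyl (cyl_mono Finset.subset_union_left ha)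
      (cyl_mono Finset.subset_union_right hb)
  · intro a ha
    obtain ⟨t, ht, h⟩ := eq_sum_freeze d ha
    rw [h]
    refine Submodule.sum_mem _ fun j _ => Submodule.mul_mem_mul ?_ ?_
    · exact cyl_mono Finset.inter_subset_right (freeze_mem_cyl _ ha)
    · refine cyl_mono ?_ (ht j)
      intro x hx
      simp only [Finset.mem_sdiff, Finset.mem_union] at hx
      tauto

theorem disjoint_qdom_iff {n : ℕ} {q : Fin n ↪ QName} {c : Finset QDomain} :
    Disjoint c (qdom q) ↔ ∀ i, nm q i ∉ c := by
  rw [Finset.disjoint_right]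
  constructor
  · exact fun h i => h (nm_mem_qdom q i)
  · intro h x hx
    obtain ⟨i, rfl⟩ := (mem_qdom_iff q x).1 hx
    exact h i

theorem assign_eq_self {n : ℕ} {q : Fin n ↪ QName} (g : Fin n → Fin 2) {c : Finset QDomain}
    {t : Amp} (ht : t ∈ cyl c) (hc : Disjoint c (qdom q)) : assign q g t = t := by
  ext f
  refine ht _ _ fun x hx => Function.extend_apply' _ _ _ ?_
  rintro ⟨i, rfl⟩
  exact disjoint_qdom_iff.1 hc i hx

theorem assign_mem_cyl {n : ℕ} {q : Fin n ↪ QName} (g : Fin n → Fin 2) {d : Finset QDomain}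
    {a : Amp} (ha : a ∈ cyl d) : assign q g a ∈ cyl (d \ qdom q) := by
  intro f f' h
  refine ha _ _ fun x hx => ?_
  beta_reduce
  by_cases hq : ∃ i, nm q i = x
  · obtain ⟨i, rfl⟩ := hq
    rw [(nm_injective q).extend_apply, (nm_injective q).extend_apply]
  · rw [Function.extend_apply' _ _ _ hq, Function.extend_apply' _ _ _ hq]
    exact h x (Finset.mem_sdiff.2 ⟨hx, fun h' => hq ((mem_qdom_iff q x).1 h')⟩)

theorem ket_mem_cyl {n : ℕ} (q : Fin n ↪ QName) (g : Fin n → Fin 2) : ket q g ∈ cyl (qdom q) := by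
  intro f f' h
  have : (fun i => f (nm q i)) = fun i => f' (nm q i) := funext fun i => h _ (nm_mem_qdom q i)
  simp only [ket, this]

theorem extend_self {n : ℕ} (q : Fin n ↪ QName) (f : Label) :
    Function.extend (nm q) (fun i => f (nm q i)) f = f := by
  ext1 x
  by_cases hq : ∃ i, nm q i = x
  · obtain ⟨i, rfl⟩ := hq
    rw [(nm_injective q).extend_apply]
  · rw [Function.extend_apply' _ _ _ hq]

/-- Expansion of an amplitude function in the basis labels of the qubits `q`. -/
theorem eq_sum_ket {n : ℕ} (q : Fin n ↪ QName) (a : Amp) : a = ∑ g, ket q g * assign q g a := by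
  ext f
  rw [Finset.sum_apply]
  simp only [Pi.mul_apply, ket, ite_mul, one_mul, zero_mul]
  rw [Finset.sum_ite_eq]
  simp [assign_apply, extend_self]

theorem swap_mem_renameDom {q : QName} {s : QDangle} {d : Finset QDomain} {x : QDomain} :
    Equiv.swap (Sum.inl q : QDomain) (Sum.inr s) x ∈ renameDom q s d ↔ x ∈ d := by
  simp [renameDom]

theorem mem_renameDom {q : QName} {s : QDangle} {d : Finset QDomain} {x : QDomain} :
    x ∈ renameDom q s d ↔ Equiv.swap (Sum.inl q : QDomain) (Sum.inr s) x ∈ d := by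
  rw [← swap_mem_renameDom (q := q) (s := s) (d := d), Equiv.swap_apply_self]

theorem ren_mem_cyl {q : QName} {s : QDangle} {d : Finset QDomain} {a : Amp} (ha : a ∈ cyl d) :
    ren q s a ∈ cyl (renameDom q s d) :=
  fun _ _ h => ha _ _ fun _ hx => h _ (swap_mem_renameDom.2 hx)

theorem card_renameDom (q : QName) (s : QDangle) (d : Finset QDomain) :
    (renameDom q s d).card = d.card := Finset.card_map _

theorem swap_eq_self {q : QName} {s : QDangle} {x : QDomain} (h1 : x ≠ Sum.inl q)
    (h2 : x ≠ Sum.inr s) : Equiv.swap (Sum.inl q : QDomain) (Sum.inr s) x = x :=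
  Equiv.swap_apply_of_ne_of_ne h1 h2

theorem ren_eq_self {q : QName} {s : QDangle} {d : Finset QDomain} {a : Amp} (ha : a ∈ cyl d)
    (hq : Sum.inl q ∉ d) (hs : Sum.inr s ∉ d) : ren q s a = a := by
  ext f
  refine ha _ _ fun x hx => ?_
  beta_reduce
  rw [swap_eq_self (by rintro rfl; exact hq hx) (by rintro rfl; exact hs hx)]

theorem inl_notMem_renameDom {q : QName} {s : QDangle} {d : Finset QDomain}
    (hs : Sum.inr s ∉ d) : Sum.inl q ∉ renameDom q s d := by
  rw [mem_renameDom, Equiv.swap_apply_left]; exact hs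

theorem renameDom_eq_self {q : QName} {s : QDangle} {d : Finset QDomain}
    (hq : Sum.inl q ∉ d) (hs : Sum.inr s ∉ d) : renameDom q s d = d := by
  ext x
  rw [mem_renameDom]
  by_cases h1 : x = Sum.inl q
  · subst h1; rw [Equiv.swap_apply_left]; tauto
  · by_cases h2 : x = Sum.inr s
    · subst h2; rw [Equiv.swap_apply_right]; tauto
    · rw [swap_eq_self h1 h2]

theorem exists_dangle_notMem (d : Finset QDomain) : ∃ s : QDangle, Sum.inr s ∉ d := by
  obtain ⟨s, hs⟩ := Infinite.exists_notMem_finset (d.preimage Sum.inr Sum.inr_injective.injOn)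
  exact ⟨s, fun h => hs (Finset.mem_preimage.2 h)⟩

/-! ### Operators on qubits -/

/-- The operator `A` applied to the qubits `q` of an amplitude function. -/
def opA {n : ℕ} (q : Fin n ↪ QName) (A : Op (Fin n)) : Amp →ₗ[ℂ] Amp where
  toFun a f := ∑ g, A (fun i => f (nm q i)) g * a (Function.extend (nm q) g f)
  map_add' a b := by
    ext f
    simp [mul_add, Finset.sum_add_distrib]
  map_smul' c a := by
    ext f
    simp [Finset.mul_sum, mul_left_comm]

theorem opA_apply {n : ℕ} (q : Fin n ↪ QName) (A : Op (Fin n)) (a : Amp) (f : Label) :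
    opA q A a f = ∑ g, A (fun i => f (nm q i)) g * a (Function.extend (nm q) g f) := rfl

/-- The row of `lift e A` at `f` is supported on the labels that agree with `f` outside `e`. -/
theorem sum_lift {ι κ : Type} [Fintype ι] [Fintype κ] [DecidableEq ι] [DecidableEq κ]
    (e : ι ↪ κ) (A : Op ι) (f : κ → Fin 2) (b : (κ → Fin 2) → ℂ) :
    ∑ g, lift e A f g * b g = ∑ g, A (f ∘ e) g * b (Function.extend e g f) := by
  symm
  refine Finset.sum_of_injOn (fun g => Function.extend e g f) ?_ ?_ ?_ ?_
  · intro g _ g' _ h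
    ext1 i
    have := congrFun h (e i)
    simpa [e.injective.extend_apply] using this
  · intro _ _; simp
  · intro g _ hg
    have : ¬ ∀ k, k ∉ Set.range e → f k = g k := by
      intro h
      refine hg ⟨g ∘ e, by simp, ?_⟩
      ext1 k
      by_cases hk : ∃ i, e i = k
      · obtain ⟨i, rfl⟩ := hk
        simp [e.injective.extend_apply]
      · simp only [Function.extend_apply' _ _ _ hk]
        exact h k hk
    simp only [lift, Matrix.of_apply, if_neg this, zero_mul]
  · intro g _
    have h1 : ∀ k, k ∉ Set.range e → f k = Function.extend e g f k :=
      fun k hk => (Function.extend_apply' _ _ _ hk).symm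
    have h2 : Function.extend e g f ∘ e = g := by
      ext1 i
      simp [e.injective.extend_apply]
    simp only [lift, Matrix.of_apply, if_pos h1, h2]

theorem amp_onQubits {n : ℕ} (q : Fin n ↪ QName) {d : Finset QDomain} (h : qdom q ⊆ d)
    (A : Op (Fin n)) (v : H d) :
    amp d (Matrix.toEuclideanLin (onQubits q h A) v) = opA q A (amp d v) := by
  ext f
  rw [amp_apply, opA_apply, Matrix.ofLp_toLpLin, Matrix.toLin'_apply, Matrix.mulVec, dotProduct,
    onQubits, sum_lift]
  refine Finset.sum_congr rfl fun g _ => ?_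
  rw [amp_apply]
  refine congrArg (fun z => A _ g * v.ofLp z) ?_
  ext1 x
  by_cases hx : ∃ i, pos q h i = x
  · obtain ⟨i, rfl⟩ := hx
    rw [(pos q h).injective.extend_apply]
    exact ((nm_injective q).extend_apply _ _ i).symm
  · rw [Function.extend_apply' _ _ _ hx, Function.extend_apply']
    rintro ⟨i, hi⟩
    exact hx ⟨i, Subtype.ext hi⟩

theorem opA_lift {n n' : ℕ} {q : Fin n ↪ QName} {q' : Fin n' ↪ QName} {e : Fin n ↪ Fin n'}
    (he : ∀ i, q' (e i) = q i) (A : Op (Fin n)) (a : Amp) : opA q' (lift e A) a = opA q A a := by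
  ext f
  rw [opA_apply, sum_lift e A _ fun g => a (Function.extend (nm q') g f), opA_apply]
  have h0 : ∀ i, nm q' (e i) = nm q i := fun i => congrArg Sum.inl (he i)
  have h1 : (fun i => f (nm q' i)) ∘ e = fun i => f (nm q i) := by
    ext1 i
    simp [h0]
  rw [h1]
  refine Finset.sum_congr rfl fun g _ => ?_
  congr 2
  ext1 x
  by_cases hx : ∃ i, nm q i = x
  · obtain ⟨i, rfl⟩ := hx
    rw [(nm_injective q).extend_apply, ← h0, (nm_injective q').extend_apply,
      e.injective.extend_apply]
  · rw [Function.extend_apply' _ _ _ hx]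
    by_cases hx' : ∃ i, nm q' i = x
    · obtain ⟨i, rfl⟩ := hx'
      rw [(nm_injective q').extend_apply, Function.extend_apply']
      rintro ⟨j, rfl⟩
      exact hx ⟨j, (h0 j).symm⟩
    · rw [Function.extend_apply' _ _ _ hx']

theorem opA_mul_right {n : ℕ} {q : Fin n ↪ QName} (A : Op (Fin n)) (a : Amp)
    {c : Finset QDomain} {t : Amp} (ht : t ∈ cyl c) (hc : Disjoint c (qdom q)) :
    opA q A (a * t) = opA q A a * t := by
  ext f
  rw [Pi.mul_apply, opA_apply, opA_apply, Finset.sum_mul]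
  refine Finset.sum_congr rfl fun g _ => ?_
  have := congrFun (assign_eq_self g ht hc) f
  rw [assign_apply] at this
  rw [Pi.mul_apply, this, mul_assoc]

theorem opA_opA {n : ℕ} (q : Fin n ↪ QName) (A B : Op (Fin n)) (a : Amp) :
    opA q A (opA q B a) = opA q (A * B) a := by
  ext f
  simp only [opA_apply, Matrix.mul_apply, Finset.mul_sum, Finset.sum_mul]
  rw [Finset.sum_comm]
  refine Finset.sum_congr rfl fun g _ => Finset.sum_congr rfl fun g' _ => ?_
  have h1 : (fun i => Function.extend (nm q) g' f (nm q i)) = g' := by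
    ext1 i
    rw [(nm_injective q).extend_apply]
  have h2 : Function.extend (nm q) g (Function.extend (nm q) g' f) =
      Function.extend (nm q) g f := by
    ext1 x
    by_cases hx : ∃ i, nm q i = x
    · obtain ⟨i, rfl⟩ := hx
      rw [(nm_injective q).extend_apply, (nm_injective q).extend_apply]
    · simp only [Function.extend_apply' _ _ _ hx]
  rw [h1, h2, mul_assoc]

theorem opA_one {n : ℕ} (q : Fin n ↪ QName) (a : Amp) : opA q 1 a = a := by
  ext f
  simp [opA_apply, Matrix.one_apply, extend_self]

theorem opA_single {n : ℕ} (q : Fin n ↪ QName) (g : Fin n → Fin 2) (a : Amp) :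
    opA q (Matrix.single 0 g 1) a = ket q 0 * assign q g a := by
  ext f
  rw [opA_apply, Finset.sum_eq_single g]
  · by_cases h : (fun i => f (nm q i)) = 0
    · simp [ket, h, assign_apply]
    · simp [ket, h, assign_apply, Matrix.single, Ne.symm h]
  · intro g' _ h
    simp [Matrix.single, Ne.symm h]
  · simp

theorem opA_mem_cyl {n : ℕ} {q : Fin n ↪ QName} (A : Op (Fin n)) {d : Finset QDomain}
    (hq : qdom q ⊆ d) {a : Amp} (ha : a ∈ cyl d) : opA q A a ∈ cyl d := by
  obtain ⟨v, rfl⟩ := exists_amp_eq ha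
  rw [← amp_onQubits q hq]
  exact amp_mem_cyl _

theorem freeze_opA {n : ℕ} {q : Fin n ↪ QName} (A : Op (Fin n)) {Q : Finset QDomain}
    (hq : qdom q ⊆ Q) (k : Label) (a : Amp) : freeze Q k (opA q A a) = opA q A (freeze Q k a) := by
  ext f
  rw [freeze_apply, opA_apply, opA_apply]
  have h1 : (fun i => Q.piecewise f k (nm q i)) = fun i => f (nm q i) := by
    ext1 i
    simp [hq (nm_mem_qdom q i)]
  rw [h1]
  refine Finset.sum_congr rfl fun g _ => ?_
  rw [freeze_apply]
  congr 2
  ext1 x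
  by_cases hx : ∃ i, nm q i = x
  · obtain ⟨i, rfl⟩ := hx
    simp [(nm_injective q).extend_apply, hq (nm_mem_qdom q i)]
  · rw [Function.extend_apply' _ _ _ hx]
    by_cases hQ : x ∈ Q
    · simp [hQ, Function.extend_apply' _ _ _ hx]
    · simp [hQ]

theorem freeze_assign {n : ℕ} {q : Fin n ↪ QName} {Q : Finset QDomain}
    (hq : qdom q ⊆ Q) (g : Fin n → Fin 2) (k : Label) (a : Amp) :
    freeze Q k (assign q g a) = assign q g (freeze Q k a) := by
  ext f
  rw [freeze_apply, assign_apply, assign_apply, freeze_apply]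
  congr 1
  ext1 x
  by_cases hx : ∃ i, nm q i = x
  · obtain ⟨i, rfl⟩ := hx
    simp [(nm_injective q).extend_apply, hq (nm_mem_qdom q i)]
  · rw [Function.extend_apply' _ _ _ hx]
    by_cases hQ : x ∈ Q
    · simp [hQ, Function.extend_apply' _ _ _ hx]
    · simp [hQ]

/-! ### Operators of the programming language as Kraus maps -/

theorem amp_toEuclideanLin_injective {d : Finset QDomain} {A B : Op d}
    (h : ∀ v, amp d (Matrix.toEuclideanLin A v) = amp d (Matrix.toEuclideanLin B v)) : A = B :=
  Matrix.toEuclideanLin.injective (LinearMap.ext fun v => amp_injective d (h v))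

theorem onQubits_mul {n : ℕ} (q : Fin n ↪ QName) {d : Finset QDomain} (h : qdom q ⊆ d)
    (A B : Op (Fin n)) : onQubits q h (A * B) = onQubits q h A * onQubits q h B := by
  refine amp_toEuclideanLin_injective fun v => ?_
  rw [Matrix.toLpLin_mul 2 2 2, LinearMap.comp_apply]
  simp only [amp_onQubits, opA_opA]

theorem onQubits_one {n : ℕ} (q : Fin n ↪ QName) {d : Finset QDomain} (h : qdom q ⊆ d) :
    onQubits q h 1 = 1 := by
  refine amp_toEuclideanLin_injective fun v => ?_
  rw [amp_onQubits, opA_one]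
  simp

theorem onQubits_sum {n : ℕ} {κ : Type*} [Fintype κ] (q : Fin n ↪ QName) {d : Finset QDomain}
    (h : qdom q ⊆ d) (A : κ → Op (Fin n)) :
    onQubits q h (∑ i, A i) = ∑ i, onQubits q h (A i) := by
  ext f g
  rw [Matrix.sum_apply]
  simp only [onQubits, lift, Matrix.of_apply, Matrix.sum_apply]
  split_ifs <;> simp

theorem lift_conjTranspose {ι κ : Type} (e : ι ↪ κ) (A : Op ι) : lift e Aᴴ = (lift e A)ᴴ := by
  ext f g
  simp only [lift, Matrix.of_apply, Matrix.conjTranspose_apply]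
  have : (∀ k, k ∉ Set.range e → f k = g k) ↔ ∀ k, k ∉ Set.range e → g k = f k :=
    forall_congr' fun k => by rw [eq_comm]
  by_cases hc : ∀ k, k ∉ Set.range e → f k = g k
  · rw [if_pos hc, if_pos (this.1 hc)]
  · rw [if_neg hc, if_neg fun h' => hc (this.2 h'), star_zero]

theorem onQubits_conjTranspose {n : ℕ} (q : Fin n ↪ QName) {d : Finset QDomain}
    (h : qdom q ⊆ d) (A : Op (Fin n)) : onQubits q h Aᴴ = (onQubits q h A)ᴴ :=
  lift_conjTranspose _ A

theorem isStarProjection_onQubits {n : ℕ} (q : Fin n ↪ QName) {d : Finset QDomain}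
    (h : qdom q ⊆ d) (P : Proj n) : IsStarProjection (onQubits q h P.1) := by
  refine ⟨?_, ?_⟩
  · rw [IsIdempotentElem, ← onQubits_mul, P.2.1.eq]
  · rw [IsSelfAdjoint, Matrix.star_eq_conjTranspose, ← onQubits_conjTranspose,
      ← Matrix.star_eq_conjTranspose, P.2.2]

theorem sum_conjTranspose_mul_onQubits {n : ℕ} {κ : Type*} [Fintype κ] (q : Fin n ↪ QName)
    {d : Finset QDomain} (h : qdom q ⊆ d) {A : κ → Op (Fin n)} (hA : ∑ i, (A i)ᴴ * A i = 1) :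
    ∑ i, (onQubits q h (A i))ᴴ * onQubits q h (A i) = 1 := by
  simp only [← onQubits_conjTranspose, ← onQubits_mul]
  rw [← onQubits_sum, hA, onQubits_one]

theorem sum_conjTranspose_mul_single (n : ℕ) :
    ∑ i : Fin n → Fin 2, (Matrix.single 0 i 1 : Op (Fin n))ᴴ * Matrix.single 0 i 1 = 1 := by
  simp only [Matrix.conjTranspose_single, star_one, Matrix.single_mul_single_same, mul_one]
  exact Matrix.sum_single_one

theorem density_kraus {n m κ : Type*} [Fintype n] [Fintype m] [DecidableEq n]
    [Fintype κ] {K : κ → Matrix m n ℂ} (hK : ∑ i, (K i)ᴴ * K i = 1) {ρ : Matrix n n ℂ}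
    (hρ : ρ.PosSemidef ∧ ρ.trace = 1) :
    (∑ i, K i * ρ * (K i)ᴴ).PosSemidef ∧ (∑ i, K i * ρ * (K i)ᴴ).trace = 1 := by
  classical
  refine ⟨posSemidef_kraus K hρ.1, ?_⟩
  rw [trace_kraus, hK, one_mul, hρ.2]

theorem density_measure {n : Type*} [Fintype n] [DecidableEq n] {ρ P : Matrix n n ℂ}
    (hρ : ρ.PosSemidef) (hP : IsStarProjection P) (ht : (P * ρ).trace ≠ 0) :
    ((P * ρ).trace⁻¹ • (P * ρ * Pᴴ)).PosSemidef ∧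
      ((P * ρ).trace⁻¹ • (P * ρ * Pᴴ)).trace = 1 := by
  have hs : Pᴴ = P := hP.2
  have h1 : (P * ρ).trace = (P * ρ * Pᴴ).trace := by
    rw [Matrix.trace_mul_comm (P * ρ), hs, ← Matrix.mul_assoc, hP.1.eq]
  have h2 := hρ.mul_mul_conjTranspose_same P
  constructor
  · refine h2.smul (inv_nonneg.2 ?_)
    rw [h1]
    exact h2.trace_nonneg
  · rw [Matrix.trace_smul, ← h1, smul_eq_mul, inv_mul_cancel₀ ht]

/-- The linear map that selects the coordinates given by `φ`, as a matrix. -/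
def sel {m n : Type*} [DecidableEq n] (φ : m → n) : Matrix m n ℂ :=
  Matrix.of fun f g => if g = φ f then 1 else 0

theorem sel_apply {m n : Type*} [Fintype n] [DecidableEq n] (φ : m → n)
    (v : EuclideanSpace ℂ n) (f : m) : Matrix.toEuclideanLin (sel φ) v f = v (φ f) := by
  rw [Matrix.ofLp_toLpLin, Matrix.toLin'_apply, Matrix.mulVec, dotProduct]
  simp [sel]

theorem sel_mul_mul {m n : Type*} [Fintype n] [DecidableEq n] (φ ψ : m → n)
    (ρ : Matrix n n ℂ) : sel φ * ρ * (sel ψ)ᴴ = ρ.submatrix φ ψ := by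
  ext f g
  simp [Matrix.mul_apply, sel]

/-- Renaming is conjugation by a permutation of labels. -/
theorem renameOp_eq (q : QName) (s : QDangle) {d : Finset QDomain} :
    ∃ pull : (renameDom q s d → Fin 2) → (d → Fin 2), Function.Bijective pull ∧
      (∀ v, amp _ (Matrix.toEuclideanLin (sel pull) v) = ren q s (amp d v)) ∧
      ∀ ρ : Op d, renameOp q s ρ = sel pull * ρ * (sel pull)ᴴ := by
  refine ⟨fun f x => f ⟨Equiv.swap (Sum.inl q : QDomain) (Sum.inr s) x.1,
    Finset.mem_map_of_mem _ x.2⟩, ⟨?_, ?_⟩, ?_, ?_⟩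
  · intro f g h
    ext1 ⟨y, hy⟩
    have := congrFun h ⟨_, mem_renameDom.1 hy⟩
    simpa using this
  · intro g
    refine ⟨fun y => g ⟨_, mem_renameDom.1 y.2⟩, ?_⟩
    ext1 x
    simp
  · intro v
    ext f
    rw [amp_apply, sel_apply]
    rfl
  · intro ρ
    rw [sel_mul_mul]
    rfl

/-- The partial trace as a Kraus map; the Kraus operators are the slices. -/
theorem restr_eq (d' : Finset QDomain) {d : Finset QDomain} (ρ : Op d) :
    restr d' ρ = ∑ k : (d \ d' : Finset QDomain) → Fin 2,
      sel (fun f => glue f k) * ρ * (sel fun f => glue f k)ᴴ := by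
  ext f g
  rw [Matrix.sum_apply]
  simp only [sel_mul_mul]
  rfl

section Slices

variable {d' d : Finset QDomain}

theorem glue_apply_of_mem (f : d' → Fin 2) (k : (d \ d' : Finset QDomain) → Fin 2) {x : d}
    (hx : x.1 ∈ d') : glue f k x = f ⟨x.1, hx⟩ := by simp [glue, hx]

theorem glue_apply_of_notMem (f : d' → Fin 2) (k : (d \ d' : Finset QDomain) → Fin 2) {x : d}
    (hx : x.1 ∉ d') : glue f k x = k ⟨x.1, Finset.mem_sdiff.2 ⟨x.2, hx⟩⟩ := by simp [glue, hx]

theorem eq_glue_iff (h : d' ⊆ d) {f : d' → Fin 2} {k : (d \ d' : Finset QDomain) → Fin 2}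
    {g : d → Fin 2} : g = glue f k ↔
      (fun x : d' => g ⟨x.1, h x.2⟩) = f ∧
      (fun x : (d \ d' : Finset QDomain) => g ⟨x.1, (Finset.mem_sdiff.1 x.2).1⟩) = k := by
  constructor
  · rintro rfl
    constructor <;> ext1 x
    · exact glue_apply_of_mem f k x.2
    · exact glue_apply_of_notMem f k (Finset.mem_sdiff.1 x.2).2
  · rintro ⟨rfl, rfl⟩
    ext1 x
    by_cases hx : x.1 ∈ d'
    · rw [glue_apply_of_mem _ _ hx]
    · rw [glue_apply_of_notMem _ _ hx]

theorem sel_glue_conjTranspose_apply (h : d' ⊆ d) (k : (d \ d' : Finset QDomain) → Fin 2)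
    (w : H d') (g : d → Fin 2) :
    Matrix.toEuclideanLin (sel (fun f => glue f k))ᴴ w g =
      if (fun x : (d \ d' : Finset QDomain) => g ⟨x.1, (Finset.mem_sdiff.1 x.2).1⟩) = k
        then w (fun x : d' => g ⟨x.1, h x.2⟩) else 0 := by
  rw [Matrix.ofLp_toLpLin, Matrix.toLin'_apply, Matrix.mulVec, dotProduct]
  simp only [sel, Matrix.conjTranspose_apply, Matrix.of_apply, eq_glue_iff h]
  split_ifs with hk <;> simp [hk]

theorem sum_sel_glue (h : d' ⊆ d) (v : H d) :
    ∑ k : (d \ d' : Finset QDomain) → Fin 2,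
      Matrix.toEuclideanLin (sel fun f : d' → Fin 2 => glue f k)ᴴ
        (Matrix.toEuclideanLin (sel fun f : d' → Fin 2 => glue f k) v) = v := by
  ext g
  rw [WithLp.ofLp_sum, Finset.sum_apply]
  simp only [sel_glue_conjTranspose_apply h, sel_apply]
  rw [Finset.sum_ite_eq]
  simp only [Finset.mem_univ, if_true]
  exact congrArg v.ofLp ((eq_glue_iff h).2 ⟨rfl, rfl⟩).symm

theorem sum_conjTranspose_mul_sel_glue (h : d' ⊆ d) :
    ∑ k : (d \ d' : Finset QDomain) → Fin 2,
      (sel fun f : d' → Fin 2 => glue f k)ᴴ * (sel fun f : d' → Fin 2 => glue f k) = 1 := by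
  refine Matrix.toEuclideanLin.injective (LinearMap.ext fun v => ?_)
  rw [map_sum, LinearMap.sum_apply]
  simp only [Matrix.toLpLin_mul 2 2 2, LinearMap.comp_apply, sum_sel_glue h]
  simp

theorem sel_glue_mul_conjTranspose (h : d' ⊆ d) (k j : (d \ d' : Finset QDomain) → Fin 2) :
    (sel fun f : d' → Fin 2 => glue f k) * (sel fun f : d' → Fin 2 => glue f j)ᴴ =
      if j = k then 1 else 0 := by
  ext f g
  rw [Matrix.mul_apply]
  simp only [sel, Matrix.conjTranspose_apply, Matrix.of_apply]
  have : glue f k = glue g j ↔ f = g ∧ k = j := by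
    rw [eq_glue_iff h]
    obtain ⟨h1, h2⟩ := (eq_glue_iff h).1 (rfl : glue f k = glue f k)
    rw [h1, h2]
  simp only [ite_mul, one_mul, zero_mul, Finset.sum_ite_eq', Finset.mem_univ, if_true, this]
  by_cases h1 : f = g <;> by_cases h2 : j = k
  · subst h1; subst h2; simp
  · simp [h2, Ne.symm h2]
  · simp [h1, h2]
  · simp [h1, h2]

theorem amp_sel_glue {n : ℕ} {q : Fin n ↪ QName} (hd : ∀ x ∈ d, x ∉ d' ↔ x ∈ qdom q)
    {k : (d \ d' : Finset QDomain) → Fin 2} {g : Fin n → Fin 2}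
    (hk : ∀ i hi, k ⟨nm q i, hi⟩ = g i) (v : H d) :
    amp d' (Matrix.toEuclideanLin (sel fun f => glue f k) v) = assign q g (amp d v) := by
  ext f
  rw [amp_apply, sel_apply, assign_apply, amp_apply]
  refine congrArg v.ofLp ?_
  ext1 x
  by_cases hx : x.1 ∈ d'
  · rw [glue_apply_of_mem _ _ hx, Function.extend_apply']
    rintro ⟨i, hi⟩
    exact (hd x.1 x.2).2 (hi ▸ nm_mem_qdom q i) hx
  · rw [glue_apply_of_notMem _ _ hx]
    obtain ⟨x, hxd⟩ := x
    obtain ⟨i, rfl⟩ := (mem_qdom_iff q x).1 ((hd x hxd).1 hx)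
    rw [hk, (nm_injective q).extend_apply]

theorem amp_sel_glue_conjTranspose {n : ℕ} {q : Fin n ↪ QName} (h : d' ⊆ d)
    (hd : ∀ x ∈ d, x ∉ d' ↔ x ∈ qdom q) (hq : qdom q ⊆ d)
    {k : (d \ d' : Finset QDomain) → Fin 2} {g : Fin n → Fin 2}
    (hk : ∀ i hi, k ⟨nm q i, hi⟩ = g i) (w : H d') :
    amp d (Matrix.toEuclideanLin (sel fun f => glue f k)ᴴ w) = ket q g * amp d' w := by
  ext f
  rw [amp_apply, sel_glue_conjTranspose_apply h, Pi.mul_apply, ket, amp_apply, ite_mul, one_mul,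
    zero_mul]
  refine if_congr ?_ rfl rfl
  constructor
  · rintro rfl
    ext1 i
    exact hk i (Finset.mem_sdiff.2
      ⟨hq (nm_mem_qdom q i), (hd _ (hq (nm_mem_qdom q i))).2 (nm_mem_qdom q i)⟩)
  · rintro rfl
    ext1 ⟨x, hx⟩
    obtain ⟨h1, h2⟩ := Finset.mem_sdiff.1 hx
    obtain ⟨i, rfl⟩ := (mem_qdom_iff q x).1 ((hd x h1).1 h2)
    exact (hk i _).symm

/-- A label of the qubits `q`, as a label of a set of names that is `qdom q` in the applications. -/
theorem exists_label {n : ℕ} (q : Fin n ↪ QName) (c : Finset QDomain) (g : Fin n → Fin 2) :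
    ∃ k : c → Fin 2, ∀ i hi, k ⟨nm q i, hi⟩ = g i :=
  ⟨fun x => Function.extend (nm q) g 0 x.1, fun _ _ => (nm_injective q).extend_apply _ _ _⟩

/-- The converse of `exists_label`. -/
theorem exists_label' {n : ℕ} (q : Fin n ↪ QName) (c : Finset QDomain) (k : c → Fin 2) :
    ∃ g : Fin n → Fin 2, ∀ i hi, k ⟨nm q i, hi⟩ = g i :=
  ⟨fun i => zeroExt k (nm q i), fun i hi => (zeroExt_apply k ⟨nm q i, hi⟩).symm⟩

/-- Every density operator on `d'` extends to `d`, and the maximally mixed extension has the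
largest support that an extension can have. -/
theorem exists_density_extension (h : d' ⊆ d) {σ : Op d'} (hσ : σ.PosSemidef ∧ σ.trace = 1) :
    ∃ ρ : Op d, (ρ.PosSemidef ∧ ρ.trace = 1) ∧ restr d' ρ = σ ∧
      ∀ W, matSupp ρ ≤ W → ∀ k : (d \ d' : Finset QDomain) → Fin 2,
        matSupp σ ≤ W.comap (Matrix.toEuclideanLin (sel fun f => glue f k)ᴴ) := by
  let S : ((d \ d' : Finset QDomain) → Fin 2) → Matrix (d' → Fin 2) (d → Fin 2) ℂ :=
    fun k => sel fun f => glue f k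
  have hS : ∀ k j, S k * (S j)ᴴ = if j = k then 1 else 0 := sel_glue_mul_conjTranspose h
  let N : ℂ := Fintype.card ((d \ d' : Finset QDomain) → Fin 2)
  have hN : N ≠ 0 := Nat.cast_ne_zero.2 Fintype.card_ne_zero
  have hN' : 0 ≤ N⁻¹ := inv_nonneg.2 (Nat.cast_nonneg _)
  let τ : Op d := ∑ k, (S k)ᴴ * σ * ((S k)ᴴ)ᴴ
  have hτ : τ.PosSemidef := posSemidef_kraus (fun k => (S k)ᴴ) hσ.1
  refine ⟨N⁻¹ • τ, ⟨hτ.smul hN', ?_⟩, ?_, ?_⟩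
  · have : τ.trace = N := by
      simp only [τ]
      rw [trace_kraus fun k => (S k)ᴴ]
      have : ∑ k, ((S k)ᴴ)ᴴ * (S k)ᴴ = N • (1 : Op d') := by
        simp only [Matrix.conjTranspose_conjTranspose, hS, if_true, Finset.sum_const,
          Finset.card_univ, N]
        rw [Nat.cast_smul_eq_nsmul]
      rw [this, smul_mul_assoc, one_mul, Matrix.trace_smul, hσ.2, smul_eq_mul, mul_one]
    rw [Matrix.trace_smul, this, smul_eq_mul, inv_mul_cancel₀ hN]
  · rw [restr_eq]
    have : ∀ k, S k * (N⁻¹ • τ) * (S k)ᴴ = N⁻¹ • σ := by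
      intro k
      rw [Matrix.mul_smul, Matrix.smul_mul]
      congr 1
      have hj : ∀ j, S k * ((S j)ᴴ * σ * ((S j)ᴴ)ᴴ) * (S k)ᴴ =
          (S k * (S j)ᴴ) * σ * (S j * (S k)ᴴ) := by
        intro j
        simp only [Matrix.mul_assoc, Matrix.conjTranspose_conjTranspose]
      simp only [τ, Matrix.mul_sum, Matrix.sum_mul, hj, hS]
      rw [Finset.sum_eq_single k]
      · simp
      · intro j _ hjk
        simp [hjk]
      · simp
    rw [Finset.sum_congr rfl fun k _ => this k, Finset.sum_const, Finset.card_univ,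
      ← Nat.cast_smul_eq_nsmul ℂ, smul_smul]
    change (N * N⁻¹) • σ = σ
    rw [mul_inv_cancel₀ hN, one_smul]
  · intro W hW k
    rw [matSupp_smul _ (inv_ne_zero hN)] at hW
    exact (matSupp_kraus_le_iff (fun k => (S k)ᴴ) hσ.1).1 hW k

/-- A vector in the support of an extension has its slices in the support of the restriction. -/
theorem matSupp_le_comap_sel {ρ : Op d} (hρ : ρ.PosSemidef)
    (k : (d \ d' : Finset QDomain) → Fin 2) :
    matSupp ρ ≤ (matSupp (restr d' ρ)).comap (Matrix.toEuclideanLin (sel fun f => glue f k)) := by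
  have := le_refl (matSupp (restr d' ρ))
  conv_lhs at this => rw [restr_eq]
  exact (matSupp_kraus_le_iff _ hρ).1 this k

end Slices

/-! ### Weakest preconditions -/

/-- A family of subspaces, one for each domain. -/
abbrev Fam := Finset QDomain → Submodule ℂ Amp

/-- The one-element list of qubits. -/
abbrev single (q : QName) : Fin 1 ↪ QName := ⟨fun _ => q, fun _ _ _ => Subsingleton.elim _ _⟩

/-- The vectors over domains containing the qubits `q` that each operator `L i`, applied to `q`,
maps into `F i`. -/
def pre {n : ℕ} {κ : Type} (q : Fin n ↪ QName) (L : κ → Op (Fin n)) (F : κ → Fam) : Fam :=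
  fun d => if qdom q ⊆ d then cyl d ⊓ ⨅ i, (F i d).comap (opA q (L i)) else ⊥

/-- The precondition of `qfree q`: all slices at `q` lie in `F`. -/
def freePre (q : QName) (F : Fam) : Fam :=
  fun d => if Sum.inl q ∈ d then
    cyl d ⊓ ⨅ g, (F (d.erase (Sum.inl q))).comap (assign (single q) g).toLinearMap else ⊥

/-- The precondition of `qalloc q`: for each choice of the dangling name `s` for the old qubit `q`,
the products of the renamed vector with the basis vectors of the new qubit `q` lie in `F`. -/
def allocPre (q : QName) (F : Fam) : Fam :=
  fun d => cyl d ⊓ ⨅ (s : QDangle) (_ : Sum.inr s ∉ d) (g : Fin 1 → Fin 2),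
    (F (insert (Sum.inl q) (renameDom q s d))).comap
      ((LinearMap.mulLeft ℂ (ket (single q) g)).comp (ren q s).toLinearMap)

/-- The weakest precondition of a statement for the postcondition `F`. That of a loop is the
greatest fixed point of its unrolling. -/
def wp : Stmt → Fam → Fam
  | .skip, F => F
  | .qalloc q, F => allocPre q F
  | .qfree q, F => freePre q F
  | .reset q, F => pre q (fun g => Matrix.single 0 g 1) fun _ => F
  | .unitary U q, F => pre q (fun _ : Unit => U.1) fun _ => F
  | .seq S₁ S₂, F => wp S₁ (wp S₂ F)
  | .ifMeas M q S, F => pre q (fun m => (M.1 m).1) fun m => wp (S m) F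
  | .whileMeas M q S, F =>
      sSup {X | X ≤ pre q (fun m => (M.1 m).1) fun m => if m = 0 then F else wp S X}

section Pre

variable {n : ℕ} {κ : Type} {q : Fin n ↪ QName} {L : κ → Op (Fin n)} {F G : κ → Fam}
  {d : Finset QDomain}

theorem mem_pre (h : qdom q ⊆ d) {a : Amp} :
    a ∈ pre q L F d ↔ a ∈ cyl d ∧ ∀ i, opA q (L i) a ∈ F i d := by
  simp [pre, h, Submodule.mem_iInf]

theorem pre_eq_bot (h : ¬ qdom q ⊆ d) : pre q L F d = ⊥ := if_neg h

theorem pre_mono (h : ∀ i, F i ≤ G i) : pre q L F ≤ pre q L G := by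
  intro d
  by_cases hq : qdom q ⊆ d
  · intro a ha
    rw [mem_pre hq] at ha ⊢
    exact ⟨ha.1, fun i => h i d (ha.2 i)⟩
  · rw [pre_eq_bot hq]
    exact bot_le

end Pre

theorem mem_freePre {q : QName} {F : Fam} {d : Finset QDomain} (h : Sum.inl q ∈ d) {a : Amp} :
    a ∈ freePre q F d ↔
      a ∈ cyl d ∧ ∀ g, assign (single q) g a ∈ F (d.erase (Sum.inl q)) := by
  simp [freePre, h, Submodule.mem_iInf]

theorem freePre_eq_bot {q : QName} {F : Fam} {d : Finset QDomain} (h : Sum.inl q ∉ d) :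
    freePre q F d = ⊥ := if_neg h

theorem mem_allocPre {q : QName} {F : Fam} {d : Finset QDomain} {a : Amp} :
    a ∈ allocPre q F d ↔ a ∈ cyl d ∧ ∀ s : QDangle, Sum.inr s ∉ d → ∀ g,
      ket (single q) g * ren q s a ∈ F (insert (Sum.inl q) (renameDom q s d)) := by
  simp [allocPre, Submodule.mem_iInf]

theorem wp_mono (S : Stmt) : Monotone (wp S) := by
  induction S with
  | skip => exact fun _ _ h => h
  | qalloc q =>
    intro F G h d a ha
    rw [wp, mem_allocPre] at ha ⊢
    exact ⟨ha.1, fun s hs g => h _ (ha.2 s hs g)⟩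
  | qfree q =>
    intro F G h d
    by_cases hq : Sum.inl q ∈ d
    · intro a ha
      rw [wp, mem_freePre hq] at ha ⊢
      exact ⟨ha.1, fun g => h _ (ha.2 g)⟩
    · rw [wp, freePre_eq_bot hq]
      exact bot_le
  | reset q => exact fun F G h => pre_mono fun _ => h
  | unitary U q => exact fun F G h => pre_mono fun _ => h
  | seq S₁ S₂ ih₁ ih₂ => exact fun F G h => ih₁ (ih₂ h)
  | ifMeas M q S ih => exact fun F G h => pre_mono fun m => ih m h
  | whileMeas M q S ih =>
    intro F G h
    refine sSup_le_sSup fun X hX => le_trans hX (pre_mono fun m => ?_)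
    split_ifs
    · exact h
    · exact le_rfl

/-- The unrolling of a loop, as a map of families. -/
def unroll {n : ℕ} (M : Measurement n 2) (q : Fin n ↪ QName) (S : Stmt) (F X : Fam) : Fam :=
  pre q (fun m => (M.1 m).1) fun m => if m = 0 then F else wp S X

theorem unroll_mono {n : ℕ} (M : Measurement n 2) (q : Fin n ↪ QName) (S : Stmt) (F : Fam) :
    Monotone (unroll M q S F) := by
  intro X Y h
  refine pre_mono fun m => ?_
  split_ifs
  · exact le_rfl
  · exact wp_mono S h

theorem le_wp_while {n : ℕ} {M : Measurement n 2} {q : Fin n ↪ QName} {S : Stmt} {F X : Fam}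
    (h : X ≤ unroll M q S F X) : X ≤ wp (.whileMeas M q S) F :=
  le_sSup h

theorem wp_while_eq {n : ℕ} (M : Measurement n 2) (q : Fin n ↪ QName) (S : Stmt) (F : Fam) :
    wp (.whileMeas M q S) F = unroll M q S F (wp (.whileMeas M q S) F) := by
  have h : wp (.whileMeas M q S) F ≤ unroll M q S F (wp (.whileMeas M q S) F) :=
    sSup_le fun X hX => le_trans hX (unroll_mono M q S F (le_sSup hX))
  exact le_antisymm h (le_wp_while (unroll_mono M q S F h))

/-! ### Weakest preconditions and the operational semantics -/

/-- The support of the heap lies in the family. -/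
def SatF (ρ : QHeap) (F : Fam) : Prop := ∀ v ∈ supp ρ.2.1, amp ρ.1 v ∈ F ρ.1

/-- A configuration satisfies the invariant of an execution with postcondition `F`. -/
def Inv (F : Fam) : Config → Prop
  | (none, ρ) => SatF ρ F
  | (some S, ρ) => SatF ρ (wp S F)

theorem exists_mem_supp (ρ : QHeap) : ∃ v ∈ supp ρ.2.1, v ≠ 0 :=
  Submodule.exists_mem_ne_zero_of_ne_bot (matSupp_ne_bot ρ.2.2.2)

theorem SatF.ne_bot {ρ : QHeap} {F : Fam} (h : SatF ρ F) : F ρ.1 ≠ ⊥ := by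
  obtain ⟨v, hv, h0⟩ := exists_mem_supp ρ
  intro hF
  have := h v hv
  rw [hF, Submodule.mem_bot] at this
  exact h0 (amp_injective _ (this.trans (map_zero _).symm))

theorem SatF.mono {ρ : QHeap} {F G : Fam} (h : SatF ρ F) (hFG : F ρ.1 ≤ G ρ.1) : SatF ρ G :=
  fun v hv => hFG (h v hv)

theorem satF_iff_le {d : Finset QDomain} {ρ : Density d} {F : Fam} :
    SatF ⟨d, ρ⟩ F ↔ matSupp ρ.1 ≤ (F d).comap (amp d) := Iff.rfl

section

variable {n : ℕ} {q : Fin n ↪ QName} {d : Finset QDomain}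

theorem matSupp_act_le_iff (h : qdom q ⊆ d) (A : Op (Fin n)) (ρ : Density d)
    {V : Submodule ℂ Amp} :
    matSupp (act q h A ρ.1) ≤ V.comap (amp d) ↔
      ∀ v ∈ supp ρ.1, opA q A (amp d v) ∈ V := by
  rw [act, matSupp_conj_le_iff _ ρ.2.1]
  refine forall₂_congr fun v _ => ?_
  rw [Submodule.mem_comap, Submodule.mem_comap, amp_onQubits]

theorem matSupp_sum_act_le_iff {κ : Type} [Fintype κ] (h : qdom q ⊆ d) (A : κ → Op (Fin n))
    (ρ : Density d) {V : Submodule ℂ Amp} :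
    matSupp (∑ i, act q h (A i) ρ.1) ≤ V.comap (amp d) ↔
      ∀ i, ∀ v ∈ supp ρ.1, opA q (A i) (amp d v) ∈ V := by
  simp only [act]
  rw [matSupp_kraus_le_iff _ ρ.2.1]
  refine forall_congr' fun i => forall₂_congr fun v _ => ?_
  rw [Submodule.mem_comap, Submodule.mem_comap, amp_onQubits]

theorem satF_measure_iff (h : qdom q ⊆ d) {P : Op (Fin n)} {ρ ρ' : Density d}
    (hm : (onQubits q h P * ρ.1).trace ≠ 0)
    (hρ' : ρ'.1 = (onQubits q h P * ρ.1).trace⁻¹ • act q h P ρ.1) {F : Fam} :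
    SatF ⟨d, ρ'⟩ F ↔ ∀ v ∈ supp ρ.1, opA q P (amp d v) ∈ F d := by
  rw [satF_iff_le, hρ', matSupp_smul _ (inv_ne_zero hm), matSupp_act_le_iff]

theorem satF_pre_iff {κ : Type} {L : κ → Op (Fin n)} {F : κ → Fam} {ρ : Density d} :
    SatF ⟨d, ρ⟩ (pre q L F) ↔
      qdom q ⊆ d ∧ ∀ i, ∀ v ∈ supp ρ.1, opA q (L i) (amp d v) ∈ F i d := by
  constructor
  · intro h
    have hq : qdom q ⊆ d := by
      by_contra hq
      exact h.ne_bot (pre_eq_bot hq)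
    exact ⟨hq, fun i v hv => ((mem_pre hq).1 (h v hv)).2 i⟩
  · rintro ⟨hq, h⟩ v hv
    exact (mem_pre hq).2 ⟨amp_mem_cyl v, fun i => h i v hv⟩

theorem opA_eq_zero_of_trace (h : qdom q ⊆ d) (P : Proj n) (ρ : Density d)
    (h0 : (onQubits q h P.1 * ρ.1).trace = 0) {v : H d} (hv : v ∈ supp ρ.1) :
    opA q P.1 (amp d v) = 0 := by
  have h1 := mul_conjTranspose_eq_zero_of_trace ρ.2.1 (isStarProjection_onQubits q h P) h0
  have h2 := (matSupp_act_le_iff h P.1 ρ (V := ⊥)).1 (by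
    rw [act, h1, matSupp_zero]
    exact bot_le) v hv
  exact (Submodule.mem_bot ℂ).1 h2

theorem exists_trace_ne_zero {k : ℕ} (M : Measurement n k) (h : qdom q ⊆ d) (ρ : Density d) :
    ∃ m, (onQubits q h (M.1 m).1 * ρ.1).trace ≠ 0 := by
  by_contra! h0
  have : (∑ m, onQubits q h (M.1 m).1 * ρ.1).trace = 0 := by
    rw [Matrix.trace_sum]
    exact Finset.sum_eq_zero fun m _ => h0 m
  rw [← Finset.sum_mul, ← onQubits_sum, M.2, onQubits_one, one_mul, ρ.2.2] at this
  exact one_ne_zero this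

/-- The density operator that remains after a measurement outcome. -/
def measured (q : Fin n ↪ QName) (h : qdom q ⊆ d) (P : Proj n) (ρ : Density d)
    (hm : (onQubits q h P.1 * ρ.1).trace ≠ 0) : Density d :=
  ⟨(onQubits q h P.1 * ρ.1).trace⁻¹ • act q h P.1 ρ.1,
    density_measure ρ.2.1 (isStarProjection_onQubits q h P) hm⟩

end

theorem qdom_single (q : QName) : qdom (single q) = {Sum.inl q} := by
  ext x
  rw [mem_qdom_iff, Finset.mem_singleton]
  exact ⟨fun ⟨_, h⟩ => h.symm, fun h => ⟨0, h.symm⟩⟩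

theorem mem_erase_iff_qdom {q : QName} {d : Finset QDomain} :
    ∀ x ∈ d, x ∉ d.erase (Sum.inl q) ↔ x ∈ qdom (single q) := by
  intro x hx
  rw [qdom_single, Finset.mem_singleton, Finset.mem_erase]
  tauto

theorem mem_insert_iff_qdom {q : QName} {d : Finset QDomain} (h : Sum.inl q ∉ d) :
    ∀ x ∈ insert (Sum.inl q) d, x ∉ d ↔ x ∈ qdom (single q) := by
  intro x hx
  rw [qdom_single, Finset.mem_singleton]
  rw [Finset.mem_insert] at hx
  constructor
  · tauto
  · rintro rfl
    exact h

theorem satF_free_iff {q : QName} {d : Finset QDomain} {ρ : Density d}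
    {ρ' : Density (d.erase (Sum.inl q))} (hρ' : ρ'.1 = restr (d.erase (Sum.inl q)) ρ.1)
    {F : Fam} :
    SatF ⟨_, ρ'⟩ F ↔
      ∀ v ∈ supp ρ.1, ∀ g, assign (single q) g (amp d v) ∈ F (d.erase (Sum.inl q)) := by
  rw [satF_iff_le, hρ', restr_eq, matSupp_kraus_le_iff _ ρ.2.1]
  constructor
  · intro h v hv g
    obtain ⟨k, hk⟩ := exists_label (single q) (d \ d.erase (Sum.inl q)) g
    rw [← amp_sel_glue mem_erase_iff_qdom hk]
    exact h k hv
  · intro h k v hv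
    obtain ⟨g, hg⟩ := exists_label' (single q) _ k
    rw [Submodule.mem_comap, Submodule.mem_comap, amp_sel_glue mem_erase_iff_qdom hg]
    exact h v hv g

theorem qdom_single_subset_insert (q : QName) (d : Finset QDomain) :
    qdom (single q) ⊆ insert (Sum.inl q) d := by
  rw [qdom_single, Finset.singleton_subset_iff]
  exact Finset.mem_insert_self _ _

theorem SatF.alloc {q : QName} {s : QDangle} {d : Finset QDomain} (hs : Sum.inr s ∉ d)
    {ρ : Density d} {ρ' : Density (insert (Sum.inl q) (renameDom q s d))}
    (hρ' : restr (renameDom q s d) ρ'.1 = renameOp q s ρ.1) {F : Fam}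
    (h : SatF ⟨d, ρ⟩ (allocPre q F)) : SatF ⟨_, ρ'⟩ F := by
  have hd := mem_insert_iff_qdom (inl_notMem_renameDom (q := q) hs)
  have hsub : renameDom q s d ⊆ insert (Sum.inl q) (renameDom q s d) := Finset.subset_insert _ _
  obtain ⟨pull, -, hamp, hren⟩ := renameOp_eq q s (d := d)
  -- The slices of vectors in the support of the new heap, times a basis vector of the new qubit.
  have h1 : ∀ g, matSupp (restr (renameDom q s d) ρ'.1) ≤
      ((F (insert (Sum.inl q) (renameDom q s d))).comap
        (LinearMap.mulLeft ℂ (ket (single q) g))).comap (amp _) := by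
    intro g
    rw [hρ', hren, matSupp_conj_le_iff _ ρ.2.1]
    intro v hv
    rw [Submodule.mem_comap, Submodule.mem_comap, hamp]
    exact (mem_allocPre.1 (h v hv)).2 s hs g
  intro v hv
  rw [← sum_sel_glue hsub v, map_sum]
  refine Submodule.sum_mem _ fun k _ => ?_
  obtain ⟨g, hg⟩ := exists_label' (single q) _ k
  rw [amp_sel_glue_conjTranspose hsub hd (qdom_single_subset_insert _ _) hg]
  exact h1 g (matSupp_le_comap_sel ρ'.2.1 k hv)

/-- The heap that `qalloc` produces with a maximally mixed new qubit. -/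
theorem exists_alloc (q : QName) {s : QDangle} {d : Finset QDomain} (hs : Sum.inr s ∉ d)
    (ρ : Density d) : ∃ ρ' : Density (insert (Sum.inl q) (renameDom q s d)),
      restr (renameDom q s d) ρ'.1 = renameOp q s ρ.1 ∧
      ∀ F, SatF ⟨_, ρ'⟩ F → ∀ v ∈ supp ρ.1, ∀ g, ket (single q) g * ren q s (amp d v) ∈
        F (insert (Sum.inl q) (renameDom q s d)) := by
  have hd := mem_insert_iff_qdom (inl_notMem_renameDom (q := q) hs)
  have hsub : renameDom q s d ⊆ insert (Sum.inl q) (renameDom q s d) := Finset.subset_insert _ _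
  obtain ⟨pull, hbij, hamp, hren⟩ := renameOp_eq q s (d := d)
  have hσ : (renameOp q s ρ.1).PosSemidef ∧ (renameOp q s ρ.1).trace = 1 := by
    rw [hren, sel_mul_mul]
    exact ⟨ρ.2.1.submatrix pull, (hbij.sum_comp fun f => ρ.1 f f).trans ρ.2.2⟩
  obtain ⟨ρ', h1, h2, h3⟩ := exists_density_extension hsub hσ
  refine ⟨⟨ρ', h1⟩, h2, fun F hF v hv g => ?_⟩
  obtain ⟨k, hk⟩ := exists_label (single q) (insert (Sum.inl q) (renameDom q s d) \
    renameDom q s d) g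
  have h4 := h3 ((F (insert (Sum.inl q) (renameDom q s d))).comap (amp _)) hF k
  rw [hren] at h4
  have h5 : amp (insert (Sum.inl q) (renameDom q s d))
      (Matrix.toEuclideanLin (sel fun f => glue f k)ᴴ (Matrix.toEuclideanLin (sel pull) v)) ∈
        F (insert (Sum.inl q) (renameDom q s d)) :=
    (matSupp_conj_le_iff (sel pull) ρ.2.1).1 h4 hv
  have h6 := amp_sel_glue_conjTranspose hsub hd (qdom_single_subset_insert _ _) hk
    (Matrix.toEuclideanLin (sel pull) v)
  rw [h6, hamp] at h5
  exact h5

/-- The weakest preconditions are an invariant of execution. -/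
theorem Inv.step {c c' : Config} (h : Step c c') : ∀ {F : Fam}, Inv F c → Inv F c' := by
  induction h with
  | skip ρ => exact fun h => h
  | reset q h ρ ρ' hρ' =>
    intro F hF
    rw [Inv, wp, satF_pre_iff] at hF
    rw [Inv, satF_iff_le, hρ', matSupp_sum_act_le_iff]
    exact hF.2
  | unitary U q h ρ ρ' hρ' =>
    intro F hF
    rw [Inv, wp, satF_pre_iff] at hF
    rw [Inv, satF_iff_le, hρ', matSupp_act_le_iff]
    exact hF.2 ()
  | qalloc q s hs ρ ρ' hρ' => exact fun hF => SatF.alloc hs hρ' hF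
  | qfree q hq ρ ρ' hρ' =>
    intro F hF
    rw [Inv, satF_free_iff hρ']
    exact fun v hv => ((mem_freePre hq).1 (hF v hv)).2
  | seqStep S₂ _ ih => exact fun hF => ih (F := wp S₂ _) hF
  | seqDone S₂ _ ih => exact fun hF => ih (F := wp S₂ _) hF
  | ifMeas M q S m h ρ ρ' hm hρ' =>
    intro F hF
    rw [Inv, wp, satF_pre_iff] at hF
    rw [Inv, satF_measure_iff h hm hρ']
    exact hF.2 m
  | whileDone M q S h ρ ρ' hm hρ' =>
    intro F hF
    rw [Inv, wp_while_eq, unroll, satF_pre_iff] at hF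
    rw [Inv, satF_measure_iff h hm hρ']
    exact hF.2 0
  | whileLoop M q S h ρ ρ' hm hρ' =>
    intro F hF
    rw [Inv, wp_while_eq, unroll, satF_pre_iff] at hF
    rw [Inv, satF_measure_iff h hm hρ']
    exact hF.2 1

/-- A heap that satisfies the weakest precondition is not stuck. -/
theorem Inv.progress (S : Stmt) : ∀ {F : Fam} {ρ : QHeap}, Inv F (some S, ρ) →
    ∃ c, Step (some S, ρ) c := by
  induction S with
  | skip => exact fun _ => ⟨_, .skip _⟩
  | qalloc q =>
    rintro F ⟨d, ρ⟩ -
    obtain ⟨s, hs⟩ := exists_dangle_notMem d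
    obtain ⟨ρ', h, -⟩ := exists_alloc q hs ρ
    exact ⟨_, .qalloc q s hs ρ ρ' h⟩
  | qfree q =>
    rintro F ⟨d, ρ⟩ hF
    have hq : Sum.inl q ∈ d := by
      by_contra hq
      exact SatF.ne_bot hF (freePre_eq_bot hq)
    refine ⟨_, .qfree q hq ρ ⟨restr _ ρ.1, ?_⟩ rfl⟩
    rw [restr_eq]
    exact density_kraus (sum_conjTranspose_mul_sel_glue (Finset.erase_subset _ _)) ρ.2
  | reset q =>
    rintro F ⟨d, ρ⟩ hF
    have hq := (satF_pre_iff.1 hF).1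
    exact ⟨_, .reset q hq ρ ⟨_, density_kraus
      (sum_conjTranspose_mul_onQubits q hq (sum_conjTranspose_mul_single _)) ρ.2⟩ rfl⟩
  | unitary U q =>
    rintro F ⟨d, ρ⟩ hF
    have hq := (satF_pre_iff.1 hF).1
    have hU : ∑ _i : Unit, (U.1)ᴴ * U.1 = 1 := by
      simpa [Matrix.star_eq_conjTranspose] using Matrix.mem_unitaryGroup_iff'.1 U.2
    have := density_kraus (sum_conjTranspose_mul_onQubits q hq hU) ρ.2
    rw [Fintype.sum_unique] at this
    exact ⟨_, .unitary U q hq ρ ⟨_, this⟩ rfl⟩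
  | seq S₁ S₂ ih₁ _ =>
    intro F ρ hF
    obtain ⟨⟨S, ρ'⟩, h⟩ := ih₁ (F := wp S₂ F) hF
    cases S with
    | none => exact ⟨_, .seqDone S₂ h⟩
    | some S => exact ⟨_, .seqStep S₂ h⟩
  | ifMeas M q S _ =>
    rintro F ⟨d, ρ⟩ hF
    have hq := (satF_pre_iff.1 hF).1
    obtain ⟨m, hm⟩ := exists_trace_ne_zero M hq ρ
    exact ⟨_, .ifMeas M q S m hq ρ (measured q hq _ ρ hm) hm rfl⟩
  | whileMeas M q S _ =>
    rintro F ⟨d, ρ⟩ hF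
    rw [Inv, wp_while_eq, unroll] at hF
    have hq := (satF_pre_iff.1 hF).1
    obtain ⟨m, hm⟩ := exists_trace_ne_zero M hq ρ
    fin_cases m
    · exact ⟨_, .whileDone M q S hq ρ (measured q hq _ ρ hm) hm rfl⟩
    · exact ⟨_, .whileLoop M q S hq ρ (measured q hq _ ρ hm) hm rfl⟩

/-- Every configuration reached is terminated with a heap in `F`, or can make another step. -/
def Correct (F : Fam) (c : Config) : Prop :=
  (∀ S ρ, Relation.ReflTransGen Step c (some S, ρ) → ∃ c', Step (some S, ρ) c') ∧
    ∀ ρ, Relation.ReflTransGen Step c (none, ρ) → SatF ρ F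

theorem Inv.correct {F : Fam} {c : Config} (h : Inv F c) : Correct F c := by
  have key : ∀ c', Relation.ReflTransGen Step c c' → Inv F c' := by
    intro c' hc
    induction hc with
    | refl => exact h
    | tail _ h' ih => exact Inv.step h' ih
  exact ⟨fun S ρ hr => Inv.progress S (key _ hr), fun ρ hr => key _ hr⟩

theorem Correct.step {F : Fam} {c c' : Config} (h : Correct F c) (hs : Step c c') :
    Correct F c' :=
  ⟨fun S ρ hr => h.1 S ρ (.head hs hr), fun ρ hr => h.2 ρ (.head hs hr)⟩

theorem Correct.exists_step {F : Fam} {S : Stmt} {ρ : QHeap} (h : Correct F (some S, ρ)) :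
    ∃ c, Step (some S, ρ) c := h.1 S ρ .refl

theorem Correct.satF {F : Fam} {ρ : QHeap} (h : Correct F (none, ρ)) : SatF ρ F := h.2 ρ .refl

/-- The span of the supports of all heaps from which the executions of `S` are correct. -/
def correctSpan (S : Stmt) (F : Fam) : Fam :=
  fun d => ⨆ (ρ : Density d) (_ : Correct F (some S, ⟨d, ρ⟩)), (supp ρ.1).map (amp d)

theorem Correct.satF_correctSpan {S : Stmt} {F : Fam} {ρ : QHeap} (h : Correct F (some S, ρ)) :
    SatF ρ (correctSpan S F) :=
  fun _ hv => Submodule.mem_iSup_of_mem ρ.2 (Submodule.mem_iSup_of_mem h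
    (Submodule.mem_map_of_mem hv))

theorem correctSpan_le {S : Stmt} {F G : Fam}
    (h : ∀ ρ, Correct F (some S, ρ) → SatF ρ G) : correctSpan S F ≤ G := by
  intro d
  refine iSup₂_le fun ρ hρ => ?_
  rw [Submodule.map_le_iff_le_comap]
  exact h ⟨d, ρ⟩ hρ

theorem reaches_seq {S₁ : Stmt} (S₂ : Stmt) {ρ : QHeap} {c : Config}
    (h : Relation.ReflTransGen Step (some S₁, ρ) c) :
    Relation.ReflTransGen Step (some (.seq S₁ S₂), ρ)
      (c.1.elim (some S₂) fun S => some (.seq S S₂), c.2) := by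
  induction h with
  | refl => exact .refl
  | @tail b c _ hs ih =>
    refine ih.tail ?_
    obtain ⟨b, ρb⟩ := b
    obtain ⟨c, ρc⟩ := c
    cases b with
    | none => cases hs
    | some b =>
      cases c with
      | none => exact .seqDone S₂ hs
      | some c => exact .seqStep S₂ hs

theorem Correct.of_reaches {F : Fam} {c c' : Config} (h : Correct F c)
    (hr : Relation.ReflTransGen Step c c') : Correct F c' :=
  ⟨fun S ρ hr' => h.1 S ρ (hr.trans hr'), fun ρ hr' => h.2 ρ (hr.trans hr')⟩

/-- The heaps with which the first statement of a sequence terminates are correct for the second. -/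
theorem Correct.seq_left {S₁ S₂ : Stmt} {F : Fam} {ρ : QHeap}
    (h : Correct F (some (.seq S₁ S₂), ρ)) : Correct (correctSpan S₂ F) (some S₁, ρ) := by
  constructor
  · intro S ρ' hr
    obtain ⟨c, hc⟩ := (h.of_reaches (reaches_seq S₂ hr)).exists_step
    cases hc with
    | seqStep _ hs => exact ⟨_, hs⟩
    | seqDone _ hs => exact ⟨_, hs⟩
  · intro ρ' hr
    exact (h.of_reaches (reaches_seq S₂ hr)).satF_correctSpan

/-- A heap from which all executions are correct satisfies the weakest precondition. For a loop, the
span of the supports of such heaps is a post-fixed point of the unrolling. -/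
theorem Correct.satF_wp (S : Stmt) : ∀ {F : Fam} {ρ : QHeap}, Correct F (some S, ρ) →
    SatF ρ (wp S F) := by
  induction S with
  | skip => exact fun h => (h.step (.skip _)).satF
  | qalloc q =>
    rintro F ⟨d, ρ⟩ h v hv
    refine mem_allocPre.2 ⟨amp_mem_cyl v, fun s hs g => ?_⟩
    obtain ⟨ρ', hρ', h'⟩ := exists_alloc q hs ρ
    exact h' F (h.step (.qalloc q s hs ρ ρ' hρ')).satF v hv g
  | qfree q =>
    rintro F ⟨d, ρ⟩ h
    obtain ⟨c, hc⟩ := h.exists_step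
    cases hc with
    | qfree _ hq _ ρ' hρ' =>
      have := (satF_free_iff hρ').1 (h.step (.qfree q hq ρ ρ' hρ')).satF
      exact fun v hv => (mem_freePre hq).2 ⟨amp_mem_cyl v, this v hv⟩
  | reset q =>
    rintro F ⟨d, ρ⟩ h
    obtain ⟨c, hc⟩ := h.exists_step
    cases hc with
    | reset _ hq _ ρ' hρ' =>
      have := (h.step (.reset q hq ρ ρ' hρ')).satF
      rw [satF_iff_le, hρ', matSupp_sum_act_le_iff] at this
      exact satF_pre_iff.2 ⟨hq, this⟩
  | unitary U q =>
    rintro F ⟨d, ρ⟩ h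
    obtain ⟨c, hc⟩ := h.exists_step
    cases hc with
    | unitary _ _ hq _ ρ' hρ' =>
      have := (h.step (.unitary U q hq ρ ρ' hρ')).satF
      rw [satF_iff_le, hρ', matSupp_act_le_iff] at this
      exact satF_pre_iff.2 ⟨hq, fun _ => this⟩
  | seq S₁ S₂ ih₁ ih₂ =>
    intro F ρ h
    exact (ih₁ h.seq_left).mono (wp_mono S₁ (correctSpan_le fun _ => ih₂) _)
  | ifMeas M q S ih =>
    rintro F ⟨d, ρ⟩ h
    obtain ⟨c, hc⟩ := h.exists_step
    have hq : qdom q ⊆ d := by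
      cases hc with
      | ifMeas _ _ _ _ hq => exact hq
    refine satF_pre_iff.2 ⟨hq, fun m v hv => ?_⟩
    by_cases hm : (onQubits q hq (M.1 m).1 * ρ.1).trace = 0
    · rw [opA_eq_zero_of_trace hq (M.1 m) ρ hm hv]
      exact Submodule.zero_mem _
    · exact (satF_measure_iff hq hm rfl).1 (ih m
        (h.step (.ifMeas M q S m hq ρ (measured q hq _ ρ hm) hm rfl))) v hv
  | whileMeas M q S ih =>
    intro F ρ h
    refine h.satF_correctSpan.mono (le_wp_while (correctSpan_le ?_) _)
    clear h ρ
    rintro ⟨d, ρ⟩ h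
    obtain ⟨c, hc⟩ := h.exists_step
    have hq : qdom q ⊆ d := by
      cases hc with
      | whileDone _ _ _ hq => exact hq
      | whileLoop _ _ _ hq => exact hq
    refine satF_pre_iff.2 ⟨hq, fun m v hv => ?_⟩
    by_cases hm : (onQubits q hq (M.1 m).1 * ρ.1).trace = 0
    · rw [opA_eq_zero_of_trace hq (M.1 m) ρ hm hv]
      exact Submodule.zero_mem _
    · refine (satF_measure_iff (F := if m = 0 then F else _) hq hm
        (ρ' := measured q hq _ ρ hm) rfl).1 ?_ v hv
      fin_cases m
      · exact (h.step (.whileDone M q S hq ρ (measured q hq _ ρ hm) hm rfl)).satF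
      · exact ih (h.step (.whileLoop M q S hq ρ (measured q hq _ ρ hm) hm rfl)).seq_left

/-! ### Assertions as families of amplitude functions -/

/-- The meaning of an assertion, as a family of subspaces of `Amp`. -/
def denA (ψ : Assr) : Fam := fun d => (den ψ d).map (amp d)

theorem amp_mem_denA {ψ : Assr} {d : Finset QDomain} {v : H d} :
    amp d v ∈ denA ψ d ↔ v ∈ den ψ d :=
  ⟨fun ⟨_, hu, h⟩ => amp_injective d h ▸ hu, Submodule.mem_map_of_mem⟩

theorem denA_le_cyl (ψ : Assr) (d : Finset QDomain) : denA ψ d ≤ cyl d := by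
  rintro _ ⟨v, -, rfl⟩
  exact amp_mem_cyl v

theorem entails_iff {ψ φ : Assr} : Entails ψ φ ↔ denA ψ ≤ denA φ :=
  forall_congr' fun d => (Submodule.map_le_map_iff_of_injective (amp_injective d) _ _).symm

theorem sat_iff {ρ : QHeap} {ψ : Assr} : Sat ρ ψ ↔ SatF ρ (denA ψ) :=
  forall₂_congr fun _ _ => amp_mem_denA.symm

/-- Validity of a triple is an inclusion of families. -/
theorem valid_iff {ψ φ : Assr} {S : Stmt} : Valid ψ S φ ↔ denA ψ ≤ wp S (denA φ) := by
  constructor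
  · intro h d
    rintro _ ⟨v, hv, rfl⟩
    by_cases h0 : v = 0
    · rw [h0, map_zero]
      exact Submodule.zero_mem _
    obtain ⟨ρ, hρ, hmem, hle⟩ := exists_pure_state h0
    have h1 := h ⟨d, ρ, hρ⟩ (hle _ hv)
    have h2 : Correct (denA φ) (some S, ⟨d, ρ, hρ⟩) :=
      ⟨h1.1, fun ρ' hr => sat_iff.1 (h1.2 ρ' hr)⟩
    exact h2.satF_wp S v hmem
  · intro h ρ hρ
    have h1 : Inv (denA φ) (some S, ρ) := (sat_iff.1 hρ).mono (h _)
    exact ⟨h1.correct.1, fun ρ' hr => sat_iff.2 (h1.correct.2 ρ' hr)⟩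

/-- The separating conjunction of families. -/
def star (F G : Fam) : Fam :=
  fun d => ⨆ (d' : Finset QDomain) (_ : d' ⊆ d), F d' * G (d \ d')

/-- The separating implication of families. -/
def wandF (F G : Fam) : Fam :=
  fun d => cyl d ⊓ ⨅ (d' : Finset QDomain) (_ : Disjoint d' d) (u : Amp) (_ : u ∈ F d'),
    (G (d' ∪ d)).comap (LinearMap.mulLeft ℂ u)

theorem mem_wandF {F G : Fam} {d : Finset QDomain} {a : Amp} :
    a ∈ wandF F G d ↔
      a ∈ cyl d ∧ ∀ d', Disjoint d' d → ∀ u ∈ F d', u * a ∈ G (d' ∪ d) := by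
  simp [wandF, Submodule.mem_iInf]

theorem star_le {F G K : Fam} :
    star F G ≤ K ↔ ∀ d d', d' ⊆ d → ∀ u ∈ F d', ∀ v ∈ G (d \ d'), u * v ∈ K d := by
  simp only [Pi.le_def, star, iSup_le_iff, Submodule.mul_le]

theorem mul_mem_star {F G : Fam} {d d' e : Finset QDomain} (h : d' ⊆ d) (he : e = d \ d')
    {u v : Amp} (hu : u ∈ F d') (hv : v ∈ G e) : u * v ∈ star F G d := by
  subst he
  exact Submodule.mem_iSup_of_mem d' (Submodule.mem_iSup_of_mem h (Submodule.mul_mem_mul hu hv))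

theorem denA_top (d : Finset QDomain) : denA .top d = cyl d := by
  rw [denA, den, Submodule.map_top, range_amp]

theorem denA_bot (d : Finset QDomain) : denA .bot d = ⊥ := by
  rw [denA, den, Submodule.map_bot]

theorem denA_emp (d : Finset QDomain) : denA .emp d = if d = ∅ then cyl ∅ else ⊥ := by
  rw [denA, den]
  split_ifs with h
  · subst h
    rw [Submodule.map_top, range_amp]
  · exact Submodule.map_bot _

theorem denA_and (ψ φ : Assr) : denA (.and ψ φ) = denA ψ ⊓ denA φ :=
  funext fun d => Submodule.map_inf _ (amp_injective d)

theorem denA_or (ψ φ : Assr) : denA (.or ψ φ) = denA ψ ⊔ denA φ :=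
  funext fun _ => Submodule.map_sup _ _ _

theorem denA_sep (ψ φ : Assr) : denA (.sep ψ φ) = star (denA ψ) (denA φ) := by
  ext1 d
  simp only [denA, den, star, Submodule.map_iSup, map_amp_tensor]

theorem denA_wand (ψ φ : Assr) : denA (.wand ψ φ) = wandF (denA ψ) (denA φ) := by
  ext d a
  rw [mem_wandF]
  have key : ∀ v : H d, v ∈ den (.wand ψ φ) d ↔
      ∀ d', Disjoint d' d → ∀ u ∈ denA ψ d', u * amp d v ∈ denA φ (d' ∪ d) := by
    intro v
    simp only [den, Submodule.mem_iInf]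
    refine forall₂_congr fun d' _ => ?_
    constructor
    · rintro h _ ⟨u, hu, rfl⟩
      exact ⟨_, h u hu, rfl⟩
    · intro h u hu
      exact amp_mem_denA.1 (h _ (Submodule.mem_map_of_mem hu))
  constructor
  · rintro ⟨v, hv, rfl⟩
    exact ⟨amp_mem_cyl v, (key v).1 hv⟩
  · rintro ⟨ha, h⟩
    obtain ⟨v, rfl⟩ := exists_amp_eq ha
    exact Submodule.mem_map_of_mem ((key v).2 h)

theorem mem_denA_pointsTo {n : ℕ} {q : Fin n ↪ QName} {P : Proj n} {a : Amp} :
    a ∈ denA (.pointsTo q P) (qdom q) ↔ a ∈ cyl (qdom q) ∧ opA q P.1 a = a := by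
  rw [denA, den, dif_pos rfl]
  constructor
  · rintro ⟨v, hv, rfl⟩
    refine ⟨amp_mem_cyl v, ?_⟩
    rw [← amp_onQubits q subset_rfl]
    exact congrArg _ hv
  · rintro ⟨ha, h⟩
    obtain ⟨v, rfl⟩ := exists_amp_eq ha
    rw [← amp_onQubits q subset_rfl] at h
    exact Submodule.mem_map_of_mem (amp_injective _ h)

theorem denA_pointsTo_eq_bot {n : ℕ} {q : Fin n ↪ QName} {P : Proj n} {d : Finset QDomain}
    (h : d ≠ qdom q) : denA (.pointsTo q P) d = ⊥ := by
  rw [denA, den, dif_neg h.symm, Submodule.map_bot]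

theorem denA_pointsTo_one {n : ℕ} {q : Fin n ↪ QName} :
    denA (.pointsTo q (Proj.one n)) (qdom q) = cyl (qdom q) := by
  ext a
  rw [mem_denA_pointsTo]
  simp [Proj.one, opA_one]

/-! ### Local families -/

/-- Two domains contain the same names of `Q`, and equally many others up to the bound `N`. -/
def SameType (Q : Finset QDomain) (N : ℕ) (d d' : Finset QDomain) : Prop :=
  d ∩ Q = d' ∩ Q ∧ min (d \ Q).card N = min (d' \ Q).card N

/-- A family is local if the slices of its members at the names in `Q`, tensored with any vector
of the other names, lie in it at every domain of the same type. So the family depends only on the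
type of the domain, and is a full tensor factor on the names outside `Q`. -/
structure Local (Q : Finset QDomain) (N : ℕ) (F : Fam) : Prop where
  le_cyl : ∀ d, F d ≤ cyl d
  transfer : ∀ {d d'}, SameType Q N d d' → ∀ {a}, a ∈ F d → ∀ (k : Label) {t},
    t ∈ cyl (d' \ Q) → freeze Q k a * t ∈ F d'

theorem SameType.symm {Q : Finset QDomain} {N : ℕ} {d d' : Finset QDomain}
    (h : SameType Q N d d') : SameType Q N d' d := ⟨h.1.symm, h.2.symm⟩

theorem SameType.mem_iff {Q : Finset QDomain} {N : ℕ} {d d' : Finset QDomain}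
    (h : SameType Q N d d') {x : QDomain} (hx : x ∈ Q) : x ∈ d ↔ x ∈ d' := by
  have := Finset.ext_iff.1 h.1 x
  simpa [hx] using this

theorem SameType.subset_iff {Q : Finset QDomain} {N : ℕ} {d d' c : Finset QDomain}
    (h : SameType Q N d d') (hc : c ⊆ Q) : c ⊆ d ↔ c ⊆ d' :=
  forall₂_congr fun _ hx => h.mem_iff (hc hx)

theorem SameType.anti_right {Q : Finset QDomain} {N N' : ℕ} (hN : N ≤ N')
    {d d' : Finset QDomain} (h : SameType Q N' d d') : SameType Q N d d' := by
  refine ⟨h.1, ?_⟩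
  have := h.2
  omega

theorem SameType.anti_left {Q Q' : Finset QDomain} {N : ℕ} (hQ : Q' ⊆ Q)
    {d d' : Finset QDomain} (h : SameType Q N d d') : SameType Q' N d d' := by
  constructor
  · ext x
    simp only [Finset.mem_inter]
    exact and_congr_left fun hx => h.mem_iff (hQ hx)
  · have e : ∀ c : Finset QDomain, c \ Q' = (c \ Q) ∪ (c ∩ Q) \ Q' := by
      intro c
      ext x
      simp only [Finset.mem_sdiff, Finset.mem_union, Finset.mem_inter]
      by_cases hx : x ∈ Q' <;> by_cases hx' : x ∈ Q <;> simp [hx, hx']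
      exact absurd (hQ hx) hx'
    have hdis : ∀ c : Finset QDomain, Disjoint (c \ Q) ((c ∩ Q) \ Q') := by
      intro c
      rw [Finset.disjoint_left]
      intro x hx hx'
      simp only [Finset.mem_sdiff, Finset.mem_inter] at hx hx'
      exact hx.2 hx'.1.2
    rw [e d, e d', Finset.card_union_of_disjoint (hdis d), Finset.card_union_of_disjoint (hdis d'),
      h.1]
    have := h.2
    omega

theorem freeze_mul_mem_cyl {Q : Finset QDomain} {N : ℕ} {d d' : Finset QDomain}
    (h : SameType Q N d d') {a : Amp} (ha : a ∈ cyl d) (k : Label) {t : Amp}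
    (ht : t ∈ cyl (d' \ Q)) : freeze Q k a * t ∈ cyl d' := by
  have h1 := freeze_mem_cyl (Q := Q) k ha
  rw [h.1] at h1
  exact mul_mem_cyl (cyl_mono Finset.inter_subset_left h1) (cyl_mono Finset.sdiff_subset ht)

/-- Membership in a subspace can be tested on slices. -/
theorem mem_of_freeze {Q d : Finset QDomain} {V : Submodule ℂ Amp} {a : Amp} (ha : a ∈ cyl d)
    (h : ∀ k, ∀ t ∈ cyl (d \ Q), freeze Q k a * t ∈ V) : a ∈ V := by
  obtain ⟨t, ht, hsum⟩ := eq_sum_freeze Q ha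
  rw [hsum]
  exact Submodule.sum_mem _ fun j _ => h _ _ (ht j)

theorem freeze_freeze_mul {Q : Finset QDomain} (j k : Label) (a : Amp) {c : Finset QDomain}
    {t : Amp} (ht : t ∈ cyl c) (hc : Disjoint c Q) :
    freeze Q j (freeze Q k a * t) = t j • freeze Q k a := by
  have h1 : freeze Q j (freeze Q k a) = freeze Q k a := by
    ext f
    simp only [freeze_apply]
    congr 1
    ext1 x
    by_cases hx : x ∈ Q <;> simp [hx]
  rw [map_mul, h1, freeze_eq_const j ht hc, mul_smul_comm, mul_one]

theorem amp_sel_glue_eq_freeze {Q e d : Finset QDomain} (he : e = d ∩ Q)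
    (k : (d \ e : Finset QDomain) → Fin 2) (v : H d) :
    amp e (Matrix.toEuclideanLin (sel fun f => glue f k) v) =
      freeze Q (zeroExt k) (amp d v) := by
  ext f
  rw [amp_apply, sel_apply, freeze_apply, amp_apply]
  refine congrArg v.ofLp ?_
  ext1 x
  by_cases hx : x.1 ∈ e
  · have hQ : x.1 ∈ Q := by
      rw [he] at hx
      exact (Finset.mem_inter.1 hx).2
    simp [glue_apply_of_mem _ _ hx, hQ]
  · have hQ : x.1 ∉ Q := fun h => hx (by rw [he]; exact Finset.mem_inter.2 ⟨x.2, h⟩)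
    simp [glue_apply_of_notMem _ _ hx, hQ, zeroExt, hx]

theorem local_cyl (Q : Finset QDomain) (N : ℕ) : Local Q N cyl :=
  ⟨fun _ => le_rfl, fun hd _ ha k _ ht => freeze_mul_mem_cyl hd ha k ht⟩

namespace Local

variable {Q Q' : Finset QDomain} {N N' : ℕ} {F G : Fam}

theorem mono_right (hN : N ≤ N') (h : Local Q N F) : Local Q N' F :=
  ⟨h.le_cyl, fun hd => h.transfer (hd.anti_right hN)⟩

theorem mono_left (hQ : Q' ⊆ Q) (h : Local Q' N F) : Local Q N F := by
  refine ⟨h.le_cyl, fun {d d'} hd {a} ha k {t} ht => ?_⟩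
  have hd' := hd.anti_left hQ
  refine mem_of_freeze (Q := Q') (freeze_mul_mem_cyl hd (h.le_cyl _ ha) k ht) fun j t' ht' => ?_
  -- The slices over `Q'` of a slice over `Q` are multiples of slices over `Q'`.
  have h2 : freeze Q' j (freeze Q k a * t) = t j • freeze Q' (Q.piecewise j k) a := by
    rw [map_mul, freeze_freeze hQ, freeze_eq_const j ht, mul_smul_comm, mul_one]
    exact Finset.disjoint_of_subset_right hQ Finset.sdiff_disjoint
  rw [h2, smul_mul_assoc]
  exact Submodule.smul_mem _ _ (h.transfer hd' ha _ ht')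

theorem bot (Q : Finset QDomain) (N : ℕ) : Local Q N ⊥ := by
  refine ⟨fun _ => bot_le, fun {_ _} _ {a} ha k {t} _ => ?_⟩
  rw [Pi.bot_apply, Submodule.mem_bot] at ha ⊢
  rw [ha, map_zero, zero_mul]

theorem inf (hF : Local Q N F) (hG : Local Q N G) : Local Q N (F ⊓ G) :=
  ⟨fun d => inf_le_left.trans (hF.le_cyl d), fun hd _ ha k _ ht =>
    ⟨hF.transfer hd ha.1 k ht, hG.transfer hd ha.2 k ht⟩⟩

theorem sup (hF : Local Q N F) (hG : Local Q N G) : Local Q N (F ⊔ G) := by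
  refine ⟨fun d => sup_le (hF.le_cyl d) (hG.le_cyl d), fun {_ _} hd {a} ha k {t} ht => ?_⟩
  obtain ⟨b, hb, c, hc, rfl⟩ := Submodule.mem_sup.1 ha
  rw [map_add, add_mul]
  exact Submodule.add_mem_sup (hF.transfer hd hb k ht) (hG.transfer hd hc k ht)

/-- A family that lives on a single domain inside `Q` is local. -/
theorem of_single {d₀ : Finset QDomain} (hd₀ : d₀ ⊆ Q) (hle : F d₀ ≤ cyl d₀)
    (hF : ∀ d, d ≠ d₀ → F d = ⊥) : Local Q 1 F := by
  have hle' : ∀ d, F d ≤ cyl d := by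
    intro d
    by_cases h : d = d₀
    · exact h ▸ hle
    · exact (hF d h).le.trans bot_le
  refine ⟨hle', fun {d d'} hd {a} ha k {t} ht => ?_⟩
  by_cases h : d = d₀
  · subst h
    have h0 : d \ Q = ∅ := Finset.sdiff_eq_empty_iff_subset.2 hd₀
    have h1 : (d' \ Q).card = 0 := by
      have := hd.2
      rw [h0, Finset.card_empty] at this
      omega
    have h1' := Finset.card_eq_zero.1 h1
    have h2 : d = d' := by
      have h3 := hd.1
      rwa [Finset.inter_eq_left.2 hd₀,
        Finset.inter_eq_left.2 (Finset.sdiff_eq_empty_iff_subset.1 h1')] at h3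
    subst h2
    rw [freeze_eq_self k (hle ha) hd₀]
    rw [h1'] at ht
    have h4 : t = t 0 • (1 : Amp) := by
      ext f
      simpa using ht f 0 (by simp)
    rw [h4, mul_smul_comm, mul_one]
    exact Submodule.smul_mem _ _ ha
  · rw [hF d h, Submodule.mem_bot] at ha
    rw [ha, map_zero, zero_mul]
    exact Submodule.zero_mem _

/-- The inner product is the sum of the inner products of the slices, so orthogonal complements of
local families are local. -/
theorem neg {ψ : Assr} (h : Local Q N (denA ψ)) : Local Q N (denA (.neg ψ)) := by
  refine ⟨denA_le_cyl _, ?_⟩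
  rintro d d' hd _ ⟨v, hv, rfl⟩ k t ht
  obtain ⟨w, hw⟩ := exists_amp_eq (freeze_mul_mem_cyl hd (amp_mem_cyl v) k ht)
  rw [← hw]
  refine amp_mem_denA.2 ((Submodule.mem_orthogonal _ _).2 fun u hu => ?_)
  obtain ⟨e, he⟩ : ∃ e, e = d ∩ Q := ⟨_, rfl⟩
  have he' : e = d' ∩ Q := he.trans hd.1
  have hsub : e ⊆ d := he ▸ Finset.inter_subset_left
  have hsub' : e ⊆ d' := he' ▸ Finset.inter_subset_left
  let kd : (d \ e : Finset QDomain) → Fin 2 := fun x => k x.1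
  let x : H e := Matrix.toEuclideanLin (sel fun f => glue f kd) v
  have hx : amp e x = freeze Q k (amp d v) := by
    rw [amp_sel_glue_eq_freeze he]
    refine freeze_congr (amp_mem_cyl v) fun y hy hyQ => ?_
    have : y ∈ d \ e := Finset.mem_sdiff.2 ⟨hy, fun h => hyQ (by
      rw [he] at h
      exact (Finset.mem_inter.1 h).2)⟩
    simp only [zeroExt, this, dif_pos, kd]
  have hdQ : Disjoint (d' \ Q) Q := Finset.sdiff_disjoint
  rw [← sum_sel_glue hsub' w, inner_sum]
  refine Finset.sum_eq_zero fun j _ => ?_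
  rw [inner_toEuclideanLin, Matrix.conjTranspose_conjTranspose]
  have h1 : Matrix.toEuclideanLin (sel fun f => glue f j) w = t (zeroExt j) • x := by
    apply amp_injective e
    rw [amp_sel_glue_eq_freeze he', map_smul, hx, hw, freeze_freeze_mul _ _ _ ht hdQ]
  have h2 : Matrix.toEuclideanLin (sel fun f => glue f kd)ᴴ
      (Matrix.toEuclideanLin (sel fun f => glue f j) u) ∈ den ψ d := by
    let i : Amp := fun f => if (fun y : (d \ e : Finset QDomain) => f y.1) = kd then 1 else 0
    have hi : i ∈ cyl (d \ Q) := by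
      intro f g hfg
      have : (fun y : (d \ e : Finset QDomain) => f y.1) = fun y => g y.1 := by
        refine funext fun y => hfg _ ?_
        obtain ⟨h1, h2⟩ := Finset.mem_sdiff.1 y.2
        exact Finset.mem_sdiff.2 ⟨h1, fun h =>
          h2 ((Finset.ext_iff.1 he _).2 (Finset.mem_inter.2 ⟨h1, h⟩))⟩
      simp only [i, this]
    rw [← amp_mem_denA]
    have := h.transfer hd.symm (amp_mem_denA.2 hu) (zeroExt j) hi
    convert this using 1
    rw [← amp_sel_glue_eq_freeze he']
    ext f
    rw [amp_apply, sel_glue_conjTranspose_apply hsub, Pi.mul_apply, amp_apply]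
    simp only [i, mul_ite, mul_one, mul_zero]
  rw [h1, inner_smul_right]
  have h3 := inner_toEuclideanLin (sel fun f : e → Fin 2 => glue f kd)
    (Matrix.toEuclideanLin (sel fun f => glue f j) u) v
  rw [h3, (Submodule.mem_orthogonal _ _).1 hv _ h2, mul_zero]

end Local

/-- A part of a domain has a counterpart in every domain of the same type. -/
theorem SameType.exists_subset {Q : Finset QDomain} {N₁ N₂ : ℕ}
    {d d' d₁ : Finset QDomain}
    (h : SameType Q (N₁ + N₂) d d') (hd₁ : d₁ ⊆ d) :
    ∃ d₁' ⊆ d', SameType Q N₁ d₁ d₁' ∧ SameType Q N₂ (d \ d₁) (d' \ d₁') := by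
  have hcard : (d₁ \ Q).card + ((d \ d₁) \ Q).card = (d \ Q).card := by
    rw [← Finset.card_union_of_disjoint]
    · congr 1
      ext x
      simp only [Finset.mem_union, Finset.mem_sdiff]
      have := @hd₁ x
      tauto
    · rw [Finset.disjoint_left]
      intro x hx hx'
      simp only [Finset.mem_sdiff] at hx hx'
      tauto
  have hmin := h.2
  -- In a large domain, one part is beyond its bound; that part absorbs the difference in size.
  obtain ⟨m, hm, hm₁, hm₂⟩ : ∃ m ≤ (d' \ Q).card, min (d₁ \ Q).card N₁ = min m N₁ ∧
      min ((d \ d₁) \ Q).card N₂ = min ((d' \ Q).card - m) N₂ := by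
    by_cases hlt : (d \ Q).card < N₁ + N₂
    · exact ⟨(d₁ \ Q).card, by omega, by omega, by omega⟩
    · by_cases h2 : N₂ ≤ ((d \ d₁) \ Q).card
      · exact ⟨min (d₁ \ Q).card N₁, by omega, by omega, by omega⟩
      · exact ⟨(d' \ Q).card - ((d \ d₁) \ Q).card, by omega, by omega, by omega⟩
  obtain ⟨X, hX, hXm⟩ := Finset.exists_subset_card_eq hm
  have hXd : ∀ x ∈ X, x ∈ d' ∧ x ∉ Q := fun x hx => Finset.mem_sdiff.1 (hX hx)
  have e1 : ∀ x ∈ Q, (x ∈ d ↔ x ∈ d') := fun x hx => h.mem_iff hx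
  refine ⟨(d₁ ∩ Q) ∪ X, ?_, ⟨?_, ?_⟩, ⟨?_, ?_⟩⟩
  · intro x hx
    rcases Finset.mem_union.1 hx with hx | hx
    · obtain ⟨h1, h2⟩ := Finset.mem_inter.1 hx
      exact (e1 x h2).1 (hd₁ h1)
    · exact (hXd x hx).1
  · ext x
    simp only [Finset.mem_inter, Finset.mem_union]
    have := hXd x
    tauto
  · have : ((d₁ ∩ Q) ∪ X) \ Q = X := by
      ext x
      simp only [Finset.mem_sdiff, Finset.mem_inter, Finset.mem_union]
      have := hXd x
      tauto
    rw [this, hXm, hm₁]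
  · ext x
    simp only [Finset.mem_inter, Finset.mem_union, Finset.mem_sdiff]
    have := hXd x
    have := e1 x
    tauto
  · have : (d' \ ((d₁ ∩ Q) ∪ X)) \ Q = (d' \ Q) \ X := by
      ext x
      simp only [Finset.mem_sdiff, Finset.mem_inter, Finset.mem_union]
      tauto
    rw [this, Finset.card_sdiff_of_subset hX, hXm, hm₂]

theorem exists_fresh (c : Finset QDomain) (m : ℕ) : ∃ X : Finset QDomain,
    Disjoint X c ∧ X.card = m := by
  obtain ⟨Y, hY, hm⟩ := Infinite.exists_superset_card_eq c (c.card + m) (by omega)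
  refine ⟨Y \ c, Finset.sdiff_disjoint, ?_⟩
  rw [Finset.card_sdiff_of_subset hY]
  omega

namespace Local

variable {Q Q' : Finset QDomain} {N N' N₁ N₂ : ℕ} {F G : Fam}

/-- The bounds add up: the sizes `n₁ + n₂` of the two parts, cut off at `N₁` and `N₂`, are
determined up to choice by the size of the whole, cut off at `N₁ + N₂`. -/
theorem star (hF : Local Q N₁ F) (hG : Local Q N₂ G) : Local Q (N₁ + N₂) (star F G) := by
  constructor
  · refine star_le.2 fun d d' hd' u hu v hv => mul_mem_cyl ?_ ?_
    · exact cyl_mono hd' (hF.le_cyl _ hu)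
    · exact cyl_mono Finset.sdiff_subset (hG.le_cyl _ hv)
  · intro d d' hd a ha k t ht
    revert a
    change QwhileHP.star F G d ≤ (QwhileHP.star F G d').comap
      ((LinearMap.mulRight ℂ t).comp (freeze Q k).toLinearMap)
    refine iSup₂_le fun d₁ hd₁ => Submodule.mul_le.2 fun u hu v hv => ?_
    change freeze Q k (u * v) * t ∈ QwhileHP.star F G d'
    obtain ⟨d₁', hd₁', h1, h2⟩ := hd.exists_subset hd₁
    have hc : cyl (d' \ Q) ≤ cyl (d₁' \ Q) * cyl ((d' \ d₁') \ Q) := by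
      rw [cyl_mul_cyl]
      refine cyl_mono fun x => ?_
      simp only [Finset.mem_sdiff, Finset.mem_union]
      tauto
    have h3 : cyl (d₁' \ Q) * cyl ((d' \ d₁') \ Q) ≤ (QwhileHP.star F G d').comap
        (LinearMap.mulLeft ℂ (freeze Q k (u * v))) := by
      refine Submodule.mul_le.2 fun r hr s hs => ?_
      change freeze Q k (u * v) * (r * s) ∈ QwhileHP.star F G d'
      rw [map_mul, mul_mul_mul_comm]
      exact mul_mem_star hd₁' rfl (hF.transfer h1 hu k hr) (hG.transfer h2 hv k hs)
    exact h3 (hc ht)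

/-- The antecedent ranges over domains with any number of other names, so only the bound of the
consequent matters. -/
theorem wandF (hF : Local Q N₁ F) (hG : Local Q N₂ G) : Local Q N₂ (wandF F G) := by
  refine ⟨fun d => inf_le_left, fun {d d'} hd {v} hv k {t} ht => ?_⟩
  rw [mem_wandF] at hv ⊢
  refine ⟨freeze_mul_mem_cyl hd hv.1 k ht, fun e' he' u hu => ?_⟩
  have hcyl : u * (freeze Q k v * t) ∈ cyl (e' ∪ d') := mul_mem_cyl
    (cyl_mono Finset.subset_union_left (hF.le_cyl _ hu))
    (cyl_mono Finset.subset_union_right (freeze_mul_mem_cyl hd hv.1 k ht))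
  refine mem_of_freeze (Q := Q) hcyl fun j r hr => ?_
  -- A domain of the same type as `e'` that is disjoint from `d`.
  obtain ⟨X, hX, hXm⟩ := exists_fresh (d ∪ Q) (e' \ Q).card
  have hXd : ∀ x ∈ X, x ∉ d ∧ x ∉ Q := fun x hx => by
    have := Finset.disjoint_left.1 hX hx
    simpa using this
  have hXQ : ((e' ∩ Q) ∪ X) \ Q = X := by
    ext x
    simp only [Finset.mem_sdiff, Finset.mem_inter, Finset.mem_union]
    have := hXd x
    tauto
  have he : SameType Q N₁ e' ((e' ∩ Q) ∪ X) := by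
    refine ⟨?_, by rw [hXQ, hXm]⟩
    ext x
    simp only [Finset.mem_inter, Finset.mem_union]
    have := hXd x
    tauto
  have hdis : Disjoint ((e' ∩ Q) ∪ X) d := by
    rw [Finset.disjoint_left]
    intro x hx hxd
    rcases Finset.mem_union.1 hx with hx | hx
    · obtain ⟨h1, h2⟩ := Finset.mem_inter.1 hx
      exact Finset.disjoint_left.1 he' h1 ((hd.mem_iff h2).1 hxd)
    · exact (hXd x hx).1 hxd
  have hunion : SameType Q N₂ (((e' ∩ Q) ∪ X) ∪ d) (e' ∪ d') := by
    constructor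
    · ext x
      simp only [Finset.mem_inter, Finset.mem_union]
      have := hXd x
      have := @SameType.mem_iff _ _ _ _ hd x
      tauto
    · have h1 : ((((e' ∩ Q) ∪ X) ∪ d) \ Q).card = (e' \ Q).card + (d \ Q).card := by
        rw [Finset.union_sdiff_distrib, hXQ, Finset.card_union_of_disjoint, hXm]
        exact Finset.disjoint_left.2 fun x hx hx' => (hXd x hx).1 (Finset.mem_sdiff.1 hx').1
      have h2 : ((e' ∪ d') \ Q).card = (e' \ Q).card + (d' \ Q).card := by
        rw [Finset.union_sdiff_distrib, Finset.card_union_of_disjoint]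
        exact Finset.disjoint_of_subset_left Finset.sdiff_subset
          (Finset.disjoint_of_subset_right Finset.sdiff_subset he')
      have := hd.2
      omega
  have h1 : freeze Q j u * 1 ∈ F ((e' ∩ Q) ∪ X) := hF.transfer he hu j (one_mem_cyl _)
  rw [mul_one] at h1
  have h2 := hG.transfer hunion (hv.2 _ hdis _ h1) k hr
  have h3 : freeze Q k (freeze Q j u * v) = freeze Q j u * freeze Q k v := by
    rw [map_mul, freeze_eq_self k (freeze_mem_cyl j (hF.le_cyl _ hu)) Finset.inter_subset_right]
  rw [h3] at h2
  rw [map_mul, freeze_freeze_mul j k v ht Finset.sdiff_disjoint, mul_smul_comm, smul_mul_assoc]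
  exact Submodule.smul_mem _ _ h2

theorem pre {n : ℕ} {κ : Type} {q : Fin n ↪ QName} (L : κ → Op (Fin n)) {F : κ → Fam}
    (hq : qdom q ⊆ Q) (hF : ∀ i, Local Q N (F i)) : Local Q N (pre q L F) := by
  constructor
  · intro d
    by_cases h : qdom q ⊆ d
    · exact fun a ha => ((mem_pre h).1 ha).1
    · exact (pre_eq_bot h).le.trans bot_le
  · intro d d' hd a ha k t ht
    by_cases h : qdom q ⊆ d
    · rw [mem_pre h] at ha
      rw [mem_pre ((hd.subset_iff hq).1 h)]
      refine ⟨freeze_mul_mem_cyl hd ha.1 k ht, fun i => ?_⟩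
      rw [opA_mul_right _ _ ht (Finset.disjoint_of_subset_right hq Finset.sdiff_disjoint),
        ← freeze_opA _ hq]
      exact (hF i).transfer hd (ha.2 i) k ht
    · rw [pre_eq_bot h, Submodule.mem_bot] at ha
      rw [ha, map_zero, zero_mul]
      exact Submodule.zero_mem _

theorem freePre {q : QName} (hq : Sum.inl q ∈ Q) (hF : Local Q N F) :
    Local Q N (freePre q F) := by
  constructor
  · intro d
    by_cases h : Sum.inl q ∈ d
    · exact fun a ha => ((mem_freePre h).1 ha).1
    · exact (freePre_eq_bot h).le.trans bot_le
  · intro d d' hd a ha k t ht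
    by_cases h : Sum.inl q ∈ d
    · have hqQ : qdom (single q) ⊆ Q := by rwa [qdom_single, Finset.singleton_subset_iff]
      have he : ∀ c : Finset QDomain, c.erase (Sum.inl q) \ Q = c \ Q := by
        intro c
        ext x
        simp only [Finset.mem_sdiff, Finset.mem_erase]
        constructor
        · tauto
        · rintro ⟨h1, h2⟩
          exact ⟨⟨fun h3 => h2 (h3 ▸ hq), h1⟩, h2⟩
      have hd2 : SameType Q N (d.erase (Sum.inl q)) (d'.erase (Sum.inl q)) := by
        refine ⟨?_, ?_⟩
        · rw [Finset.erase_inter, Finset.erase_inter, hd.1]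
        · rw [he, he, hd.2]
      rw [mem_freePre h] at ha
      rw [mem_freePre ((hd.mem_iff hq).1 h)]
      refine ⟨freeze_mul_mem_cyl hd ha.1 k ht, fun g => ?_⟩
      rw [map_mul, ← freeze_assign hqQ, assign_eq_self g ht
        (Finset.disjoint_of_subset_right hqQ Finset.sdiff_disjoint)]
      exact hF.transfer hd2 (ha.2 g) k (by rwa [he])
    · rw [freePre_eq_bot h, Submodule.mem_bot] at ha
      rw [ha, map_zero, zero_mul]
      exact Submodule.zero_mem _

/-- The allocated name itself does not matter for the precondition of an allocation: it is the new
name of a new qubit, and the old qubit of that name becomes dangling. -/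
theorem allocPre {q : QName} (hq : Sum.inl q ∈ Q) (hQ : ∀ s : QDangle, Sum.inr s ∉ Q)
    (hF : Local Q N F) : Local (Q.erase (Sum.inl q)) N (allocPre q F) := by
  refine ⟨fun d => inf_le_left, fun {d d'} hd {a} ha k {t} ht => ?_⟩
  rw [mem_allocPre] at ha ⊢
  refine ⟨freeze_mul_mem_cyl hd ha.1 k ht, fun s' hs' g => ?_⟩
  obtain ⟨s, hs⟩ := exists_dangle_notMem d
  set Q' := Q.erase (Sum.inl q) with hQ'
  have hqQ' : Sum.inl q ∉ Q' := Finset.notMem_erase _ _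
  have hsQ' : ∀ s : QDangle, Sum.inr s ∉ Q' := fun s h => hQ s (Finset.mem_of_mem_erase h)
  have hswap : ∀ (s : QDangle) x, x ∈ Q' →
      Equiv.swap (Sum.inl q : QDomain) (Sum.inr s) x = x := fun s x hx =>
    swap_eq_self (fun h => hqQ' (h ▸ hx)) (fun h => hsQ' s (h ▸ hx))
  have hout : ∀ (s : QDangle) (c : Finset QDomain), Sum.inr s ∉ c →
      insert (Sum.inl q) (renameDom q s c) \ Q = renameDom q s (c \ Q') := by
    intro s c hsc
    ext x
    simp only [Finset.mem_sdiff, Finset.mem_insert, mem_renameDom]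
    by_cases h1 : x = Sum.inl q
    · subst h1
      simp [hq, hsc]
    · by_cases h2 : x = Sum.inr s
      · subst h2
        simp [hQ s, hqQ']
      · rw [swap_eq_self h1 h2]
        simp [hQ', h1]
  have hin : ∀ (s : QDangle) (c : Finset QDomain),
      insert (Sum.inl q) (renameDom q s c) ∩ Q = insert (Sum.inl q) (c ∩ Q') := by
    intro s c
    ext x
    simp only [Finset.mem_inter, Finset.mem_insert, mem_renameDom]
    by_cases h1 : x = Sum.inl q
    · simp [h1, hq]
    · by_cases h2 : x = Sum.inr s
      · subst h2
        simp [hQ s, hsQ' s]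
      · rw [swap_eq_self h1 h2]
        simp [hQ', h1]
  have hd2 : SameType Q N (insert (Sum.inl q) (renameDom q s d))
      (insert (Sum.inl q) (renameDom q s' d')) := by
    refine ⟨by rw [hin, hin, hd.1], ?_⟩
    rw [hout s d hs, hout s' d' hs', card_renameDom, card_renameDom, hd.2]
  have hqsub : qdom (single q) ⊆ Q := by rwa [qdom_single, Finset.singleton_subset_iff]
  have ht' : ren q s' t ∈ cyl (insert (Sum.inl q) (renameDom q s' d') \ Q) := by
    rw [hout s' d' hs']
    exact ren_mem_cyl ht
  have h1 : ren q s' (freeze Q' k a) = freeze Q' k a := by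
    refine ren_eq_self (freeze_mem_cyl k ha.1) ?_ ?_
    · exact fun h => hqQ' (Finset.mem_inter.1 h).2
    · exact fun h => hsQ' s' (Finset.mem_inter.1 h).2
  -- Slices of the renamed vector: the label of `q` is now that of `s`.
  have h2 : freeze Q (Function.update k (Sum.inr s) (k (Sum.inl q))) (ren q s a) =
      freeze Q' k a := by
    ext f
    rw [freeze_apply, ren_apply, freeze_apply]
    refine ha.1 _ _ fun x hx => ?_
    have hxs : x ≠ Sum.inr s := fun h => hs (h ▸ hx)
    by_cases h1 : x = Sum.inl q
    · subst h1
      rw [Equiv.swap_apply_left, Finset.piecewise_eq_of_notMem _ _ _ (hQ s),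
        Finset.piecewise_eq_of_notMem _ _ _ hqQ', Function.update_self]
    · rw [swap_eq_self h1 hxs]
      by_cases h3 : x ∈ Q
      · rw [Finset.piecewise_eq_of_mem _ _ _ h3,
          Finset.piecewise_eq_of_mem _ _ _ (Finset.mem_erase.2 ⟨h1, h3⟩)]
      · rw [Finset.piecewise_eq_of_notMem _ _ _ h3, Finset.piecewise_eq_of_notMem _ _ _
          (fun h => h3 (Finset.mem_of_mem_erase h)), Function.update_of_ne hxs]
  have h3 := hF.transfer hd2 (ha.2 s hs g) (Function.update k (Sum.inr s) (k (Sum.inl q))) ht'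
  rw [map_mul, h2, freeze_eq_self _ (ket_mem_cyl _ _) hqsub] at h3
  rw [map_mul, h1, ← mul_assoc]
  exact h3

/-- The greatest fixed point of a monotone map that preserves local families is local: the smallest
local family that contains it is a post-fixed point. -/
theorem sSup_postfixed {Θ : Fam → Fam} (hmono : Monotone Θ)
    (hΘ : ∀ X, Local Q N X → Local Q N (Θ X)) (hcyl : ∀ X, Θ X ≤ cyl) :
    Local Q N (sSup {X | X ≤ Θ X}) := by
  set Z := sSup {X | X ≤ Θ X}
  have hZ : Z ≤ Θ Z := sSup_le fun X hX => hX.trans (hmono (le_sSup hX))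
  set Y := sInf {Y | Local Q N Y ∧ Z ≤ Y}
  have hmem : ∀ d a, a ∈ Y d ↔ ∀ W, Local Q N W → Z ≤ W → a ∈ W d := by
    intro d a
    simp only [Y, sInf_apply, Submodule.mem_iInf, Subtype.forall, Set.mem_ofPred_eq, and_imp]
  have hY : Local Q N Y := by
    refine ⟨fun d => ?_, fun {d d'} hd {a} ha k {t} ht => ?_⟩
    · exact fun a ha => (hmem d a).1 ha cyl (local_cyl Q N) (hZ.trans (hcyl Z))
    · rw [hmem] at ha ⊢
      exact fun W hW hZW => hW.transfer hd (ha W hW hZW) k ht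
  have hZY : Z ≤ Y := le_sInf fun W hW => hW.2
  have hYΘ : Y ≤ Θ Y := sInf_le ⟨hΘ Y hY, hZ.trans (hmono hZY)⟩
  exact le_antisymm hZY (le_sSup hYΘ) ▸ hY

end Local

/-- The names that occur in a statement. -/
def stmtNames : Stmt → Finset QName
  | .skip => ∅
  | .qalloc q => {q}
  | .qfree q => {q}
  | .reset q => Finset.univ.map q
  | .unitary _ q => Finset.univ.map q
  | .seq S₁ S₂ => stmtNames S₁ ∪ stmtNames S₂
  | .ifMeas _ q S => Finset.univ.map q ∪ Finset.univ.biUnion fun m => stmtNames (S m)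
  | .whileMeas _ q S => Finset.univ.map q ∪ stmtNames S

/-- Qubit names as names. -/
def qset (A : Finset QName) : Finset QDomain := A.map Function.Embedding.inl

theorem inl_mem_qset {A : Finset QName} {q : QName} : Sum.inl q ∈ qset A ↔ q ∈ A := by
  simp [qset]

theorem inr_notMem_qset {A : Finset QName} (s : QDangle) : Sum.inr s ∉ qset A := by
  simp [qset]

theorem qdom_subset_qset {A : Finset QName} {n : ℕ} {q : Fin n ↪ QName} :
    qdom q ⊆ qset A ↔ Finset.univ.map q ⊆ A := by
  rw [qdom, ← Finset.map_map, qset, Finset.map_subset_map]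

theorem qset_mono {A B : Finset QName} (h : A ⊆ B) : qset A ⊆ qset B :=
  Finset.map_subset_map.2 h

/-- Weakest preconditions of local families are local. -/
theorem Local.wp {A : Finset QName} {N : ℕ} (S : Stmt) : stmtNames S ⊆ A →
    ∀ {F : Fam}, Local (qset A) N F → Local (qset A) N (wp S F) := by
  induction S with
  | skip => exact fun _ _ h => h
  | qalloc q =>
    intro hS F hF
    have hq := inl_mem_qset.2 (Finset.singleton_subset_iff.1 hS)
    exact (hF.allocPre hq inr_notMem_qset).mono_left (Finset.erase_subset _ _)
  | qfree q =>
    exact fun hS F hF => hF.freePre (inl_mem_qset.2 (Finset.singleton_subset_iff.1 hS))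
  | reset q => exact fun hS F hF => Local.pre _ (qdom_subset_qset.2 hS) fun _ => hF
  | unitary U q => exact fun hS F hF => Local.pre _ (qdom_subset_qset.2 hS) fun _ => hF
  | seq S₁ S₂ ih₁ ih₂ =>
    intro hS F hF
    rw [stmtNames, Finset.union_subset_iff] at hS
    exact ih₁ hS.1 (ih₂ hS.2 hF)
  | ifMeas M q S ih =>
    intro hS F hF
    rw [stmtNames, Finset.union_subset_iff, Finset.biUnion_subset] at hS
    exact Local.pre _ (qdom_subset_qset.2 hS.1) fun m => ih m (hS.2 m (Finset.mem_univ m)) hF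
  | whileMeas M q S ih =>
    intro hS F hF
    rw [stmtNames, Finset.union_subset_iff] at hS
    have hun : ∀ X, Local (qset A) N X → Local (qset A) N (unroll M q S F X) := by
      intro X hX
      refine Local.pre _ (qdom_subset_qset.2 hS.1) fun m => ?_
      split_ifs
      · exact hF
      · exact ih hS.2 hX
    refine Local.sSup_postfixed (unroll_mono M q S F) hun fun X d a ha => ?_
    by_cases h : qdom q ⊆ d
    · exact ((mem_pre h).1 ha).1
    · exact (pre_eq_bot h).le.trans bot_le ha

theorem qbit_finite (ψ : Assr) : (qbit ψ).Finite := by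
  induction ψ with
  | top | bot | emp => exact Set.finite_empty
  | pointsTo q P => exact Set.finite_range q
  | neg ψ ih => exact ih
  | and _ _ h₁ h₂ | or _ _ h₁ h₂ | hook _ _ h₁ h₂ | sep _ _ h₁ h₂ | wand _ _ h₁ h₂ =>
    exact h₁.union h₂

/-- The meaning of an assertion is a local family. -/
theorem exists_local_denA {A : Finset QName} (ψ : Assr) :
    qbit ψ ⊆ A → ∃ N, Local (qset A) N (denA ψ) := by
  induction ψ with
  | top =>
    intro _
    have : denA .top = cyl := funext denA_top
    exact ⟨0, this ▸ local_cyl _ _⟩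
  | bot =>
    intro _
    have : denA .bot = ⊥ := funext denA_bot
    exact ⟨0, this ▸ Local.bot _ _⟩
  | emp =>
    exact fun _ => ⟨1, Local.of_single (Finset.empty_subset _) (denA_le_cyl _ _)
      fun d hd => by rw [denA_emp, if_neg hd]⟩
  | pointsTo q P =>
    intro h
    refine ⟨1, Local.of_single (d₀ := qdom q) ?_ (denA_le_cyl _ _)
      fun d hd => denA_pointsTo_eq_bot hd⟩
    rw [qdom_subset_qset]
    intro x hx
    obtain ⟨i, -, rfl⟩ := Finset.mem_map.1 hx
    exact h ⟨i, rfl⟩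
  | neg ψ ih =>
    intro h
    obtain ⟨N, hN⟩ := ih h
    exact ⟨N, hN.neg⟩
  | and ψ φ h₁ h₂ =>
    intro h
    obtain ⟨N₁, hN₁⟩ := h₁ (Set.subset_union_left.trans h)
    obtain ⟨N₂, hN₂⟩ := h₂ (Set.subset_union_right.trans h)
    rw [denA_and]
    exact ⟨max N₁ N₂, (hN₁.mono_right (le_max_left _ _)).inf (hN₂.mono_right (le_max_right _ _))⟩
  | or ψ φ h₁ h₂ =>
    intro h
    obtain ⟨N₁, hN₁⟩ := h₁ (Set.subset_union_left.trans h)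
    obtain ⟨N₂, hN₂⟩ := h₂ (Set.subset_union_right.trans h)
    rw [denA_or]
    exact ⟨max N₁ N₂, (hN₁.mono_right (le_max_left _ _)).sup (hN₂.mono_right (le_max_right _ _))⟩
  | hook ψ φ h₁ h₂ =>
    intro h
    obtain ⟨N₁, hN₁⟩ := h₁ (Set.subset_union_left.trans h)
    obtain ⟨N₂, hN₂⟩ := h₂ (Set.subset_union_right.trans h)
    have h1 := hN₁.mono_right (le_max_left N₁ N₂)
    have h2 := hN₂.mono_right (le_max_right N₁ N₂)
    have : denA (.hook ψ φ) = denA (.or (.neg ψ) (.and ψ φ)) := rfl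
    rw [this, denA_or, denA_and]
    exact ⟨_, h1.neg.sup (h1.inf h2)⟩
  | sep ψ φ h₁ h₂ =>
    intro h
    obtain ⟨N₁, hN₁⟩ := h₁ (Set.subset_union_left.trans h)
    obtain ⟨N₂, hN₂⟩ := h₂ (Set.subset_union_right.trans h)
    rw [denA_sep]
    exact ⟨_, hN₁.star hN₂⟩
  | wand ψ φ h₁ h₂ =>
    intro h
    obtain ⟨N₁, hN₁⟩ := h₁ (Set.subset_union_left.trans h)
    obtain ⟨N₂, hN₂⟩ := h₂ (Set.subset_union_right.trans h)
    rw [denA_wand]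
    exact ⟨_, hN₁.wandF hN₂⟩

/-! ### Framing -/

/-- A family that is closed under renaming the qubit `q` to a fresh dangling name. -/
def Renamable (q : QName) (G : Fam) : Prop :=
  ∀ (s : QDangle) (d : Finset QDomain), Sum.inr s ∉ d → ∀ a ∈ G d,
    ren q s a ∈ G (renameDom q s d)

/-- Names outside `Q` can be renamed, as only their number matters. -/
theorem Local.renamable {Q : Finset QDomain} {N : ℕ} {G : Fam} (hG : Local Q N G) {q : QName}
    (hq : Sum.inl q ∉ Q) (hQ : ∀ s : QDangle, Sum.inr s ∉ Q) : Renamable q G := by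
  intro s d hs a ha
  have hswap : ∀ x ∈ Q, Equiv.swap (Sum.inl q : QDomain) (Sum.inr s) x = x := fun x hx =>
    swap_eq_self (fun h => hq (h ▸ hx)) (fun h => hQ s (h ▸ hx))
  have hmem : ∀ x, Equiv.swap (Sum.inl q : QDomain) (Sum.inr s) x ∈ Q ↔ x ∈ Q := by
    intro x
    constructor
    · intro h
      have := hswap _ h
      rw [Equiv.swap_apply_self] at this
      rwa [← this] at h
    · intro h
      rwa [hswap x h]
  have hd : SameType Q N d (renameDom q s d) := by
    have e1 : renameDom q s d \ Q = renameDom q s (d \ Q) := by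
      ext x
      simp only [Finset.mem_sdiff, mem_renameDom, hmem]
    refine ⟨?_, by rw [e1, card_renameDom]⟩
    ext x
    simp only [Finset.mem_inter, mem_renameDom]
    exact and_congr_left fun hx => by rw [hswap x hx]
  refine mem_of_freeze (Q := Q) (ren_mem_cyl (hG.le_cyl _ ha)) fun k t ht => ?_
  have h1 : freeze Q k (ren q s a) =
      freeze Q (fun x => k (Equiv.swap (Sum.inl q : QDomain) (Sum.inr s) x)) a := by
    ext f
    rw [freeze_apply, ren_apply, freeze_apply]
    congr 1
    ext1 x
    by_cases hx : x ∈ Q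
    · rw [hswap x hx, Finset.piecewise_eq_of_mem _ _ _ hx, Finset.piecewise_eq_of_mem _ _ _ hx]
    · rw [Finset.piecewise_eq_of_notMem _ _ _ hx,
        Finset.piecewise_eq_of_notMem _ _ _ (fun h => hx ((hmem x).1 h))]
  rw [h1]
  exact hG.transfer hd ha _ ht

theorem star_mono_left {F F' G : Fam} (h : F ≤ F') : star F G ≤ star F' G :=
  star_le.2 fun _ _ hd _ hu _ hv => mul_mem_star hd rfl (h _ hu) hv

/-- Operators on `q` commute with multiplication by vectors on other names. -/
theorem star_pre_le {n : ℕ} {κ : Type} {q : Fin n ↪ QName} {L : κ → Op (Fin n)} {F : κ → Fam}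
    {G : Fam} (hG : ∀ d, G d ≤ cyl d) :
    star (pre q L F) G ≤ pre q L fun i => star (F i) G := by
  refine star_le.2 fun d d' hd u hu v hv => ?_
  by_cases h : qdom q ⊆ d'
  · rw [mem_pre h] at hu
    rw [mem_pre (h.trans hd)]
    have hv' := hG _ hv
    refine ⟨mul_mem_cyl (cyl_mono hd hu.1) (cyl_mono Finset.sdiff_subset hv'), fun i => ?_⟩
    rw [opA_mul_right _ _ hv' (Finset.disjoint_of_subset_right h Finset.sdiff_disjoint)]
    exact mul_mem_star hd rfl (hu.2 i) hv
  · rw [pre_eq_bot h, Submodule.mem_bot] at hu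
    rw [hu, zero_mul]
    exact Submodule.zero_mem _

/-- A statement acts on its own part of a product of domains, up to renaming the names that it
allocates in the other part. -/
theorem star_wp_le {G : Fam} (hG : ∀ d, G d ≤ cyl d) (S : Stmt) :
    (∀ q ∈ alloc S, Renamable q G) → ∀ F, star (wp S F) G ≤ wp S (star F G) := by
  induction S with
  | skip => exact fun _ _ => le_rfl
  | qalloc q =>
    intro hren F
    refine star_le.2 fun d d' hd u hu v hv => ?_
    rw [wp, mem_allocPre] at hu ⊢
    refine ⟨mul_mem_cyl (cyl_mono hd hu.1) (cyl_mono Finset.sdiff_subset (hG _ hv)),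
      fun s hs g => ?_⟩
    have hs' : Sum.inr s ∉ d' := fun h => hs (hd h)
    have hs'' : Sum.inr s ∉ d \ d' := fun h => hs (Finset.sdiff_subset h)
    rw [map_mul, ← mul_assoc]
    refine mul_mem_star ?_ ?_ (hu.2 s hs' g) (hren q rfl s _ hs'' v hv)
    · exact Finset.insert_subset_insert _ (Finset.map_subset_map.2 hd)
    · ext x
      simp only [Finset.mem_sdiff, Finset.mem_insert, mem_renameDom]
      by_cases hx : x = Sum.inl q
      · subst hx
        simp [hs]
      · simp [hx]
  | qfree q =>
    intro _ F
    refine star_le.2 fun d d' hd u hu v hv => ?_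
    by_cases hq : Sum.inl q ∈ d'
    · rw [wp, mem_freePre hq] at hu
      rw [wp, mem_freePre (hd hq)]
      refine ⟨mul_mem_cyl (cyl_mono hd hu.1) (cyl_mono Finset.sdiff_subset (hG _ hv)),
        fun g => ?_⟩
      have hdis : Disjoint (d \ d') (qdom (single q)) := by
        rw [qdom_single, Finset.disjoint_singleton_right]
        exact fun h => (Finset.mem_sdiff.1 h).2 hq
      rw [map_mul, assign_eq_self g (hG _ hv) hdis]
      refine mul_mem_star (Finset.erase_subset_erase _ hd) ?_ (hu.2 g) hv
      ext x
      simp only [Finset.mem_sdiff, Finset.mem_erase]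
      by_cases hx : x = Sum.inl q
      · subst hx
        simp [hq]
      · simp [hx]
    · rw [wp, freePre_eq_bot hq, Submodule.mem_bot] at hu
      rw [hu, zero_mul]
      exact Submodule.zero_mem _
  | reset q => exact fun _ F => star_pre_le hG
  | unitary U q => exact fun _ F => star_pre_le hG
  | seq S₁ S₂ ih₁ ih₂ =>
    intro hren F
    exact (ih₁ (fun q hq => hren q (Or.inl hq)) _).trans
      (wp_mono S₁ (ih₂ (fun q hq => hren q (Or.inr hq)) F))
  | ifMeas M q S ih =>
    intro hren F
    exact (star_pre_le hG).trans (pre_mono fun m =>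
      ih m (fun q hq => hren q (Set.mem_iUnion_of_mem m hq)) F)
  | whileMeas M q S ih =>
    intro hren F
    refine le_wp_while ?_
    conv_lhs => rw [wp_while_eq]
    refine (star_pre_le hG).trans (pre_mono fun m => ?_)
    split_ifs
    · exact le_rfl
    · exact ih hren _

/-! ### Soundness -/

section Measurement

variable {n : ℕ} {q : Fin n ↪ QName} {d : Finset QDomain}

theorem mem_denA_contains {P : Proj n} (h : qdom q ⊆ d) {a : Amp} :
    a ∈ denA (.contains q P) d ↔ a ∈ cyl d ∧ opA q P.1 a = a := by
  constructor
  · intro ha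
    refine ⟨denA_le_cyl _ _ ha, ?_⟩
    rw [Assr.contains, denA_sep] at ha
    suffices hle : star (denA (.pointsTo q P)) (denA .top) d ≤
        LinearMap.eqLocus (opA q P.1) LinearMap.id from hle ha
    refine iSup₂_le fun d' hd' => Submodule.mul_le.2 fun u hu v hv => ?_
    change opA q P.1 (u * v) = u * v
    by_cases hd : d' = qdom q
    · subst hd
      rw [opA_mul_right _ _ (denA_le_cyl _ _ hv) Finset.sdiff_disjoint,
        (mem_denA_pointsTo.1 hu).2]
    · rw [denA_pointsTo_eq_bot hd, Submodule.mem_bot] at hu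
      rw [hu, zero_mul, map_zero]
  · rintro ⟨ha, hP⟩
    have h1 : a = ∑ g, opA q P.1 (ket q g) * assign q g a := by
      conv_lhs => rw [← hP, eq_sum_ket q a, map_sum]
      refine Finset.sum_congr rfl fun g _ => ?_
      exact opA_mul_right _ _ (assign_mem_cyl g ha) Finset.sdiff_disjoint
    rw [h1, Assr.contains, denA_sep]
    refine Submodule.sum_mem _ fun g _ => mul_mem_star h rfl (mem_denA_pointsTo.2 ⟨?_, ?_⟩) ?_
    · exact opA_mem_cyl _ subset_rfl (ket_mem_cyl q g)
    · rw [opA_opA, P.2.1.eq]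
    · rw [denA_top]
      exact assign_mem_cyl g ha

theorem denA_contains_eq_bot {P : Proj n} (h : ¬ qdom q ⊆ d) : denA (.contains q P) d = ⊥ := by
  rw [Assr.contains, denA_sep, eq_bot_iff]
  refine iSup₂_le fun d' hd' => ?_
  rw [denA_pointsTo_eq_bot fun h' => h (h' ▸ hd'), Submodule.bot_mul]

/-- The Sasaki hook from the range of a projection is the preimage under the projection. -/
theorem mem_denA_hook {P : Proj n} (h : qdom q ⊆ d) {φ : Assr} {a : Amp} :
    a ∈ denA (.hook (.contains q P) φ) d ↔ a ∈ cyl d ∧ opA q P.1 a ∈ denA φ d := by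
  have hE := isStarProjection_onQubits q h P
  set E := onQubits q h P.1 with hEdef
  have hEE : ∀ v, Matrix.toEuclideanLin E (Matrix.toEuclideanLin E v) =
      Matrix.toEuclideanLin E v := by
    intro v
    rw [← LinearMap.comp_apply, ← Matrix.toLpLin_mul 2 2 2, hE.1.eq]
  have hadj : ∀ u v, inner ℂ u (Matrix.toEuclideanLin E v) =
      inner ℂ (Matrix.toEuclideanLin E u) v := by
    intro u v
    rw [inner_toEuclideanLin, ← Matrix.star_eq_conjTranspose, hE.2]
  have hmem : ∀ v, v ∈ den (.contains q P) d ↔ Matrix.toEuclideanLin E v = v := by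
    intro v
    rw [← amp_mem_denA, mem_denA_contains h, ← amp_onQubits q h, (amp_injective d).eq_iff]
    exact and_iff_right (amp_mem_cyl v)
  have key : ∀ v, v ∈ den (.hook (.contains q P) φ) d ↔ Matrix.toEuclideanLin E v ∈ den φ d := by
    intro v
    rw [den]
    constructor
    · intro hv
      obtain ⟨x, hx, y, hy, rfl⟩ := Submodule.mem_sup.1 hv
      have h0 : Matrix.toEuclideanLin E x = 0 := by
        rw [← inner_self_eq_zero (𝕜 := ℂ), hadj, hEE]
        exact (Submodule.mem_orthogonal _ _).1 hx _ ((hmem _).2 (hEE x))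
      rw [map_add, h0, zero_add, (hmem y).1 hy.1]
      exact hy.2
    · intro hv
      rw [← sub_add_cancel v (Matrix.toEuclideanLin E v)]
      refine Submodule.add_mem_sup ((Submodule.mem_orthogonal _ _).2 fun u hu => ?_)
        ⟨(hmem _).2 (hEE v), hv⟩
      rw [inner_sub_right, hadj, (hmem u).1 hu, sub_self]
  constructor
  · rintro ⟨v, hv, rfl⟩
    refine ⟨amp_mem_cyl v, ?_⟩
    rw [← amp_onQubits q h]
    exact amp_mem_denA.2 ((key v).1 hv)
  · rintro ⟨ha, h'⟩
    obtain ⟨v, rfl⟩ := exists_amp_eq ha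
    rw [← amp_onQubits q h] at h'
    exact amp_mem_denA.2 ((key v).2 (amp_mem_denA.1 h'))

theorem mem_denA_bigAnd {k : ℕ} {ψ : Fin k → Assr} {a : Amp} :
    a ∈ denA (.bigAnd ψ) d ↔ a ∈ cyl d ∧ ∀ m, a ∈ denA (ψ m) d := by
  have key : ∀ l : List Assr, a ∈ denA (l.foldr .and .top) d ↔
      a ∈ cyl d ∧ ∀ φ ∈ l, a ∈ denA φ d := by
    intro l
    induction l with
    | nil => simp [denA_top]
    | cons φ l ih =>
      rw [List.foldr_cons, denA_and, Pi.inf_apply, Submodule.mem_inf, ih]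
      simp only [List.mem_cons, forall_eq_or_imp]
      tauto
  rw [Assr.bigAnd, key]
  simp [List.mem_ofFn]

theorem denA_ifPre {k : ℕ} (M : Measurement n k) (q : Fin n ↪ QName) (ψ : Fin k → Assr) :
    denA (.and (.contains q (Proj.one n)) (.bigAnd fun m => .hook (.contains q (M.1 m)) (ψ m))) =
      pre q (fun m => (M.1 m).1) fun m => denA (ψ m) := by
  ext d a
  rw [denA_and, Pi.inf_apply, Submodule.mem_inf, mem_denA_bigAnd]
  by_cases h : qdom q ⊆ d
  · rw [mem_pre h, mem_denA_contains h]
    simp only [mem_denA_hook h]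
    simp only [Proj.one, opA_one]
    exact ⟨fun h => ⟨h.1.1, fun m => (h.2.2 m).2⟩,
      fun h => ⟨⟨h.1, trivial⟩, h.1, fun m => ⟨h.1, h.2 m⟩⟩⟩
  · rw [pre_eq_bot h, denA_contains_eq_bot h, Submodule.mem_bot]
    constructor
    · exact fun h => h.1
    · rintro rfl
      exact ⟨rfl, Submodule.zero_mem _, fun m => Submodule.zero_mem _⟩

theorem denA_whilePre (M : Measurement n 2) (q : Fin n ↪ QName) (ψ φ : Assr) :
    denA (whilePre M q ψ φ) =
      pre q (fun m => (M.1 m).1) fun m => if m = 0 then denA ψ else denA φ := by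
  ext d a
  rw [whilePre, denA_and, denA_and, Pi.inf_apply, Submodule.mem_inf, Pi.inf_apply,
    Submodule.mem_inf]
  by_cases h : qdom q ⊆ d
  · rw [mem_pre h, mem_denA_contains h, mem_denA_hook h, mem_denA_hook h, Fin.forall_fin_two]
    simp only [Proj.one, opA_one, if_true, one_ne_zero, if_false]
    tauto
  · rw [pre_eq_bot h, denA_contains_eq_bot h, Submodule.mem_bot]
    constructor
    · exact fun h => h.1
    · rintro rfl
      exact ⟨rfl, Submodule.zero_mem _, Submodule.zero_mem _⟩

end Measurement

theorem renameDom_empty (q : QName) (s : QDangle) : renameDom q s ∅ = ∅ := rfl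

theorem denA_sep_le_wp {ψ φ χ : Assr} {S : Stmt} (h : denA ψ ≤ wp S (denA φ))
    (hχ : qbit χ ∩ alloc S = ∅) : denA (.sep ψ χ) ≤ wp S (denA (.sep φ χ)) := by
  obtain ⟨N, hN⟩ := exists_local_denA (A := (qbit_finite χ).toFinset) χ (by simp)
  rw [denA_sep, denA_sep]
  refine (star_mono_left h).trans (star_wp_le (denA_le_cyl χ) S (fun q hq => ?_) _)
  refine hN.renamable ?_ inr_notMem_qset
  rw [inl_mem_qset, Set.Finite.mem_toFinset]
  exact fun h' => Set.eq_empty_iff_forall_notMem.1 hχ q ⟨h', hq⟩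

/-- Each rule is an inclusion of a family in a weakest precondition. Disjunctions are preserved
because weakest preconditions are subspaces. -/
theorem Derivable.sound {Ent : Assr → Assr → Prop} (hEnt : ∀ ψ φ, Ent ψ φ → Entails ψ φ)
    {ψ φ : Assr} {S : Stmt} (h : Derivable Ent ψ S φ) : denA ψ ≤ wp S (denA φ) := by
  induction h with
  | skip ψ => exact le_rfl
  | qalloc q =>
    intro d
    rw [denA_emp]
    split_ifs with h
    · subst h
      intro a ha
      rw [wp, mem_allocPre]
      refine ⟨ha, fun s hs g => ?_⟩
      have e : insert (Sum.inl q) (renameDom q s ∅) = qdom (single q) := by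
        rw [qdom_single, renameDom_empty, insert_empty_eq]
      rw [e, denA_pointsTo_one]
      refine mul_mem_cyl (ket_mem_cyl _ g) (cyl_mono (Finset.empty_subset _) ?_)
      have := ren_mem_cyl (q := q) (s := s) ha
      rwa [renameDom_empty] at this
    · exact bot_le
  | qfree q =>
    intro d
    by_cases h : d = qdom (single q)
    · subst h
      intro a ha
      have hq : Sum.inl q ∈ qdom (single q) := nm_mem_qdom (single q) 0
      rw [wp, mem_freePre hq]
      refine ⟨denA_le_cyl _ _ ha, fun g => ?_⟩
      have e : (qdom (single q)).erase (Sum.inl q) = ∅ := by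
        rw [qdom_single, Finset.erase_singleton]
      rw [e, denA_emp, if_pos rfl]
      have := assign_mem_cyl (q := single q) g (denA_le_cyl _ _ ha)
      rwa [Finset.sdiff_self] at this
    · rw [denA_pointsTo_eq_bot h]
      exact bot_le
  | reset q =>
    intro d
    by_cases h : d = qdom q
    · subst h
      intro a ha
      rw [wp, mem_pre subset_rfl]
      have hc := denA_le_cyl _ _ ha
      refine ⟨hc, fun g => mem_denA_pointsTo.2 ⟨opA_mem_cyl _ subset_rfl hc, ?_⟩⟩
      rw [opA_opA, Proj.zeroKet, Matrix.single_mul_single_same, mul_one]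
    · rw [denA_pointsTo_eq_bot h]
      exact bot_le
  | @unitary n n' U q q' e he P P' hP' =>
    intro d
    by_cases h : d = qdom q'
    · subst h
      intro a ha
      obtain ⟨hc, hPa⟩ := mem_denA_pointsTo.1 ha
      have hsub : qdom q ⊆ qdom q' := by
        intro x hx
        obtain ⟨i, rfl⟩ := (mem_qdom_iff q x).1 hx
        exact (mem_qdom_iff q' _).2 ⟨e i, congrArg Sum.inl (he i)⟩
      rw [wp, mem_pre hsub]
      refine ⟨hc, fun _ => mem_denA_pointsTo.2 ⟨opA_mem_cyl _ hsub hc, ?_⟩⟩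
      -- On the qubits `q'`, the operator `U` acts as an isometry.
      have hUU : (U.1)ᴴ * U.1 = 1 := Matrix.mem_unitaryGroup_iff'.1 U.2
      rw [hP', ← lift_conjTranspose, ← opA_opA, ← opA_opA, opA_lift he, opA_lift he,
        opA_opA q _ U.1, hUU, opA_one, hPa]
    · rw [denA_pointsTo_eq_bot h]
      exact bot_le
  | seq _ _ ih₁ ih₂ => exact ih₁.trans (wp_mono _ ih₂)
  | consequence h₁ _ h₂ ih =>
    exact (entails_iff.1 (hEnt _ _ h₁)).trans
      (ih.trans (wp_mono _ (entails_iff.1 (hEnt _ _ h₂))))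
  | ifMeas M q S ψ φ _ ih =>
    rw [denA_ifPre]
    exact pre_mono ih
  | whileMeas M q S ψ φ _ ih =>
    refine le_wp_while ?_
    conv_lhs => rw [denA_whilePre]
    refine pre_mono fun m => ?_
    split_ifs
    · exact le_rfl
    · exact ih
  | conjunction _ _ ih₁ ih₂ =>
    rw [← valid_iff] at ih₁ ih₂ ⊢
    intro ρ hρ
    have h₁ := ih₁ ρ (hρ.trans inf_le_left)
    have h₂ := ih₂ ρ (hρ.trans inf_le_right)
    exact ⟨h₁.1, fun ρ' hρ' => le_inf (h₁.2 ρ' hρ') (h₂.2 ρ' hρ')⟩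
  | disjunction _ _ ih₁ ih₂ =>
    rw [denA_or, denA_or]
    exact sup_le (ih₁.trans (wp_mono _ le_sup_left)) (ih₂.trans (wp_mono _ le_sup_right))
  | frame _ hχ ih => exact denA_sep_le_wp ih hχ

/-! ### Expressing local families by assertions -/

/-- The meaning of `ψ` is all of `H d` at the domains with `p d`, and `0` at the others. -/
def DomainPred (ψ : Assr) (p : Finset QDomain → Prop) : Prop :=
  ∀ d, (p d → den ψ d = ⊤) ∧ (¬ p d → den ψ d = ⊥)

namespace DomainPred

variable {ψ φ : Assr} {p r : Finset QDomain → Prop}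

theorem congr (h : DomainPred ψ p) (hpr : ∀ d, p d ↔ r d) : DomainPred ψ r :=
  fun d => by rw [← hpr]; exact h d

theorem denA_of_pos (h : DomainPred ψ p) {d : Finset QDomain} (hd : p d) : denA ψ d = cyl d := by
  rw [denA, (h d).1 hd, Submodule.map_top, range_amp]

theorem denA_of_neg (h : DomainPred ψ p) {d : Finset QDomain} (hd : ¬ p d) : denA ψ d = ⊥ := by
  rw [denA, (h d).2 hd, Submodule.map_bot]

theorem of_denA (h₁ : ∀ d, p d → cyl d ≤ denA ψ d) (h₂ : ∀ d, ¬ p d → denA ψ d ≤ ⊥) :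
    DomainPred ψ p := by
  intro d
  constructor
  · intro hd
    rw [eq_top_iff]
    exact fun v _ => amp_mem_denA.1 (h₁ d hd (amp_mem_cyl v))
  · intro hd
    rw [eq_bot_iff]
    intro v hv
    exact amp_injective d (((Submodule.mem_bot ℂ).1 (h₂ d hd (amp_mem_denA.2 hv))).trans
      (map_zero _).symm)

theorem top : DomainPred .top fun _ => True :=
  fun _ => ⟨fun _ => rfl, fun h => absurd trivial h⟩

theorem emp : DomainPred .emp fun d => d = ∅ :=
  fun _ => ⟨fun h => if_pos h, fun h => if_neg h⟩

theorem neg (h : DomainPred ψ p) : DomainPred (.neg ψ) fun d => ¬ p d := by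
  intro d
  constructor
  · intro hd
    rw [den, (h d).2 hd, Submodule.bot_orthogonal_eq_top]
  · intro hd
    rw [den, (h d).1 (not_not.1 hd), Submodule.top_orthogonal_eq_bot]

theorem and (h : DomainPred ψ p) (h' : DomainPred φ r) :
    DomainPred (.and ψ φ) fun d => p d ∧ r d := by
  intro d
  constructor
  · intro hd
    rw [den, (h d).1 hd.1, (h' d).1 hd.2, top_inf_eq]
  · intro hd
    rw [den]
    by_cases hp : p d
    · rw [(h' d).2 fun hr => hd ⟨hp, hr⟩, inf_bot_eq]
    · rw [(h d).2 hp, bot_inf_eq]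

theorem sep (h : DomainPred ψ p) (h' : DomainPred φ r) :
    DomainPred (.sep ψ φ) fun d => ∃ d' ⊆ d, p d' ∧ r (d \ d') := by
  apply of_denA
  · rintro d ⟨d', hd', hp, hr⟩
    have h1 : denA ψ d' * denA φ (d \ d') = cyl d := by
      rw [h.denA_of_pos hp, h'.denA_of_pos hr, cyl_mul_cyl, Finset.union_sdiff_of_subset hd']
    rw [← h1, denA_sep, Submodule.mul_le]
    exact fun u hu v hv => mul_mem_star hd' rfl hu hv
  · intro d hd
    rw [denA_sep]
    refine iSup₂_le fun d' hd' => ?_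
    by_cases hp : p d'
    · rw [h'.denA_of_neg fun hr => hd ⟨d', hd', hp, hr⟩, Submodule.mul_bot]
    · rw [h.denA_of_neg hp, Submodule.bot_mul]

theorem contains (q : QName) :
    DomainPred (.contains (single q) (Proj.one 1)) fun d => Sum.inl q ∈ d := by
  have hq : ∀ d : Finset QDomain, qdom (single q) ⊆ d ↔ Sum.inl q ∈ d := fun d => by
    rw [qdom_single, Finset.singleton_subset_iff]
  apply of_denA
  · intro d hd a ha
    exact (mem_denA_contains ((hq d).2 hd)).2 ⟨ha, opA_one _ a⟩
  · intro d hd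
    rw [denA_contains_eq_bot fun h => hd ((hq d).1 h)]

end DomainPred

/-- The domain has at least `n` elements. -/
def atLeast : ℕ → Assr
  | 0 => .top
  | n + 1 => .sep (.neg .emp) (atLeast n)

/-- The domain contains none of the qubit names in a list. -/
def avoid : List QName → Assr
  | [] => .top
  | q :: l => .and (.neg (.contains (single q) (Proj.one 1))) (avoid l)

/-- The domain avoids `A`, and has `n` elements if `n < N` and at least `N` if `n = N`. -/
def others (A : Finset QName) (N n : ℕ) : Assr :=
  .and (avoid A.toList) (.and (atLeast n) (if n < N then .neg (atLeast (n + 1)) else .top))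

theorem domainPred_atLeast (n : ℕ) : DomainPred (atLeast n) fun d => n ≤ d.card := by
  induction n with
  | zero => exact DomainPred.top.congr fun d => by simp
  | succ n ih =>
    refine (DomainPred.emp.neg.sep ih).congr fun d => ?_
    constructor
    · rintro ⟨d', hd', hne, h⟩
      rw [Finset.card_sdiff_of_subset hd'] at h
      have := Finset.card_pos.2 (Finset.nonempty_iff_ne_empty.2 hne)
      have := Finset.card_le_card hd'
      omega
    · intro h
      obtain ⟨x, hx⟩ := Finset.card_pos.1 (show 0 < d.card by omega)
      refine ⟨{x}, Finset.singleton_subset_iff.2 hx, Finset.singleton_ne_empty x, ?_⟩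
      rw [Finset.card_sdiff_of_subset (Finset.singleton_subset_iff.2 hx), Finset.card_singleton]
      omega

theorem domainPred_avoid (l : List QName) :
    DomainPred (avoid l) fun d => ∀ q ∈ l, Sum.inl q ∉ d := by
  induction l with
  | nil => exact DomainPred.top.congr fun d => by simp
  | cons q l ih => exact ((DomainPred.contains q).neg.and ih).congr fun d => by simp

theorem domainPred_others (A : Finset QName) {N n : ℕ} (hn : n ≤ N) :
    DomainPred (others A N n) fun d => Disjoint d (qset A) ∧ min d.card N = n := by
  have h1 : DomainPred (if n < N then .neg (atLeast (n + 1)) else .top)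
      fun d => n < N → ¬ n + 1 ≤ d.card := by
    split_ifs with h
    · exact (domainPred_atLeast (n + 1)).neg.congr fun d => by simp [h]
    · exact DomainPred.top.congr fun d => by simp [h]
  refine ((domainPred_avoid A.toList).and ((domainPred_atLeast n).and h1)).congr fun d => ?_
  refine and_congr ?_ (by omega)
  rw [Finset.disjoint_right]
  constructor
  · intro h x hx
    obtain ⟨q, hq, rfl⟩ := Finset.mem_map.1 hx
    exact h q (Finset.mem_toList.2 hq)
  · exact fun h q hq => h (inl_mem_qset.2 (Finset.mem_toList.1 hq))

theorem qbit_atLeast (n : ℕ) : qbit (atLeast n) = ∅ := by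
  induction n with
  | zero => rfl
  | succ n ih => simp [atLeast, qbit, ih]

theorem qbit_avoid_subset (l : List QName) : qbit (avoid l) ⊆ {q | q ∈ l} := by
  induction l with
  | nil => exact Set.empty_subset _
  | cons q l ih =>
    refine Set.union_subset ?_ (ih.trans fun x hx => List.mem_cons_of_mem _ hx)
    refine Set.union_subset ?_ (Set.empty_subset _)
    rintro x ⟨_, rfl⟩
    exact List.mem_cons_self

theorem qbit_others_subset (A : Finset QName) (N n : ℕ) : qbit (others A N n) ⊆ A := by
  refine Set.union_subset ((qbit_avoid_subset _).trans fun x hx => Finset.mem_toList.1 hx) ?_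
  refine Set.union_subset (by rw [qbit_atLeast]; exact Set.empty_subset _) ?_
  split_ifs
  · rw [qbit, qbit_atLeast]
    exact Set.empty_subset _
  · exact Set.empty_subset _

/-- Every subspace is the range of a projection. -/
theorem exists_denA_pointsTo_eq {n : ℕ} (q : Fin n ↪ QName) {V : Submodule ℂ Amp}
    (hV : V ≤ cyl (qdom q)) : ∃ P : Proj n, denA (.pointsTo q P) (qdom q) = V := by
  let j : EuclideanSpace ℂ (Fin n → Fin 2) →ₗ[ℂ] Amp :=
    { toFun := fun b f => b fun i => f (nm q i)
      map_add' := fun _ _ => rfl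
      map_smul' := fun _ _ => rfl }
  have hext : ∀ (g : Fin n → Fin 2) (f : Label),
      (fun i => Function.extend (nm q) g f (nm q i)) = g := fun g f =>
    funext fun i => (nm_injective q).extend_apply g f i
  have hj : Function.Injective j := by
    intro b c h
    ext g
    have := congrFun h (Function.extend (nm q) g 0)
    change b.ofLp (fun i => Function.extend (nm q) g 0 (nm q i)) =
      c.ofLp (fun i => Function.extend (nm q) g 0 (nm q i)) at this
    rwa [hext] at this
  have hsurj : ∀ a ∈ cyl (qdom q), ∃ b, j b = a := by
    intro a ha
    refine ⟨WithLp.toLp 2 fun g => a (Function.extend (nm q) g 0), ?_⟩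
    ext f
    refine ha _ _ fun x hx => ?_
    obtain ⟨i, rfl⟩ := (mem_qdom_iff q x).1 hx
    rw [(nm_injective q).extend_apply]
  let W := V.comap j
  let P : Op (Fin n) :=
    (Matrix.toEuclideanCLM (n := Fin n → Fin 2) (𝕜 := ℂ)).symm W.starProjection
  have hP : IsStarProjection P := by
    have hW := isStarProjection_starProjection (U := W)
    let e := (Matrix.toEuclideanCLM (n := Fin n → Fin 2) (𝕜 := ℂ)).symm
    exact ⟨(map_mul e _ _).symm.trans (congrArg e hW.1),
      (map_star e _).symm.trans (congrArg e hW.2)⟩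
  have hPW : ∀ b, Matrix.toEuclideanLin P b = W.starProjection b := by
    intro b
    have h1 : Matrix.toEuclideanCLM (n := Fin n → Fin 2) (𝕜 := ℂ) P = W.starProjection :=
      StarAlgEquiv.apply_symm_apply _ _
    rw [← h1]
    rfl
  have hop : ∀ b, opA q P (j b) = j (Matrix.toEuclideanLin P b) := by
    intro b
    ext f
    change ∑ g, P _ g * b (fun i => Function.extend (nm q) g f (nm q i)) = _
    simp only [hext]
    rfl
  refine ⟨⟨P, hP⟩, ?_⟩
  ext a
  rw [mem_denA_pointsTo]
  constructor
  · rintro ⟨ha, h⟩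
    obtain ⟨b, rfl⟩ := hsurj a ha
    rw [hop, hj.eq_iff, hPW, Submodule.starProjection_eq_self_iff] at h
    exact h
  · intro ha
    refine ⟨hV ha, ?_⟩
    obtain ⟨b, rfl⟩ := hsurj a (hV ha)
    rw [hop, hPW, Submodule.starProjection_eq_self_iff.2 ha]

/-- Finite disjunctions. -/
def orList (l : List Assr) : Assr := l.foldr .or .bot

theorem denA_orList_le {l : List Assr} {F : Fam} (h : ∀ ψ ∈ l, denA ψ ≤ F) :
    denA (orList l) ≤ F := by
  induction l with
  | nil =>
    intro d
    rw [orList, List.foldr_nil, denA_bot]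
    exact bot_le
  | cons ψ l ih =>
    rw [orList, List.foldr_cons, denA_or]
    exact sup_le (h ψ List.mem_cons_self) (ih fun φ hφ => h φ (List.mem_cons_of_mem _ hφ))

theorem denA_le_denA_orList {l : List Assr} {ψ : Assr} (h : ψ ∈ l) :
    denA ψ ≤ denA (orList l) := by
  induction l with
  | nil => simp at h
  | cons φ l ih =>
    rw [orList, List.foldr_cons, denA_or]
    rcases List.mem_cons.1 h with rfl | h
    · exact le_sup_left
    · exact (ih h).trans le_sup_right

theorem qbit_orList_subset {l : List Assr} {X : Set QName} (h : ∀ ψ ∈ l, qbit ψ ⊆ X) :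
    qbit (orList l) ⊆ X := by
  induction l with
  | nil => exact Set.empty_subset _
  | cons ψ l ih =>
    exact Set.union_subset (h ψ List.mem_cons_self)
      (ih fun φ hφ => h φ (List.mem_cons_of_mem _ hφ))

/-- A list of the elements of a finite set of qubit names. -/
def enum (B : Finset QName) : Fin B.card ↪ QName := (B.orderEmbOfFin rfl).toEmbedding

theorem range_enum (B : Finset QName) : Set.range (enum B) = B := B.range_orderEmbOfFin rfl

theorem qdom_enum (B : Finset QName) : qdom (enum B) = qset B := by
  ext x
  rw [mem_qdom_iff, qset, Finset.mem_map]
  constructor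
  · rintro ⟨i, rfl⟩
    exact ⟨enum B i, by
      rw [← Finset.mem_coe, ← range_enum]
      exact ⟨i, rfl⟩, rfl⟩
  · rintro ⟨b, hb, rfl⟩
    rw [← Finset.mem_coe, ← range_enum] at hb
    obtain ⟨i, rfl⟩ := hb
    exact ⟨i, rfl⟩

/-- The vectors on `e` whose products with all vectors of the other names lie in the family, at
every domain that consists of `e` and `n` (or, for `n = N`, at least `N`) names outside `Q`. -/
def residue (Q : Finset QDomain) (N : ℕ) (F : Fam) (e : Finset QDomain) (n : ℕ) :
    Submodule ℂ Amp :=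
  cyl e ⊓ ⨅ (d : Finset QDomain) (_ : d ∩ Q = e ∧ min (d \ Q).card N = n)
    (t : Amp) (_ : t ∈ cyl (d \ Q)), (F d).comap (LinearMap.mulRight ℂ t)

theorem mem_residue {Q : Finset QDomain} {N : ℕ} {F : Fam} {e : Finset QDomain} {n : ℕ}
    {a : Amp} : a ∈ residue Q N F e n ↔ a ∈ cyl e ∧ ∀ d, d ∩ Q = e →
      min (d \ Q).card N = n → ∀ t ∈ cyl (d \ Q), a * t ∈ F d := by
  simp [residue, Submodule.mem_iInf]

/-- A local family is the meaning of a finite disjunction, with one disjunct for each type of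
domains: a subspace for the named qubits, times all vectors of the others. -/
theorem Local.exists_normal_form {A : Finset QName} {N : ℕ} {F : Fam}
    (h : Local (qset A) N F) : ∃ l : List Assr, denA (orList l) = F ∧
      ∀ ψ ∈ l, qbit ψ ⊆ A ∧ ∃ (n : ℕ) (q : Fin n ↪ QName) (P : Proj n) (χ : Assr),
        ψ = .sep (.pointsTo q P) χ ∧ ∀ d, d ∩ qset A ≠ qdom q → denA ψ d = ⊥ := by
  have hP : ∀ (B : Finset QName) (n : ℕ), ∃ P : Proj B.card,
      denA (.pointsTo (enum B) P) (qset B) = residue (qset A) N F (qset B) n := by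
    intro B n
    have := exists_denA_pointsTo_eq (enum B) (V := residue (qset A) N F (qset B) n) (by
      rw [qdom_enum]
      exact inf_le_left)
    rwa [qdom_enum] at this
  choose P hP using hP
  let T : Finset QName × ℕ → Assr := fun x =>
    .sep (.pointsTo (enum x.1) (P x.1 x.2)) (others A N x.2)
  have hdom : ∀ B ⊆ A, ∀ n ≤ N, ∀ d d', d' ⊆ d → ∀ u ∈ denA (.pointsTo (enum B) (P B n)) d',
      ∀ v ∈ denA (others A N n) (d \ d'), u * v ≠ 0 → d' = qset B ∧ d ∩ qset A = qset B ∧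
        d \ d' = d \ qset A ∧ min (d \ qset A).card N = n := by
    intro B hB n hn d d' hd' u hu v hv h0
    have h1 : d' = qset B := by
      by_contra hne
      rw [denA_pointsTo_eq_bot (by rwa [qdom_enum]), Submodule.mem_bot] at hu
      exact h0 (by rw [hu, zero_mul])
    have h2 : Disjoint (d \ d') (qset A) ∧ min (d \ d').card N = n := by
      by_contra hne
      rw [(domainPred_others A hn).denA_of_neg hne, Submodule.mem_bot] at hv
      exact h0 (by rw [hv, mul_zero])
    have hBA := qset_mono hB
    have h3 : ∀ x ∈ d, x ∉ d' → x ∉ qset A := fun x hx hx' =>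
      Finset.disjoint_left.1 h2.1 (Finset.mem_sdiff.2 ⟨hx, hx'⟩)
    have h4 : d \ d' = d \ qset A := by
      ext x
      simp only [Finset.mem_sdiff]
      refine and_congr_right fun hx => ⟨h3 x hx, fun h5 h6 => h5 (hBA (h1 ▸ h6))⟩
    refine ⟨h1, ?_, h4, h4 ▸ h2.2⟩
    rw [← h1]
    ext x
    rw [Finset.mem_inter]
    refine ⟨fun hx => by_contra fun h5 => h3 x hx.1 h5 hx.2, fun hx => ⟨hd' hx, hBA (h1 ▸ hx)⟩⟩
  refine ⟨(A.powerset ×ˢ Finset.range (N + 1)).toList.map T, ?_, ?_⟩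
  · apply le_antisymm
    · refine denA_orList_le fun ψ hψ => ?_
      obtain ⟨⟨B, n⟩, hx, rfl⟩ := List.mem_map.1 hψ
      rw [Finset.mem_toList, Finset.mem_product, Finset.mem_powerset, Finset.mem_range] at hx
      simp only [T]
      rw [denA_sep, star_le]
      intro d d' hd' u hu v hv
      by_cases h0 : u * v = 0
      · rw [h0]
        exact Submodule.zero_mem _
      obtain ⟨rfl, h2, h3, h4⟩ := hdom B hx.1 n (Nat.lt_succ_iff.1 hx.2) d d' hd' u hu v hv h0
      rw [hP] at hu
      have hv' := denA_le_cyl _ _ hv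
      rw [h3] at hv'
      exact (mem_residue.1 hu).2 d h2 h4 v hv'
    · intro d a ha
      obtain ⟨t, ht, hsum⟩ := eq_sum_freeze (qset A) (h.le_cyl _ ha)
      let B := A.filter fun q => Sum.inl q ∈ d
      have hB : d ∩ qset A = qset B := by
        ext x
        cases x with
        | inl q => simp [inl_mem_qset, B, and_comm]
        | inr s => simp [inr_notMem_qset]
      let n := min (d \ qset A).card N
      have hn : n ≤ N := min_le_right _ _
      have hmem : T (B, n) ∈ (A.powerset ×ˢ Finset.range (N + 1)).toList.map T := by
        refine List.mem_map_of_mem ?_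
        rw [Finset.mem_toList, Finset.mem_product, Finset.mem_powerset, Finset.mem_range]
        exact ⟨Finset.filter_subset _ _, Nat.lt_succ_iff.2 hn⟩
      refine denA_le_denA_orList hmem d ?_
      simp only [T]
      rw [denA_sep, hsum]
      have hsd : d \ qset B = d \ qset A := by rw [← hB, Finset.sdiff_inter_self_left]
      refine Submodule.sum_mem _ fun j _ => mul_mem_star (d' := qset B) (e := d \ qset A) ?_
        hsd.symm ?_ ?_
      · rw [← hB]
        exact Finset.inter_subset_left
      · rw [hP, mem_residue]
        refine ⟨hB ▸ freeze_mem_cyl _ (h.le_cyl _ ha), fun d' hd' hn' t' ht' => ?_⟩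
        exact h.transfer ⟨hB.trans hd'.symm, hn'.symm⟩ ha _ ht'
      · rw [(domainPred_others A hn).denA_of_pos ⟨Finset.sdiff_disjoint, rfl⟩]
        exact ht j
  · intro ψ hψ
    obtain ⟨⟨B, n⟩, hx, rfl⟩ := List.mem_map.1 hψ
    rw [Finset.mem_toList, Finset.mem_product, Finset.mem_powerset, Finset.mem_range] at hx
    refine ⟨Set.union_subset ?_ (qbit_others_subset A N n), _, enum B, P B n, others A N n, rfl,
      fun d hd => ?_⟩
    · rw [qbit, range_enum]
      exact Finset.coe_subset.2 hx.1
    · simp only [T]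
      rw [denA_sep, eq_bot_iff]
      refine iSup₂_le fun d' hd' => Submodule.mul_le.2 fun u hu v hv => ?_
      by_contra h0
      rw [Submodule.mem_bot] at h0
      rw [qdom_enum] at hd
      exact hd (hdom B hx.1 n (Nat.lt_succ_iff.1 hx.2) d d' hd' u hu v hv h0).2.1

/-- Weakest preconditions of assertions are expressed by assertions. -/
theorem exists_denA_eq_wp (S : Stmt) (φ : Assr) : ∃ χ, denA χ = wp S (denA φ) := by
  obtain ⟨N, hN⟩ := exists_local_denA (A := (qbit_finite φ).toFinset ∪ stmtNames S) φ (by simp)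
  obtain ⟨l, hl, -⟩ := (hN.wp S Finset.subset_union_right).exists_normal_form
  exact ⟨_, hl⟩

/-! ### Completeness -/

section Completeness

variable {Ent : Assr → Assr → Prop}

theorem Derivable.of_le (hEnt : ∀ ψ φ, Entails ψ φ → Ent ψ φ) {ψ ψ' φ φ' : Assr} {S : Stmt}
    (h : Derivable Ent ψ' S φ') (hψ : denA ψ ≤ denA ψ') (hφ : denA φ' ≤ denA φ) :
    Derivable Ent ψ S φ :=
  .consequence (hEnt _ _ (entails_iff.2 hψ)) h (hEnt _ _ (entails_iff.2 hφ))

theorem Derivable.orList (hEnt : ∀ ψ φ, Entails ψ φ → Ent ψ φ) {l : List Assr} {φ : Assr}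
    {S : Stmt} (hbot : Derivable Ent .bot S φ) (h : ∀ ψ ∈ l, Derivable Ent ψ S φ) :
    Derivable Ent (orList l) S φ := by
  induction l with
  | nil => exact hbot
  | cons ψ l ih =>
    refine (Derivable.disjunction (h ψ List.mem_cons_self)
      (ih fun χ hχ => h χ (List.mem_cons_of_mem _ hχ))).of_le hEnt le_rfl ?_
    rw [denA_or, sup_idem]

theorem one_mul_mem_star_emp {F : Fam} {d : Finset QDomain} {a : Amp} (ha : a ∈ F d) :
    a ∈ star (denA .emp) F d := by
  rw [← one_mul a]
  refine mul_mem_star (Finset.empty_subset d) Finset.sdiff_empty.symm ?_ ha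
  rw [denA_emp, if_pos rfl]
  exact one_mem_cyl _

theorem star_emp_le (F : Fam) : star (denA .emp) F ≤ F := by
  refine star_le.2 fun d d' hd' u hu v hv => ?_
  rw [denA_emp] at hu
  split_ifs at hu with h
  · subst h
    have h1 : u = u 0 • (1 : Amp) := by
      ext f
      simpa using hu f 0 (by simp)
    rw [h1, smul_mul_assoc, one_mul]
    rw [Finset.sdiff_empty] at hv
    exact Submodule.smul_mem _ _ hv
  · rw [(Submodule.mem_bot ℂ).1 hu, zero_mul]
    exact Submodule.zero_mem _

/-- The products with the basis vectors of `q` determine a product with the whole space of `q`. -/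
theorem mul_mem_of_ket {n : ℕ} {q : Fin n ↪ QName} {V : Submodule ℂ Amp} {v : Amp}
    (h : ∀ g, ket q g * v ∈ V) {u : Amp} (hu : u ∈ cyl (qdom q)) : u * v ∈ V := by
  rw [eq_sum_ket q u, Finset.sum_mul]
  refine Submodule.sum_mem _ fun g _ => ?_
  have h1 := assign_mem_cyl (q := q) g hu
  rw [Finset.sdiff_self] at h1
  have h2 : assign q g u = assign q g u 0 • (1 : Amp) := by
    ext f
    simpa using h1 f 0 (by simp)
  rw [h2, mul_smul_comm, mul_one, smul_mul_assoc]
  exact Submodule.smul_mem _ _ (h g)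

theorem derivable_qalloc (hEnt : ∀ ψ φ, Entails ψ φ → Ent ψ φ) {q : QName} {ψ φ : Assr}
    (h : denA ψ ≤ wp (.qalloc q) (denA φ)) : Derivable Ent ψ (.qalloc q) φ := by
  obtain ⟨N, hN⟩ := exists_local_denA (A := insert q (qbit_finite φ).toFinset) φ (by simp)
  have hloc := hN.allocPre (inl_mem_qset.2 (Finset.mem_insert_self _ _)) inr_notMem_qset
  have he : ∀ A : Finset QName, (qset A).erase (Sum.inl q) = qset (A.erase q) := fun A =>
    (Finset.map_erase _ A q).symm
  rw [he] at hloc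
  obtain ⟨l, hl, hq⟩ := hloc.exists_normal_form
  have hfr : qbit (orList l) ∩ alloc (.qalloc q) = ∅ := by
    rw [Set.eq_empty_iff_forall_notMem]
    rintro x ⟨hx, hxq⟩
    have hxq : x = q := hxq
    have := qbit_orList_subset (fun ψ hψ => (hq ψ hψ).1) hx
    rw [Finset.mem_coe, hxq] at this
    exact Finset.notMem_erase _ _ this
  refine ((Derivable.qalloc q).frame hfr).of_le hEnt ?_ ?_
  · intro d a ha
    rw [denA_sep, hl]
    exact one_mul_mem_star_emp (h d ha)
  · rw [denA_sep, star_le, hl]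
    intro d d' hd' u hu v hv
    by_cases hne : d' = qdom (single q)
    · subst hne
      refine mul_mem_of_ket (q := single q) (fun g => ?_) (denA_le_cyl _ _ hu)
      -- The name `q` is not in the domain of `v`, so that nothing is renamed.
      obtain ⟨s, hs⟩ := exists_dangle_notMem (d \ qdom (single q))
      have h1 := (mem_allocPre.1 hv).2 s hs g
      have hqd : Sum.inl q ∉ d \ qdom (single q) := fun h =>
        (Finset.mem_sdiff.1 h).2 (nm_mem_qdom (single q) 0)
      rw [ren_eq_self (mem_allocPre.1 hv).1 hqd hs, renameDom_eq_self hqd hs] at h1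
      have h2 : insert (Sum.inl q) (d \ qdom (single q)) = d := by
        rw [qdom_single] at hd' ⊢
        rw [Finset.sdiff_singleton_eq_erase,
          Finset.insert_erase (Finset.singleton_subset_iff.1 hd')]
      rwa [h2] at h1
    · rw [denA_pointsTo_eq_bot hne, Submodule.mem_bot] at hu
      rw [hu, zero_mul]
      exact Submodule.zero_mem _

theorem derivable_qfree (hEnt : ∀ ψ φ, Entails ψ φ → Ent ψ φ) {q : QName} {ψ φ : Assr}
    (h : denA ψ ≤ wp (.qfree q) (denA φ)) : Derivable Ent ψ (.qfree q) φ := by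
  refine ((Derivable.qfree q).frame (χ := φ) (Set.inter_empty _)).of_le hEnt ?_ ?_
  · refine h.trans fun d a ha => ?_
    by_cases hq : Sum.inl q ∈ d
    · rw [wp, mem_freePre hq] at ha
      rw [denA_sep, eq_sum_ket (single q) a]
      refine Submodule.sum_mem _ fun g _ => mul_mem_star (d' := qdom (single q)) ?_ ?_ ?_ (ha.2 g)
      · rwa [qdom_single, Finset.singleton_subset_iff]
      · rw [qdom_single, Finset.sdiff_singleton_eq_erase]
      · rw [denA_pointsTo_one]
        exact ket_mem_cyl _ g
    · rw [wp, freePre_eq_bot hq, Submodule.mem_bot] at ha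
      rw [ha]
      exact Submodule.zero_mem _
  · rw [denA_sep]
    exact star_emp_le _

theorem derivable_reset (hEnt : ∀ ψ φ, Entails ψ φ → Ent ψ φ) {n : ℕ} {q : Fin n ↪ QName}
    {ψ φ : Assr} (h : denA ψ ≤ wp (.reset q) (denA φ)) : Derivable Ent ψ (.reset q) φ := by
  refine ((Derivable.reset q).frame (χ := .wand (.pointsTo q (Proj.zeroKet n)) φ)
    (Set.inter_empty _)).of_le hEnt ?_ ?_
  · refine h.trans fun d a ha => ?_
    by_cases hq : qdom q ⊆ d
    · rw [wp, mem_pre hq] at ha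
      rw [denA_sep, denA_wand, eq_sum_ket q a]
      refine Submodule.sum_mem _ fun g _ => mul_mem_star hq rfl ?_ (mem_wandF.2
        ⟨assign_mem_cyl g ha.1, fun d' _ u hu => ?_⟩)
      · rw [denA_pointsTo_one]
        exact ket_mem_cyl _ g
      · by_cases hne : d' = qdom q
        · subst hne
          -- A vector on `q` that `|0⟩⟨0|` fixes is a multiple of `|0⟩`.
          obtain ⟨hc, hu⟩ := mem_denA_pointsTo.1 hu
          have h1 := assign_mem_cyl (q := q) 0 hc
          rw [Finset.sdiff_self] at h1
          have h2 : assign q 0 u = assign q 0 u 0 • (1 : Amp) := by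
            ext f
            simpa using h1 f 0 (by simp)
          have h3 : u = assign q 0 u 0 • ket q 0 := by
            conv_lhs => rw [← hu, Proj.zeroKet, opA_single, h2, mul_smul_comm, mul_one]
          have h4 := ha.2 g
          rw [opA_single] at h4
          rw [h3, smul_mul_assoc, Finset.union_sdiff_of_subset hq]
          exact Submodule.smul_mem _ _ h4
        · rw [denA_pointsTo_eq_bot hne, Submodule.mem_bot] at hu
          rw [hu, zero_mul]
          exact Submodule.zero_mem _
    · rw [wp, pre_eq_bot hq, Submodule.mem_bot] at ha
      rw [ha]
      exact Submodule.zero_mem _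
  · rw [denA_sep, denA_wand, star_le]
    intro d d' hd' u hu v hv
    have := (mem_wandF.1 hv).2 d' Finset.disjoint_sdiff u hu
    rwa [Finset.union_sdiff_of_subset hd'] at this

theorem opA_injective {n : ℕ} (q : Fin n ↪ QName) {A B : Op (Fin n)}
    (h : ∀ a, opA q A a = opA q B a) : A = B := by
  have key : ∀ (C : Op (Fin n)) (f g : Fin n → Fin 2),
      opA q C (ket q g) (Function.extend (nm q) f 0) = C f g := by
    intro C f g
    have hext : ∀ (g : Fin n → Fin 2) (f : Label),
        (fun i => Function.extend (nm q) g f (nm q i)) = g := fun g f =>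
      funext fun i => (nm_injective q).extend_apply g f i
    simp [opA_apply, ket, hext]
  ext f g
  rw [← key A, ← key B, h]

theorem lift_conjTranspose_mul_lift {n n' : ℕ} {q : Fin n ↪ QName} {q' : Fin n' ↪ QName}
    {e : Fin n ↪ Fin n'} (he : ∀ i, q' (e i) = q i)
    (U : Matrix.unitaryGroup (Fin n → Fin 2) ℂ) : (lift e U.1)ᴴ * lift e U.1 = 1 := by
  refine opA_injective q' fun a => ?_
  have hUU : (U.1)ᴴ * U.1 = 1 := Matrix.mem_unitaryGroup_iff'.1 U.2
  rw [← opA_opA, ← lift_conjTranspose, opA_lift he, opA_lift he, opA_opA, hUU, opA_one, opA_one]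

/-- The projection onto the image of a subspace under a unitary operator on some of the qubits. -/
theorem exists_proj_conj {n n' : ℕ} {q : Fin n ↪ QName} {q' : Fin n' ↪ QName}
    {e : Fin n ↪ Fin n'} (he : ∀ i, q' (e i) = q i)
    (U : Matrix.unitaryGroup (Fin n → Fin 2) ℂ) (P : Proj n') :
    ∃ P' : Proj n', P'.1 = lift e U.1 * P.1 * (lift e U.1)ᴴ := by
  have h1 := lift_conjTranspose_mul_lift he U
  refine ⟨⟨lift e U.1 * P.1 * (lift e U.1)ᴴ, ?_, ?_⟩, rfl⟩
  · rw [IsIdempotentElem]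
    calc lift e U.1 * P.1 * (lift e U.1)ᴴ * (lift e U.1 * P.1 * (lift e U.1)ᴴ)
        = lift e U.1 * P.1 * ((lift e U.1)ᴴ * lift e U.1) * P.1 * (lift e U.1)ᴴ := by
          simp only [Matrix.mul_assoc]
      _ = lift e U.1 * (P.1 * P.1) * (lift e U.1)ᴴ := by
          rw [h1, Matrix.mul_one, Matrix.mul_assoc (lift e U.1)]
      _ = _ := by rw [P.2.1.eq]
  · have h2 : (P.1)ᴴ = P.1 := P.2.2
    rw [IsSelfAdjoint, Matrix.star_eq_conjTranspose, Matrix.conjTranspose_mul,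
      Matrix.conjTranspose_mul, Matrix.conjTranspose_conjTranspose, h2, Matrix.mul_assoc]

theorem derivable_unitary_bot (hEnt : ∀ ψ φ, Entails ψ φ → Ent ψ φ) {n : ℕ}
    (U : Matrix.unitaryGroup (Fin n → Fin 2) ℂ) (q : Fin n ↪ QName) (φ : Assr) :
    Derivable Ent .bot (.unitary U q) φ := by
  have he : ∀ i, q (Function.Embedding.refl _ i) = q i := fun _ => rfl
  obtain ⟨P', hP'⟩ := exists_proj_conj he U (Proj.one n)
  refine ((Derivable.unitary U q q _ he _ P' hP').frame (χ := .bot)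
    (Set.inter_empty _)).of_le hEnt ?_ ?_
  · intro d
    rw [denA_bot]
    exact bot_le
  · rw [denA_sep, star_le]
    intro d d' _ u _ v hv
    rw [denA_bot, Submodule.mem_bot] at hv
    rw [hv, mul_zero]
    exact Submodule.zero_mem _

theorem derivable_unitary (hEnt : ∀ ψ φ, Entails ψ φ → Ent ψ φ) {n : ℕ}
    {U : Matrix.unitaryGroup (Fin n → Fin 2) ℂ} {q : Fin n ↪ QName}
    {ψ φ : Assr} (h : denA ψ ≤ wp (.unitary U q) (denA φ)) :
    Derivable Ent ψ (.unitary U q) φ := by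
  let A := (qbit_finite φ).toFinset ∪ stmtNames (.unitary U q)
  have hqA : qdom q ⊆ qset A := qdom_subset_qset.2 Finset.subset_union_right
  obtain ⟨N, hN⟩ := exists_local_denA (A := A) φ (by simp [A])
  obtain ⟨l, hl, hform⟩ := (hN.wp (.unitary U q) Finset.subset_union_right).exists_normal_form
  refine Derivable.of_le hEnt (ψ' := orList l) (φ' := φ) ?_ (h.trans hl.ge) le_rfl
  refine Derivable.orList hEnt (derivable_unitary_bot hEnt U q φ) fun τ hτ => ?_
  have hle : denA τ ≤ wp (.unitary U q) (denA φ) := (denA_le_denA_orList hτ).trans hl.le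
  obtain ⟨-, n', q', P, χ, rfl, hdom⟩ := hform τ hτ
  by_cases hsub : qdom q ⊆ qdom q'
  · have he : ∀ i, ∃ j, q' j = q i := by
      intro i
      obtain ⟨j, hj⟩ := (mem_qdom_iff q' _).1 (hsub (nm_mem_qdom q i))
      exact ⟨j, Sum.inl_injective hj⟩
    choose e he using he
    have heinj : Function.Injective e := fun i j hij => q.injective (by rw [← he, ← he, hij])
    have he' : ∀ i, q' ((⟨e, heinj⟩ : Fin n ↪ Fin n') i) = q i := he
    obtain ⟨P', hP'⟩ := exists_proj_conj he' U P
    refine ((Derivable.unitary U q q' _ he' P P' hP').frame (χ := χ)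
      (Set.inter_empty _)).of_le hEnt le_rfl ?_
    rw [denA_sep, star_le]
    intro d d' hd' u hu v hv
    by_cases hne : d' = qdom q'
    · subst hne
      -- The vector `u` is the image under `U` of a vector in the range of `P`.
      obtain ⟨hc, hu⟩ := mem_denA_pointsTo.1 hu
      have hU' : (lift ⟨e, heinj⟩ U.1)ᴴ * lift ⟨e, heinj⟩ U.1 = 1 :=
        lift_conjTranspose_mul_lift he' U
      have hUU : U.1 * (U.1)ᴴ = 1 := Matrix.mem_unitaryGroup_iff.1 U.2
      have hw : opA q (U.1)ᴴ u ∈ denA (.pointsTo q' P) (qdom q') := by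
        refine mem_denA_pointsTo.2 ⟨opA_mem_cyl _ hsub hc, ?_⟩
        conv_rhs => rw [← hu, hP', ← opA_lift he' (U.1)ᴴ, opA_opA, lift_conjTranspose]
        rw [← opA_lift he' (U.1)ᴴ, opA_opA, lift_conjTranspose, ← Matrix.mul_assoc,
          ← Matrix.mul_assoc, hU', Matrix.one_mul]
      have h1 := hle d (by
        rw [denA_sep]
        exact mul_mem_star hd' rfl hw hv)
      rw [wp, mem_pre (hsub.trans hd')] at h1
      have h2 := h1.2 ()
      rwa [opA_mul_right _ _ (denA_le_cyl _ _ hv)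
        (Finset.disjoint_of_subset_right hsub Finset.sdiff_disjoint), opA_opA, hUU,
        opA_one] at h2
    · rw [denA_pointsTo_eq_bot hne, Submodule.mem_bot] at hu
      rw [hu, zero_mul]
      exact Submodule.zero_mem _
  · refine (derivable_unitary_bot hEnt U q φ).of_le hEnt (fun d => ?_) le_rfl
    rw [denA_bot]
    by_cases hd : d ∩ qset A = qdom q'
    · have hq : ¬ qdom q ⊆ d := fun hq => hsub (hd ▸ Finset.subset_inter hq hqA)
      exact (hle d).trans (pre_eq_bot hq).le
    · exact (hdom d hd).le

theorem derivable_of_le_wp (hEnt : ∀ ψ φ, Entails ψ φ → Ent ψ φ) (S : Stmt) :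
    ∀ {ψ φ : Assr}, denA ψ ≤ wp S (denA φ) → Derivable Ent ψ S φ := by
  induction S with
  | skip => exact fun h => (Derivable.skip _).of_le hEnt h le_rfl
  | qalloc q => exact derivable_qalloc hEnt
  | qfree q => exact derivable_qfree hEnt
  | reset q => exact derivable_reset hEnt
  | unitary U q => exact derivable_unitary hEnt
  | seq S₁ S₂ ih₁ ih₂ =>
    intro ψ φ h
    obtain ⟨χ, hχ⟩ := exists_denA_eq_wp S₂ φ
    exact .seq (φ := χ) (ih₁ (by rwa [hχ])) (ih₂ hχ.le)
  | ifMeas M q S ih =>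
    intro ψ φ h
    choose χ hχ using fun m => exists_denA_eq_wp (S m) φ
    refine (Derivable.ifMeas M q S χ φ fun m => ih m (hχ m).le).of_le hEnt ?_ le_rfl
    rw [denA_ifPre]
    exact h.trans (pre_mono fun m => (hχ m).ge)
  | whileMeas M q S ih =>
    intro ψ φ h
    -- `χ` is the precondition of the loop and `τ` the precondition of its body.
    obtain ⟨χ, hχ⟩ := exists_denA_eq_wp (.whileMeas M q S) φ
    obtain ⟨τ, hτ⟩ := exists_denA_eq_wp S χ
    have heq : denA (whilePre M q φ τ) = denA χ := by
      rw [denA_whilePre, hχ, wp_while_eq, unroll, ← hχ, hτ]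
    refine (Derivable.whileMeas M q S φ τ (ih ?_)).of_le hEnt ?_ le_rfl
    · rw [heq, hτ]
    · rw [heq, hχ]
      exact h

end Completeness

end

end QwhileHP

theorem mainTheorem1 :
    (∀ (ψ : QwhileHP.Assr) (S : QwhileHP.Stmt) (φ : QwhileHP.Assr),
      QwhileHP.Valid ψ S φ ↔ QwhileHP.Derivable QwhileHP.Entails ψ S φ) ∧
    (∀ Ent : QwhileHP.Assr → QwhileHP.Assr → Prop,
      (∀ ψ φ, Ent ψ φ → QwhileHP.Entails ψ φ) →
      ∀ (ψ : QwhileHP.Assr) (S : QwhileHP.Stmt) (φ : QwhileHP.Assr),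
        QwhileHP.Derivable Ent ψ S φ → QwhileHP.Valid ψ S φ) ∧
    (∀ Ent : QwhileHP.Assr → QwhileHP.Assr → Prop,
      (∀ ψ φ, QwhileHP.Entails ψ φ → Ent ψ φ) →
      ∀ (ψ : QwhileHP.Assr) (S : QwhileHP.Stmt) (φ : QwhileHP.Assr),
        QwhileHP.Valid ψ S φ → QwhileHP.Derivable Ent ψ S φ) := by
  have sound : ∀ Ent : QwhileHP.Assr → QwhileHP.Assr → Prop,
      (∀ ψ φ, Ent ψ φ → QwhileHP.Entails ψ φ) →
      ∀ (ψ : QwhileHP.Assr) (S : QwhileHP.Stmt) (φ : QwhileHP.Assr),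
        QwhileHP.Derivable Ent ψ S φ → QwhileHP.Valid ψ S φ :=
    fun _ hEnt _ _ _ h => QwhileHP.valid_iff.2 (h.sound hEnt)
  have complete : ∀ Ent : QwhileHP.Assr → QwhileHP.Assr → Prop,
      (∀ ψ φ, QwhileHP.Entails ψ φ → Ent ψ φ) →
      ∀ (ψ : QwhileHP.Assr) (S : QwhileHP.Stmt) (φ : QwhileHP.Assr),
        QwhileHP.Valid ψ S φ → QwhileHP.Derivable Ent ψ S φ :=
    fun _ hEnt _ S _ h => QwhileHP.derivable_of_le_wp hEnt S (QwhileHP.valid_iff.1 h)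
  exact ⟨fun ψ S φ => ⟨complete _ (fun _ _ h => h) ψ S φ, sound _ (fun _ _ h => h) ψ S φ⟩,
    sound, complete⟩
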